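/- Work on two-dimensional anti-de Sitter space with coordinates $t\in\mathbb R$, $\rho\in(-\pi/2,\pi/2)$, metric $\sec^2\rho\,(-dt^2+d\rho^2)$, gamma matrices $\gamma^0=\begin{pmatrix}0&i\\ i&0\end{pmatrix}$, $\gamma^1=\begin{pmatrix}-1&0\\0&1\end{pmatrix}$, $\Sigma^{01}=\tfrac14[\gamma^0,\gamma^1]$, and on $\mathbb C^2$-valued spinor fields put $$L_0=i\partial_t,\qquad L_\pm=e^{\mp it}\left(\pm i\cos\rho\,\partial_\rho+\sin\rho\,\partial_t+\cos\rho\,\Sigma^{01}\right),\qquad \langle\psi_1,\psi_2\rangle_D=\int_{-\pi/2}^{\pi/2}\psi_1^\dagger\psi_2\,\frac{d\rho}{\cos\rho}.$$ Consider a family of modes $(\psi_j)_{j\in\mathbb Z}$, $\psi_j=(\cos\rho)^{1/2}\Psi_j$, with frequencies $\omega_j$, of one of the following kinds. (A) Massless modes without zero frequency. Let $\beta_\pm\in[0,\pi]$, $\beta=(\beta_++\beta_-)/\pi$, $B=(\beta_+-\beta_-)/2$, $\nu_k=k+1-\beta$, and $$\Psi^{\beta_\pm}_{k}=\pi^{-1/2}e^{-i\nu_kt}\begin{pmatrix}\cos(\nu_k\rho-B)\\-\sin(\nu_k\rho-B)\end{pmatrix}\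 (k\text{ even}),\qquad \Psi^{\beta_\pm}_{k}=\pi^{-1/2}e^{-i\nu_kt}\begin{pmatrix}\sin(\nu_k\rho-B)\\\cos(\nu_k\rho-B)\end{pmatrix}\ (k\text{ odd}).$$ Let $\mu=\nu_{j_0}$ be the lowest positive frequency; assume $0<\mu<1$ and $\mu\neq 1/2$. Put $\Psi_j=\Psi^{\beta_\pm}_{j_0+j}$, so $\omega_j=\mu+j$, and $\lambda=\tfrac12(\mu-\tfrac12)^2$. (B) Modes with $\omega_j=j$: either $M=0$ and the massless modes above with $\nu_{j_0}=0$ and $\Psi_j=\Psi^{\beta_\pm}_{j_0+j}$; or $0\le M<1/2$ and the Dirichlet type III modes $$\Psi_{\pm n}=N_n\left(\tfrac{1+\sin\rho}{1-\sin\rho}\right)^{M/2}\begin{pmatrix}\cos\rho\,P_{n-1}^{(1/2-M,1/2+M)}(\sin\rho)\\ \mp2P_n^{(-1/2-M,-1/2+M)}(\sin\rho)\end{pmatrix}e^{\mp int}\ (n\ge1),\qquad \Psi_0=N_0\left(\tfrac{1+\sin\rho}{1-\sin\rho}\right)^{M/2}\begin{pmatrix}0\\-2\end{pmatrix},$$ or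 the Dirichlet type IV modes $$\Psi_{\pm n}=N_n\left(\tfrac{1-\sin\rho}{1+\sin\rho}\right)^{M/2}\begin{pmatrix}2P_n^{(-1/2+M,-1/2-M)}(\sin\rho)\\ \pm\cos\rho\,P_{n-1}^{(1/2+M,1/2-M)}(\sin\rho)\end{pmatrix}e^{\mp int}\ (n\ge1),\qquad \Psi_0=N_0\left(\tfrac{1-\sin\rho}{1+\sin\rho}\right)^{M/2}\begin{pmatrix}2\\0\end{pmatrix},$$ where $P_n^{(a,b)}$ are the Jacobi polynomials and $N_n=n!\,\big/\,2\sqrt{\Gamma(\tfrac12+M+n)\Gamma(\tfrac12-M+n)}$. In case (B) put $\lambda=\tfrac12(\tfrac14-M^2)$. On the fermionic Fock space with vacuum $|0\rangle$ let $a_j$ ($j\ge0$) and $b_j$ ($j<0$) be annihilation operators, $\{a_j,a_k^\dagger\}=\delta_{jk}=\{b_j,b_k^\dagger\}$, all other anticommutators zero. Let $\psi=\sum_{j\ge0}a_j\psi_j+\sum_{j<0}b_j^\dagger\psi_j=\sum_j\hat\psi_j\psi_j$ be the quantum field. For $w>0$ let $\mathscr D^+_w$ be the positive discrete series of $\widetilde{\mathrm{SL}}(2,\mathbb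 R)$ of lowest weight $w$, given infinitesimally by its orthonormal weight basis $(e_n)_{n\ge0}$ and $$L_0e_n=(w+n)e_n,\quad L_+e_n=-i\sqrt{(n+1)(n+2w)}\,e_{n+1},\quad L_-e_n=-i\sqrt{n(n+2w-1)}\,e_{n-1}.$$ Then in both cases the modes are orthonormal for $\langle\cdot,\cdot\rangle_D$, satisfy $L_0\psi_j=\omega_j\psi_j$, and the charges $$\hat L_\pm=\langle\psi,L_\pm\psi\rangle_D=\sum_{j,k\in\mathbb Z}\langle\psi_j,L_\pm\psi_k\rangle_D\,\hat\psi_j^\dagger\hat\psi_k,\qquad \hat L_0=\sum_{j\ge0}\omega_j\,a_j^\dagger a_j-\sum_{j<0}\omega_j\,b_j^\dagger b_j+\lambda\,\mathbb I$$ are well-defined on finite-particle vectors (finitely many nonzero terms on each), independent of $t$, and satisfy there $$[\hat L_+,\hat L_-]=2\hat L_0,\qquad[\hat L_0,\hat L_\pm]=\pm\hat L_\pm,\qquad \hat L_0^\dagger=\hat L_0,\qquad\hat L_\pm^\dagger=-\hat L_\mp .$$ The finite-particle space is spanned by eigenvectors of $\hat L_0$, all eigenvalues are real, and the least one is $\lambda$.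 Moreover: In case (A), $\hat L_0|0\rangle=\lambda|0\rangle$ and $\hat L_-|0\rangle=0$, and the module generated by $|0\rangle$ under $\hat L_0,\hat L_\pm$ is irreducible and (with its Hilbert space completion) unitarily equivalent to $\mathscr D^+_\lambda$, $\lambda=(\mu-1/2)^2/2$. In case (B), the eigenspace of $\hat L_0$ for its lowest eigenvalue $\lambda=(1/4-M^2)/2$ is two-dimensional, spanned by $|0\rangle$ and $a_0^\dagger|0\rangle$. For every $\alpha\in\mathbb C$ the vector $|0;\alpha\rangle=\alpha|0\rangle+(1-|\alpha|^2)^{1/2}a_0^\dagger|0\rangle$ (principal square root; a unit vector if $|\alpha|\le1$) satisfies $\hat L_0|0;\alpha\rangle=\lambda|0;\alpha\rangle$ and $\hat L_-|0;\alpha\rangle=0$, and the module it generates is irreducible and (with its Hilbert space completion) unitarily equivalent to $\mathscr D^+_{(1/4-M^2)/2}$. -/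

import Mathlib

namespace AdS2Dirac

noncomputable section

/-! ## Spinor fields on two-dimensional anti-de Sitter space

Coordinates are `t : ℝ` and `ρ ∈ (-π/2, π/2)`, with metric `sec² ρ (-dt² + dρ²)`. A spinor field is
written `ψ t ρ : Fin 2 → ℂ`; only its values for `ρ ∈ (-π/2, π/2)` matter. -/

abbrev SpinorField := ℝ → ℝ → Fin 2 → ℂ

/-- `Σ⁰¹ = [γ⁰, γ¹] / 4` for `γ⁰ = !![0, i; i, 0]`, `γ¹ = !![-1, 0; 0, 1]`. -/
def sigma01 : Matrix (Fin 2) (Fin 2) ℂ :=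
  !![0, Complex.I / 2; -(Complex.I / 2), 0]

/-- Spinorial Lie derivative along the Killing field
`ξ₁ = cos t sin ρ ∂_t + sin t cos ρ ∂_ρ`. -/
def lieKilling1 (ψ : SpinorField) : SpinorField := fun t ρ =>
  (Real.cos t * Real.sin ρ) • deriv (fun s => ψ s ρ) t
    + (Real.sin t * Real.cos ρ) • deriv (ψ t) ρ
    + (Real.cos t * Real.cos ρ) • Matrix.mulVec sigma01 (ψ t ρ)

/-- Spinorial Lie derivative along the Killing field
`ξ₂ = -sin t sin ρ ∂_t + cos t cos ρ ∂_ρ`. -/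
def lieKilling2 (ψ : SpinorField) : SpinorField := fun t ρ =>
  (-(Real.sin t * Real.sin ρ)) • deriv (fun s => ψ s ρ) t
    + (Real.cos t * Real.cos ρ) • deriv (ψ t) ρ
    - (Real.sin t * Real.cos ρ) • Matrix.mulVec sigma01 (ψ t ρ)

/-- The operator `L_0 = i 𝓛_{ξ₀}` of the Killing field `ξ₀ = ∂_t`. -/
def timeTranslation (ψ : SpinorField) : SpinorField := fun t ρ =>
  Complex.I • deriv (fun s => ψ s ρ) t

/-- The raising operator `L₊ = 𝓛_{ξ₁} + i 𝓛_{ξ₂}`. -/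
def ladderPlus (ψ : SpinorField) : SpinorField := lieKilling1 ψ + Complex.I • lieKilling2 ψ

/-- The lowering operator `L₋ = 𝓛_{ξ₁} - i 𝓛_{ξ₂}`. -/
def ladderMinus (ψ : SpinorField) : SpinorField := lieKilling1 ψ - Complex.I • lieKilling2 ψ

/-- The density `ψ₁† ψ₂ / cos ρ` of the conserved Dirac inner product. -/
def diracDensity (ψ₁ ψ₂ : SpinorField) (t ρ : ℝ) : ℂ :=
  dotProduct (star (ψ₁ t ρ)) (ψ₂ t ρ) / (Real.cos ρ : ℂ)

/-- The Dirac inner product `⟨ψ₁, ψ₂⟩_D` on the slice of constant `t`. -/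
def diracInner (ψ₁ ψ₂ : SpinorField) (t : ℝ) : ℂ :=
  ∫ ρ in (-(Real.pi / 2))..(Real.pi / 2), diracDensity ψ₁ ψ₂ t ρ

/-- The spinor `ψ = (cos ρ)^{1/2} Ψ` built from the rescaled spinor `Ψ`. -/
def rescale (Ψ : SpinorField) : SpinorField := fun t ρ => Real.sqrt (Real.cos ρ) • Ψ t ρ

/-! ## Mode solutions -/

/-- Frequencies `ω_j = j + 1 - β`, `β = (β₊ + β₋) / π`, of the massless field with the boundary
conditions `cos β_± Φ⁽¹⁾(±π/2) = ∓ sin β_± Φ⁽²⁾(±π/2)`. -/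
def masslessFreq (βp βm : ℝ) (j : ℤ) : ℝ := j + 1 - (βp + βm) / Real.pi

/-- Normalised massless mode functions for the same boundary conditions. -/
def masslessMode (βp βm : ℝ) (j : ℤ) : SpinorField := rescale fun t ρ =>
  ((1 / Real.sqrt Real.pi : ℝ) * Complex.exp (-(Complex.I * (masslessFreq βp βm j : ℂ) * (t : ℂ))))
    • (if Even j then
        ![(Real.cos (masslessFreq βp βm j * ρ - (βp - βm) / 2) : ℂ),
          -(Real.sin (masslessFreq βp βm j * ρ - (βp - βm) / 2) : ℂ)]
      else
        ![(Real.sin (masslessFreq βp βm j * ρ - (βp - βm) / 2) : ℂ),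
          (Real.cos (masslessFreq βp βm j * ρ - (βp - βm) / 2) : ℂ)])

/-- The Jacobi polynomial
`P_n^{(a,b)}(x) = Γ(n+a+1) / (n! Γ(a+1)) F(n+a+b+1, -n; a+1; (1-x)/2)`. -/
def jacobiP (n : ℕ) (a b x : ℝ) : ℝ :=
  Real.Gamma (n + a + 1) / (n.factorial * Real.Gamma (a + 1)) *
    ∑ k ∈ Finset.range (n + 1),
      (ascPochhammer ℝ k).eval ((n : ℝ) + a + b + 1) * (ascPochhammer ℝ k).eval (-(n : ℝ))
        / ((ascPochhammer ℝ k).eval (a + 1) * k.factorial) * ((1 - x) / 2) ^ k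

/-- Normalisation constant of the type III and type IV modes. -/
def massiveNorm (M : ℝ) (n : ℕ) : ℝ :=
  n.factorial / (2 * Real.sqrt (Real.Gamma (1 / 2 + M + n) * Real.Gamma (1 / 2 - M + n)))

/-- Mode functions of mass `M` and frequency `n : ℤ` for the Dirichlet type III boundary
condition. -/
def typeIIIMode (M : ℝ) (n : ℤ) : SpinorField := rescale fun t ρ =>
  ((massiveNorm M n.natAbs * ((1 + Real.sin ρ) / (1 - Real.sin ρ)) ^ (M / 2) : ℝ)
      * Complex.exp (-(Complex.I * (n : ℂ) * (t : ℂ))))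
    • (if n = 0 then ![(0 : ℂ), -2]
      else
        ![((Real.cos ρ * jacobiP (n.natAbs - 1) (1 / 2 - M) (1 / 2 + M) (Real.sin ρ) : ℝ) : ℂ),
          ((-2 * n.sign * jacobiP n.natAbs (-(1 / 2) - M) (-(1 / 2) + M) (Real.sin ρ) : ℝ) : ℂ)])

/-- Mode functions of mass `M` and frequency `n : ℤ` for the Dirichlet type IV boundary
condition. -/
def typeIVMode (M : ℝ) (n : ℤ) : SpinorField := rescale fun t ρ =>
  ((massiveNorm M n.natAbs * ((1 - Real.sin ρ) / (1 + Real.sin ρ)) ^ (M / 2) : ℝ)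
      * Complex.exp (-(Complex.I * (n : ℂ) * (t : ℂ))))
    • (if n = 0 then ![(2 : ℂ), 0]
      else
        ![((2 * jacobiP n.natAbs (-(1 / 2) + M) (-(1 / 2) - M) (Real.sin ρ) : ℝ) : ℂ),
          ((n.sign * (Real.cos ρ * jacobiP (n.natAbs - 1) (1 / 2 + M) (1 / 2 - M) (Real.sin ρ))
            : ℝ) : ℂ)])

/-- The modes are orthonormal for the Dirac inner product, at all times. -/
def IsOrthonormalModes (mode : ℤ → SpinorField) : Prop :=
  ∀ (t : ℝ) (j k : ℤ),
    IntervalIntegrable (diracDensity (mode j) (mode k) t) MeasureTheory.volume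
      (-(Real.pi / 2)) (Real.pi / 2) ∧
    diracInner (mode j) (mode k) t = if j = k then 1 else 0

/-! ## Fermionic Fock space

Occupation number representation. A set `S : Finset ℤ` lists the occupied one-particle states:
`j ∈ S` with `j ≥ 0` is a particle in the mode `j`, and `j ∈ S` with `j < 0` is an antiparticle
belonging to the negative-frequency mode `j`. -/

/-- The finite-particle vectors of the Fock space. -/
abbrev FockDomain := Finset ℤ →₀ ℂ

/-- A finitely supported family as a vector of `ℓ²`. -/
def toL2 {ι : Type} : (ι →₀ ℂ) →ₗ[ℂ] lp (fun _ : ι => ℂ) 2 where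
  toFun v := ⟨⇑v, (memℓp_zero v.hasFiniteSupport).of_exponent_ge zero_le⟩
  map_add' _ _ := rfl
  map_smul' _ _ := rfl

/-- The sign `(-1)^{#{i ∈ S, i < j}}`. -/
def fockSign (j : ℤ) (S : Finset ℤ) : ℂ := (-1) ^ (S.filter (· < j)).card

/-- The annihilation operator `c_j`. -/
def annihilate (j : ℤ) : FockDomain →ₗ[ℂ] FockDomain :=
  Finsupp.linearCombination ℂ fun S =>
    if j ∈ S then Finsupp.single (S.erase j) (fockSign j S) else 0

/-- The creation operator `c_j†`. -/
def create (j : ℤ) : FockDomain →ₗ[ℂ] FockDomain :=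
  Finsupp.linearCombination ℂ fun S =>
    if j ∈ S then 0 else Finsupp.single (insert j S) (fockSign j S)

/-- The vacuum `|0⟩`. -/
def vacuum : FockDomain := Finsupp.single ∅ 1

theorem fockSign_mul_self (j : ℤ) (S : Finset ℤ) : fockSign j S * fockSign j S = 1 := by
  unfold fockSign; rw [← pow_add, ← two_mul, pow_mul]; simp

theorem fockSign_erase (j k : ℤ) (S : Finset ℤ) (hk : k ∈ S) :
    fockSign j (S.erase k) = if k < j then -fockSign j S else fockSign j S := by
  unfold fockSign
  rw [Finset.filter_erase]
  split_ifs with h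
  · have hm : k ∈ S.filter (· < j) := by simp [hk, h]
    rw [Finset.card_erase_of_mem hm]
    obtain ⟨n, hn⟩ : ∃ n, (S.filter (· < j)).card = n + 1 :=
      ⟨_, (Nat.succ_pred_eq_of_pos (Finset.card_pos.2 ⟨k, hm⟩)).symm⟩
    rw [hn, pow_succ]; simp
  · rw [Finset.erase_eq_of_notMem (by simp [h])]

theorem fockSign_insert (j k : ℤ) (S : Finset ℤ) (hk : k ∉ S) :
    fockSign j (insert k S) = if k < j then -fockSign j S else fockSign j S := by
  have := fockSign_erase j k (insert k S) (Finset.mem_insert_self k S)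
  rw [Finset.erase_insert hk] at this
  rw [this]; split_ifs <;> simp

theorem annihilate_single (j : ℤ) (S : Finset ℤ) (z : ℂ) : annihilate j (Finsupp.single S z) =
    if j ∈ S then Finsupp.single (S.erase j) (z * fockSign j S) else 0 := by
  simp only [annihilate, Finsupp.linearCombination_single]; split_ifs <;> simp

theorem create_single (j : ℤ) (S : Finset ℤ) (z : ℂ) : create j (Finsupp.single S z) =
    if j ∈ S then 0 else Finsupp.single (insert j S) (z * fockSign j S) := by
  simp only [create, Finsupp.linearCombination_single]; split_ifs <;> simp

/-- `{c_j, c_k†} = δ_{jk}`. -/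
theorem annihilate_create (j k : ℤ) :
    annihilate j ∘ₗ create k + create k ∘ₗ annihilate j = if j = k then LinearMap.id else 0 := by
  refine Finsupp.lhom_ext fun S z => ?_
  simp only [LinearMap.add_apply, LinearMap.comp_apply, annihilate_single, create_single]
  by_cases hjk : j = k
  · subst hjk
    by_cases hj : j ∈ S
    · simp [-Finsupp.single_mul, hj, create_single, fockSign_erase, mul_assoc, fockSign_mul_self]
    · simp [-Finsupp.single_mul, hj, annihilate_single, fockSign_insert, mul_assoc, fockSign_mul_self]
  · by_cases hj : j ∈ S <;> by_cases hk : k ∈ S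
    · simp [-Finsupp.single_mul, hj, hk, create_single, Ne.symm hjk, hjk]
    · simp only [hj, hk, if_true, if_false, annihilate_single, create_single, Finset.mem_insert,
        Finset.mem_erase, hjk, and_false, or_true, fockSign_insert j k S hk, fockSign_erase k j S hj]
      rw [Finset.erase_insert_of_ne (Ne.symm hjk), ← Finsupp.single_add]
      rcases lt_or_gt_of_ne hjk with h | h
      · simp [-Finsupp.single_mul, h, h.not_gt]; try ring_nf
        try simp
      · simp [-Finsupp.single_mul, h, h.not_gt]; try ring_nf
        try simp
    · simp [-Finsupp.single_mul, hj, hk, hjk]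
    · simp [-Finsupp.single_mul, hj, hk, hjk, annihilate_single]

/-- `{c_j, c_k} = 0`. -/
theorem annihilate_annihilate (j k : ℤ) :
    annihilate j ∘ₗ annihilate k + annihilate k ∘ₗ annihilate j = 0 := by
  refine Finsupp.lhom_ext fun S z => ?_
  simp only [LinearMap.add_apply, LinearMap.comp_apply, annihilate_single]
  by_cases hjk : j = k
  · subst hjk
    by_cases hj : j ∈ S <;> simp [-Finsupp.single_mul, hj, annihilate_single]
  · by_cases hj : j ∈ S <;> by_cases hk : k ∈ S
    · simp only [hj, hk, if_true, annihilate_single, Finset.mem_erase, hjk, Ne.symm hjk, ne_eq,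
        not_false_eq_true, and_self, fockSign_erase j k S hk, fockSign_erase k j S hj]
      rw [Finset.erase_right_comm, ← Finsupp.single_add]
      rcases lt_or_gt_of_ne hjk with h | h
      · simp [-Finsupp.single_mul, h, h.not_gt]; try ring_nf
        try simp
      · simp [-Finsupp.single_mul, h, h.not_gt]; try ring_nf
        try simp
    · simp [-Finsupp.single_mul, hj, hk, annihilate_single]
    · simp [-Finsupp.single_mul, hj, hk, annihilate_single]
    · simp [-Finsupp.single_mul, hj, hk]

theorem inner_toL2 {ι : Type} (u v : ι →₀ ℂ) :
    inner ℂ (toL2 u) (toL2 v) = v.sum fun i z => z * star (u i) := by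
  rw [lp.inner_eq_tsum, Finsupp.sum, tsum_eq_sum (s := v.support)]
  · rfl
  · intro i hi
    have : (toL2 v) i = 0 := Finsupp.notMem_support_iff.1 hi
    rw [this, inner_zero_right]

/-- `c_j†` is the adjoint of `c_j` on finite-particle vectors. -/
theorem inner_create (j : ℤ) (u v : FockDomain) :
    inner ℂ (toL2 (create j u)) (toL2 v) = inner ℂ (toL2 u) (toL2 (annihilate j v)) := by
  induction u using Finsupp.induction_linear with
  | zero => simp
  | add x y hx hy => simp only [map_add, inner_add_left, hx, hy]
  | single S z =>
    induction v using Finsupp.induction_linear with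
    | zero => simp
    | add x y hx hy => simp only [map_add, inner_add_right, hx, hy]
    | single R w =>
      rw [create_single, annihilate_single]
      have hs : ∀ S, star (fockSign j S) = fockSign j S := fun S => by simp [-Finsupp.single_mul, fockSign]
      by_cases hS : j ∈ S <;> by_cases hR : j ∈ R
      · have : R.erase j ≠ S := fun h => by simp [-Finsupp.single_mul, ← h] at hS
        simp [-Finsupp.single_mul, hS, hR, inner_toL2, Finsupp.single_apply, this.symm]
      · simp [-Finsupp.single_mul, hS, hR]
      · by_cases h : insert j S = R
        · subst h
          simp [-Finsupp.single_mul, hS, inner_toL2, hs, fockSign_insert]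
          have := hs S
          simp at this
          rw [this]; ring
        · have h' : ¬ (S = R.erase j) := fun e => h (by rw [e, Finset.insert_erase hR])
          simp [-Finsupp.single_mul, hS, hR, inner_toL2, Finsupp.single_apply, h, h']
      · have : insert j S ≠ R := fun h => by simp [-Finsupp.single_mul, ← h] at hR
        simp [-Finsupp.single_mul, hS, hR, inner_toL2, Finsupp.single_apply, this]

/-- The coefficient of the mode `j` in the quantum field
`ψ = ∑_{j ≥ 0} a_j ψ_j + ∑_{j < 0} b_j† ψ_j`. -/
def fieldCoeff (j : ℤ) : FockDomain →ₗ[ℂ] FockDomain :=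
  if 0 ≤ j then annihilate j else create j

/-- The adjoint of `fieldCoeff j`. -/
def fieldCoeffAdj (j : ℤ) : FockDomain →ₗ[ℂ] FockDomain :=
  if 0 ≤ j then create j else annihilate j

/-! ## Charges -/

/-- `Q` is the conserved charge `⟨ψ, X ψ⟩_D` of the quantum field `ψ = ∑_j ψ̂_j ψ_j`:
`Q = ∑_{j,k} ⟨ψ_j, X ψ_k⟩_D ψ̂_j† ψ̂_k` at every time `t`, where only finitely many terms are
nonzero on each finite-particle vector. -/
def IsQuantumCharge (mode : ℤ → SpinorField) (X : SpinorField → SpinorField)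
    (Q : FockDomain →ₗ[ℂ] FockDomain) : Prop :=
  ∀ t : ℝ,
    (∀ j k : ℤ, IntervalIntegrable (diracDensity (mode j) (X (mode k)) t) MeasureTheory.volume
      (-(Real.pi / 2)) (Real.pi / 2)) ∧
    ∀ v : FockDomain,
      (Function.support fun p : ℤ × ℤ =>
        diracInner (mode p.1) (X (mode p.2)) t • fieldCoeffAdj p.1 (fieldCoeff p.2 v)).Finite ∧
      Q v = ∑ᶠ p : ℤ × ℤ,
        diracInner (mode p.1) (X (mode p.2)) t • fieldCoeffAdj p.1 (fieldCoeff p.2 v)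

/-- `Q` is the time-translation charge
`∑_{j ≥ 0} ω_j a_j† a_j - ∑_{j < 0} ω_j b_j† b_j + c 𝕀`. -/
def IsTimeTranslationCharge (freq : ℤ → ℝ) (c : ℝ) (Q : FockDomain →ₗ[ℂ] FockDomain) : Prop :=
  ∀ v : FockDomain,
    (Function.support fun j : ℤ =>
      (if 0 ≤ j then freq j else -freq j) • create j (annihilate j v)).Finite ∧
    Q v = (∑ᶠ j : ℤ, (if 0 ≤ j then freq j else -freq j) • create j (annihilate j v)) + c • v

/-- `L₀, L₊, L₋` are the quantum charges of the theory with the given modes, of frequencies `freq`,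
and `L₀` has the additive constant `c`. -/
structure AreCharges (mode : ℤ → SpinorField) (freq : ℤ → ℝ) (c : ℝ)
    (L₀ Lp Lm : FockDomain →ₗ[ℂ] FockDomain) : Prop where
  plus : IsQuantumCharge mode ladderPlus Lp
  minus : IsQuantumCharge mode ladderMinus Lm
  frequency : ∀ j, timeTranslation (mode j) = fun t ρ => freq j • mode j t ρ
  zero : IsTimeTranslationCharge freq c L₀

/-- The commutation relations `[L₊, L₋] = 2 L₀`, `[L₀, L_±] = ± L_±`, together with the unitarity
conditions `L₀† = L₀`, `L_±† = - L_∓` on the finite-particle vectors. -/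
structure IsUnitarySl2Action (L₀ Lp Lm : FockDomain →ₗ[ℂ] FockDomain) : Prop where
  comm_plus_minus : ∀ v, Lp (Lm v) - Lm (Lp v) = (2 : ℂ) • L₀ v
  comm_zero_plus : ∀ v, L₀ (Lp v) - Lp (L₀ v) = Lp v
  comm_zero_minus : ∀ v, L₀ (Lm v) - Lm (L₀ v) = -Lm v
  adjoint_zero : ∀ u v, inner ℂ (toL2 (L₀ u)) (toL2 v) = inner ℂ (toL2 u) (toL2 (L₀ v))
  adjoint_plus : ∀ u v, inner ℂ (toL2 (Lp u)) (toL2 v) = -inner ℂ (toL2 u) (toL2 (Lm v))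

/-- The Fock space is a weight module with lowest weight `w`: it is spanned by eigenvectors of
`L₀`, whose eigenvalues are real and have least element `w`. -/
def IsWeightModuleWithLowest (L₀ : FockDomain →ₗ[ℂ] FockDomain) (w : ℝ) : Prop :=
  (⨆ z : ℂ, Module.End.eigenspace L₀ z) = ⊤ ∧
  Module.End.HasEigenvalue L₀ (w : ℂ) ∧
  ∀ z : ℂ, Module.End.HasEigenvalue L₀ z → ∃ r : ℝ, w ≤ r ∧ z = r

/-! ## The discrete series -/

/-- `L₀ e_n = (w + n) e_n` in the discrete series `𝒟⁺_w`, on the span of the orthonormal weight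
basis `e_0, e_1, …` of its Hilbert space `ℓ²(ℕ)`. -/
def discreteZero (w : ℝ) : (ℕ →₀ ℂ) →ₗ[ℂ] (ℕ →₀ ℂ) :=
  Finsupp.linearCombination ℂ fun n => Finsupp.single n ((w + n : ℝ) : ℂ)

/-- `L₊ e_n = -i √((n+1)(n+2w)) e_{n+1}` in the discrete series `𝒟⁺_w`. -/
def discretePlus (w : ℝ) : (ℕ →₀ ℂ) →ₗ[ℂ] (ℕ →₀ ℂ) :=
  Finsupp.linearCombination ℂ fun n =>
    Finsupp.single (n + 1) (-(Complex.I * (Real.sqrt ((n + 1) * (n + 2 * w)) : ℂ)))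

/-- `L₋ e_n = -i √(n(n+2w-1)) e_{n-1}` in the discrete series `𝒟⁺_w`; in particular
`L₋ e_0 = 0`. -/
def discreteMinus (w : ℝ) : (ℕ →₀ ℂ) →ₗ[ℂ] (ℕ →₀ ℂ) :=
  Finsupp.linearCombination ℂ fun n =>
    Finsupp.single (n - 1) (-(Complex.I * (Real.sqrt (n * (n + 2 * w - 1)) : ℂ)))

/-- Invariance of a subspace under the three charges. -/
def IsInvariant (L₀ Lp Lm : FockDomain →ₗ[ℂ] FockDomain) (W : Submodule ℂ FockDomain) : Prop :=
  ∀ v ∈ W, L₀ v ∈ W ∧ Lp v ∈ W ∧ Lm v ∈ W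

/-- The smallest invariant subspace containing `Ω`. -/
def generated (L₀ Lp Lm : FockDomain →ₗ[ℂ] FockDomain) (Ω : FockDomain) :
    Submodule ℂ FockDomain :=
  sInf {W | Ω ∈ W ∧ IsInvariant L₀ Lp Lm W}

/-- The module generated by `Ω` is irreducible and, with its closure in the Fock Hilbert space
`ℓ²(Finset ℤ)`, unitarily equivalent to the discrete series `𝒟⁺_w`. -/
def GeneratesDiscreteSeries (L₀ Lp Lm : FockDomain →ₗ[ℂ] FockDomain) (Ω : FockDomain) (w : ℝ) :
    Prop :=
  0 < w ∧
  (∀ W ≤ generated L₀ Lp Lm Ω, IsInvariant L₀ Lp Lm W → W = ⊥ ∨ W = generated L₀ Lp Lm Ω) ∧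
  ∃ (T : (ℕ →₀ ℂ) →ₗ[ℂ] FockDomain)
    (U : lp (fun _ : ℕ => ℂ) 2 →ₗᵢ[ℂ] lp (fun _ : Finset ℤ => ℂ) 2),
    (∀ x, U (toL2 x) = toL2 (T x)) ∧
    LinearMap.range T = generated L₀ Lp Lm Ω ∧
    LinearMap.range U.toLinearMap
      = ((generated L₀ Lp Lm Ω).map toL2).topologicalClosure ∧
    (∀ x, T (discreteZero w x) = L₀ (T x)) ∧
    (∀ x, T (discretePlus w x) = Lp (T x)) ∧
    (∀ x, T (discreteMinus w x) = Lm (T x))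

/-- `|0; α⟩ = α |0⟩ + (1 - |α|²)^{1/2} a_0† |0⟩`, with the principal square root. -/
def vacuumFamily (α : ℂ) : FockDomain :=
  α • vacuum + ((1 - ‖α‖ ^ 2 : ℝ) : ℂ) ^ (1 / 2 : ℂ) • create 0 vacuum

/-- The theories of mass `M` with frequency spectrum `ℤ`: the massless boundary conditions with a
zero frequency, with the zero mode labelled by `0`, and the Dirichlet type III and type IV
theories. -/
def IsZeroModeTheory (M : ℝ) (mode : ℤ → SpinorField) : Prop :=
  (M = 0 ∧ ∃ βp ∈ Set.Icc 0 Real.pi, ∃ βm ∈ Set.Icc 0 Real.pi, ∃ j₀ : ℤ,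
      masslessFreq βp βm j₀ = 0 ∧ mode = fun j => masslessMode βp βm (j₀ + j)) ∨
  (0 ≤ M ∧ M < 1 / 2 ∧ mode = typeIIIMode M) ∨
  (0 ≤ M ∧ M < 1 / 2 ∧ mode = typeIVMode M)

end

end AdS2Dirac

/-! On spatial profiles the symmetry operators are ladder operators: `L₊` sends mode `n` to `i κ_n`
times mode `n+1` and `L₋` sends it back with the same factor, where `κ_n² = (ω_n + 1/2)² - M²`. By
orthonormality the charges are therefore `∑ i κ_k ψ̂_{k+1}† ψ̂_k` and the corresponding lowering sum
(`isQuantumCharge_shiftCharge`); both are finite on each vector because a nonzero shift meets the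
filled sea in only finitely many places.

The differences `κ_n² - κ_{n-1}² = 2 ω_n` are the one-particle relations. They make `[L̂₊, L̂₋] - 2
L̂₀` commute with every field coefficient, and since the vacuum is cyclic such an operator vanishes
once it kills the vacuum (`eq_zero_of_lie_field`). On the vacuum `L̂₊` creates exactly one pair,
from mode `-1` to mode `0`, so the anomaly is `κ_{-1}²` and the additive constant must be `κ_{-1}² /
2` (`isUnitarySl2Action_charges`): `(μ - 1/2)² / 2` or `(1/4 - M²) / 2`. No excitation has negative
energy, so this constant is the lowest weight; it is attained twice exactly when mode `0` has zero
frequency. Any nonzero vector of positive weight killed by `L̂₋` generates a discrete series by the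
usual ladder computation (`generatesDiscreteSeries`).

What remains is analysis of the modes, collected in `LadderModes`. The massless case is
trigonometry. For type III, contiguous relations of the hypergeometric polynomials give the raising
formulas, and orthonormality comes from two total derivatives with vanishing boundary terms plus one
Beta integral for the zero mode (`ladderModes_of_massFactor`). Type IV is type III at mass `-M`,
rotated. -/

namespace AdS2Dirac

noncomputable section

/-! ## Canonical anticommutation relations -/

theorem toL2_injective {ι : Type} : Function.Injective (toL2 : (ι →₀ ℂ) → _) := fun _ _ h =>
  Finsupp.ext fun i => congrArg (fun w : lp (fun _ : ι => ℂ) 2 => w i) h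

theorem inner_annihilate (j : ℤ) (u v : FockDomain) :
    inner ℂ (toL2 (annihilate j u)) (toL2 v) = inner ℂ (toL2 u) (toL2 (create j v)) := by
  rw [← inner_conj_symm, ← inner_create, inner_conj_symm]

/-- Testing against the difference itself suffices; operator identities can then be read off from
their adjoints. -/
theorem eq_of_forall_inner_toL2 {ι : Type} {u v : ι →₀ ℂ}
    (h : ∀ w : ι →₀ ℂ, inner ℂ (toL2 u) (toL2 w) = inner ℂ (toL2 v) (toL2 w)) : u = v := by
  have h' : inner ℂ (toL2 (u - v)) (toL2 (u - v)) = 0 := by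
    rw [map_sub, inner_sub_left, ← map_sub, h, sub_self]
  exact sub_eq_zero.1 (toL2_injective (by simpa using h'))

/-- `{c_j†, c_k†} = 0`. -/
theorem create_create (j k : ℤ) (v : FockDomain) :
    create j (create k v) + create k (create j v) = 0 := by
  refine eq_of_forall_inner_toL2 fun w => ?_
  have := LinearMap.congr_fun (annihilate_annihilate j k) w
  simp only [LinearMap.add_apply, LinearMap.comp_apply, LinearMap.zero_apply] at this
  rw [map_add, inner_add_left, inner_create, inner_create, inner_create, inner_create,
    ← inner_add_right, ← map_add, add_comm, this]
  simp

theorem annihilate_create_apply (j k : ℤ) (v : FockDomain) :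
    annihilate j (create k v) + create k (annihilate j v) = if j = k then v else 0 := by
  have := LinearMap.congr_fun (annihilate_create j k) v
  simp only [LinearMap.add_apply, LinearMap.comp_apply] at this
  rw [this]; split_ifs <;> simp

theorem annihilate_annihilate_apply (j k : ℤ) (v : FockDomain) :
    annihilate j (annihilate k v) + annihilate k (annihilate j v) = 0 :=
  LinearMap.congr_fun (annihilate_annihilate j k) v

/-- The canonical relations are symmetric under exchanging creation and annihilation, so making that
exchange on the negative modes preserves them. -/
theorem fieldCoeff_fieldCoeffAdj (j k : ℤ) (v : FockDomain) :
    fieldCoeff j (fieldCoeffAdj k v) + fieldCoeffAdj k (fieldCoeff j v)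
      = if j = k then v else 0 := by
  unfold fieldCoeff fieldCoeffAdj
  by_cases hj : 0 ≤ j <;> by_cases hk : 0 ≤ k <;> simp only [hj, hk, if_true, if_false]
  · exact annihilate_create_apply j k v
  · rw [annihilate_annihilate_apply, if_neg (by omega)]
  · rw [create_create, if_neg (by omega)]
  · rw [add_comm, annihilate_create_apply]; simp only [eq_comm]

theorem fieldCoeff_fieldCoeff (j k : ℤ) (v : FockDomain) :
    fieldCoeff j (fieldCoeff k v) + fieldCoeff k (fieldCoeff j v) = 0 := by
  unfold fieldCoeff
  by_cases hj : 0 ≤ j <;> by_cases hk : 0 ≤ k <;> simp only [hj, hk, if_true, if_false]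
  · exact annihilate_annihilate_apply j k v
  · rw [annihilate_create_apply, if_neg (by omega)]
  · rw [add_comm, annihilate_create_apply, if_neg (by omega)]
  · exact create_create j k v

theorem fieldCoeffAdj_fieldCoeffAdj (j k : ℤ) (v : FockDomain) :
    fieldCoeffAdj j (fieldCoeffAdj k v) + fieldCoeffAdj k (fieldCoeffAdj j v) = 0 := by
  unfold fieldCoeffAdj
  by_cases hj : 0 ≤ j <;> by_cases hk : 0 ≤ k <;> simp only [hj, hk, if_true, if_false]
  · exact create_create j k v
  · rw [add_comm, annihilate_create_apply, if_neg (by omega)]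
  · rw [annihilate_create_apply, if_neg (by omega)]
  · exact annihilate_annihilate_apply j k v

theorem inner_fieldCoeff (j : ℤ) (u v : FockDomain) :
    inner ℂ (toL2 (fieldCoeff j u)) (toL2 v) = inner ℂ (toL2 u) (toL2 (fieldCoeffAdj j v)) := by
  unfold fieldCoeff fieldCoeffAdj
  split_ifs
  · exact inner_annihilate j u v
  · exact inner_create j u v

theorem inner_fieldCoeffAdj (j : ℤ) (u v : FockDomain) :
    inner ℂ (toL2 (fieldCoeffAdj j u)) (toL2 v) = inner ℂ (toL2 u) (toL2 (fieldCoeff j v)) := by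
  rw [← inner_conj_symm, ← inner_fieldCoeff, inner_conj_symm]

/-! ## Locally finite sums of operators -/

/-- Only finitely many of the operators `A k` act nontrivially on each vector. -/
def IsLocallyFinite (A : ℤ → Module.End ℂ FockDomain) : Prop :=
  ∀ v, (Function.support fun k => A k v).Finite

theorem isLocallyFinite_of_single {A : ℤ → Module.End ℂ FockDomain}
    (h : ∀ S, ∃ F : Finset ℤ, ∀ k ∉ F, ∀ z, A k (Finsupp.single S z) = 0) : IsLocallyFinite A := by
  intro v
  induction v using Finsupp.induction_linear with
  | zero => simp
  | add x y hx hy =>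
    refine (hx.union hy).subset fun k hk => ?_
    by_contra hk'
    simp only [Set.mem_union, Function.mem_support, not_or, not_not] at hk'
    exact hk (by simp [hk'.1, hk'.2])
  | single S z =>
    obtain ⟨F, hF⟩ := h S
    refine F.finite_toSet.subset fun k hk => ?_
    by_contra hk'
    exact hk (hF k hk' z)

/-- The sum of a locally finite family of operators. -/
def sumOperator (A : ℤ → Module.End ℂ FockDomain) (hA : IsLocallyFinite A) :
    Module.End ℂ FockDomain where
  toFun v := ∑ᶠ k, A k v
  map_add' u v := by simp only [map_add]; exact finsum_add_distrib (hA u) (hA v)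
  map_smul' z v := by simp only [map_smul, RingHom.id_apply, smul_finsum]

theorem sumOperator_apply {A : ℤ → Module.End ℂ FockDomain} (hA : IsLocallyFinite A)
    (v : FockDomain) : sumOperator A hA v = ∑ᶠ k, A k v := rfl

/-- The commutator with a locally finite sum in which a single term contributes. -/
theorem lie_sumOperator {A : ℤ → Module.End ℂ FockDomain} (hA : IsLocallyFinite A)
    {B D : Module.End ℂ FockDomain} {j : ℤ} (h : ∀ k, ⁅A k, B⁆ = if k = j then D else 0) :
    ⁅sumOperator A hA, B⁆ = D := by
  refine LinearMap.ext fun v => ?_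
  have hv : ∀ k, A k (B v) - B (A k v) = if k = j then D v else 0 := fun k => by
    have := LinearMap.congr_fun (h k) v
    rw [Ring.lie_def] at this
    simp only [LinearMap.sub_apply, Module.End.mul_apply] at this
    rw [this]; split_ifs <;> simp
  have hB : B (∑ᶠ k, A k v) = ∑ᶠ k, B (A k v) := B.toAddMonoidHom.map_finsum (hA v)
  have hfin : (Function.support fun k => B (A k v)).Finite :=
    (hA v).subset fun k hk hk' => hk (by beta_reduce; rw [show A k v = 0 from hk', map_zero])
  rw [Ring.lie_def, LinearMap.sub_apply, Module.End.mul_apply, Module.End.mul_apply,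
    sumOperator_apply, sumOperator_apply, hB, ← finsum_sub_distrib (hA (B v)) hfin]
  simp only [hv]
  rw [finsum_eq_single _ j fun k hk => if_neg hk, if_pos rfl]

/-! ## Charges bilinear in the field -/

/-- The term `c_k ψ̂_{k+d}† ψ̂_k` of a charge bilinear in the field. -/
def chargeTerm (c : ℤ → ℂ) (d k : ℤ) : Module.End ℂ FockDomain :=
  c k • (fieldCoeffAdj (k + d) * fieldCoeff k)

theorem chargeTerm_apply (c : ℤ → ℂ) (d k : ℤ) (v : FockDomain) :
    chargeTerm c d k v = c k • fieldCoeffAdj (k + d) (fieldCoeff k v) := rfl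

/-- Moving one fermionic operator past a bilinear costs two signs, which cancel; only the
contraction with `fieldCoeff k` survives. In the companion lemma the contraction is with
`fieldCoeffAdj (k + d)`, hence the minus sign and the index `j - d`. -/
theorem lie_chargeTerm_fieldCoeffAdj (c : ℤ → ℂ) (d k j : ℤ) :
    ⁅chargeTerm c d k, fieldCoeffAdj j⁆ = if k = j then c j • fieldCoeffAdj (j + d) else 0 := by
  refine LinearMap.ext fun v => ?_
  simp only [Ring.lie_def, LinearMap.sub_apply, Module.End.mul_apply, chargeTerm_apply, map_smul]
  rw [eq_sub_of_add_eq (fieldCoeff_fieldCoeffAdj k j v), map_sub,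
    eq_neg_of_add_eq_zero_left (fieldCoeffAdj_fieldCoeffAdj j (k + d) _)]
  split_ifs with h
  · subst h; simp [smul_sub]
  · simp

theorem lie_chargeTerm_fieldCoeff (c : ℤ → ℂ) (d k j : ℤ) :
    ⁅chargeTerm c d k, fieldCoeff j⁆
      = if k = j - d then -c (j - d) • fieldCoeff (j - d) else 0 := by
  refine LinearMap.ext fun v => ?_
  simp only [Ring.lie_def, LinearMap.sub_apply, Module.End.mul_apply, chargeTerm_apply, map_smul]
  rw [eq_neg_of_add_eq_zero_left (fieldCoeff_fieldCoeff k j v), map_neg,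
    eq_sub_of_add_eq (fieldCoeff_fieldCoeffAdj j (k + d) _)]
  by_cases h : k = j - d
  · subst h; simp [smul_sub]; abel
  · rw [if_neg (by omega), if_neg h]; simp

/-- A term with `k ≥ 0` needs `k` occupied. A term with `k < 0` either crosses zero, which happens
for finitely many `k`, or needs `k + d` occupied after `k` is filled. Here `d ≠ 0` is essential:
diagonal terms would act as the identity on every empty negative mode. -/
theorem isLocallyFinite_chargeTerm (c : ℤ → ℂ) {d : ℤ} (hd : d ≠ 0) :
    IsLocallyFinite (chargeTerm c d) := by
  refine isLocallyFinite_of_single fun S =>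
    ⟨S ∪ S.image (· - d) ∪ Finset.Ico (-d) 0, fun k hk z => ?_⟩
  simp only [Finset.mem_union, Finset.mem_image, Finset.mem_Ico, not_or, not_exists, not_and,
    not_lt] at hk
  obtain ⟨⟨hk1, hk2⟩, hk3⟩ := hk
  have hk4 : k + d ∉ S := fun h => hk2 _ h (by omega)
  rw [chargeTerm_apply, fieldCoeff]
  split_ifs with h
  · simp [annihilate_single, hk1]
  · rw [fieldCoeffAdj, if_neg (by omega), create_single, if_neg hk1, annihilate_single,
      if_neg (by simp [hk4, hd]), smul_zero]

/-- The charge `∑_k c_k ψ̂_{k+d}† ψ̂_k`. -/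
def shiftCharge (c : ℤ → ℂ) {d : ℤ} (hd : d ≠ 0) : Module.End ℂ FockDomain :=
  sumOperator (chargeTerm c d) (isLocallyFinite_chargeTerm c hd)

theorem lie_shiftCharge_fieldCoeffAdj (c : ℤ → ℂ) {d : ℤ} (hd : d ≠ 0) (j : ℤ) :
    ⁅shiftCharge c hd, fieldCoeffAdj j⁆ = c j • fieldCoeffAdj (j + d) :=
  lie_sumOperator _ fun k => lie_chargeTerm_fieldCoeffAdj c d k j

theorem lie_shiftCharge_fieldCoeff (c : ℤ → ℂ) {d : ℤ} (hd : d ≠ 0) (j : ℤ) :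
    ⁅shiftCharge c hd, fieldCoeff j⁆ = -c (j - d) • fieldCoeff (j - d) :=
  lie_sumOperator _ fun k => lie_chargeTerm_fieldCoeff c d k j

/-- The adjoint of the `k`-th term is, up to sign, the term of index `k + d` in the charge shifting
by `-d`. Reindexing and a common finite support reduce the claim to single terms. -/
theorem inner_shiftCharge {c c' : ℤ → ℂ} {d d' : ℤ} (hd : d ≠ 0) (hd' : d' ≠ 0) (h : d' = -d)
    (hc : ∀ k, c' (k + d) = -star (c k)) (u v : FockDomain) :
    inner ℂ (toL2 (shiftCharge c hd u)) (toL2 v)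
      = -inner ℂ (toL2 u) (toL2 (shiftCharge c' hd' v)) := by
  subst h
  have h1 := isLocallyFinite_chargeTerm c hd u
  have h2 := isLocallyFinite_chargeTerm c' hd' v
  have e : (shiftCharge c' hd' v) = ∑ᶠ k, chargeTerm c' (-d) (k + d) v :=
    (finsum_comp_equiv (Equiv.addRight d)).symm
  have h3 : (Function.support fun k => chargeTerm c' (-d) (k + d) v).Finite :=
    Set.Finite.preimage (f := fun k => k + d) (add_left_injective d).injOn h2
  obtain ⟨F, hF1, hF2⟩ : ∃ F : Finset ℤ, (Function.support fun k => chargeTerm c d k u) ⊆ F ∧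
      (Function.support fun k => chargeTerm c' (-d) (k + d) v) ⊆ F :=
    ⟨h1.toFinset ∪ h3.toFinset, by simp, by simp⟩
  rw [e, finsum_eq_sum_of_support_subset _ hF2, shiftCharge, sumOperator_apply,
    finsum_eq_sum_of_support_subset _ hF1, map_sum, map_sum, sum_inner, inner_sum,
    ← Finset.sum_neg_distrib]
  refine Finset.sum_congr rfl fun k _ => ?_
  rw [chargeTerm_apply, chargeTerm_apply, map_smul, map_smul, inner_smul_left, inner_smul_right,
    inner_fieldCoeffAdj, inner_fieldCoeff, hc, add_neg_cancel_right]
  simp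

/-! ## The time-translation charge -/

/-- The term `s_j c_j† c_j` of the time-translation charge. -/
def numberTerm (s : ℤ → ℝ) (j : ℤ) : Module.End ℂ FockDomain := (s j : ℂ) • (create j * annihilate j)

theorem numberTerm_single (s : ℤ → ℝ) (j : ℤ) (S : Finset ℤ) (z : ℂ) :
    numberTerm s j (Finsupp.single S z) = if j ∈ S then Finsupp.single S (s j * z) else 0 := by
  rw [numberTerm, LinearMap.smul_apply, Module.End.mul_apply, annihilate_single]
  split_ifs with h
  · rw [create_single, if_neg (by simp), Finset.insert_erase h, fockSign_erase j j S h,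
      if_neg (lt_irrefl j), mul_assoc, fockSign_mul_self, mul_one, Finsupp.smul_single, smul_eq_mul]
  · simp

theorem isLocallyFinite_numberTerm (s : ℤ → ℝ) : IsLocallyFinite (numberTerm s) :=
  isLocallyFinite_of_single fun S => ⟨S, fun k hk z => by rw [numberTerm_single, if_neg hk]⟩

/-- The operator `∑_j s_j c_j† c_j + c`. -/
def numberCharge (s : ℤ → ℝ) (c : ℝ) : Module.End ℂ FockDomain :=
  sumOperator (numberTerm s) (isLocallyFinite_numberTerm s) + (c : ℂ) • 1

theorem numberCharge_single (s : ℤ → ℝ) (c : ℝ) (S : Finset ℤ) (z : ℂ) :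
    numberCharge s c (Finsupp.single S z)
      = ((∑ j ∈ S, s j + c : ℝ) : ℂ) • Finsupp.single S z := by
  have : ∑ᶠ j, numberTerm s j (Finsupp.single S z) = ∑ j ∈ S, (s j : ℂ) • Finsupp.single S z := by
    rw [finsum_eq_sum_of_support_subset (s := S)]
    · refine Finset.sum_congr rfl fun j hj => ?_
      rw [numberTerm_single, if_pos hj, Finsupp.smul_single, smul_eq_mul]
    · intro j hj
      by_contra h
      exact hj (by beta_reduce; rw [numberTerm_single, if_neg (by simpa using h)])
  rw [numberCharge, LinearMap.add_apply, sumOperator_apply, this, ← Finset.sum_smul]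
  simp [add_smul]

theorem numberCharge_apply (s : ℤ → ℝ) (c : ℝ) (v : FockDomain) (S : Finset ℤ) :
    numberCharge s c v S = ((∑ j ∈ S, s j + c : ℝ) : ℂ) * v S := by
  induction v using Finsupp.induction_linear with
  | zero => simp
  | add x y hx hy => simp only [map_add, Finsupp.add_apply, hx, hy, mul_add]
  | single R z =>
    rw [numberCharge_single, Finsupp.smul_apply, smul_eq_mul]
    by_cases h : R = S
    · rw [h]
    · simp [h]

theorem lie_numberCharge_create (s : ℤ → ℝ) (c : ℝ) (j : ℤ) :
    ⁅numberCharge s c, create j⁆ = (s j : ℂ) • create j := by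
  refine Finsupp.lhom_ext fun S z => ?_
  rw [Ring.lie_def, LinearMap.sub_apply, Module.End.mul_apply, Module.End.mul_apply,
    LinearMap.smul_apply, numberCharge_single, map_smul, create_single]
  split_ifs with h
  · simp
  · rw [numberCharge_single, Finset.sum_insert h, ← sub_smul]
    push_cast; ring_nf

theorem lie_numberCharge_annihilate (s : ℤ → ℝ) (c : ℝ) (j : ℤ) :
    ⁅numberCharge s c, annihilate j⁆ = -(s j : ℂ) • annihilate j := by
  refine Finsupp.lhom_ext fun S z => ?_
  rw [Ring.lie_def, LinearMap.sub_apply, Module.End.mul_apply, Module.End.mul_apply,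
    LinearMap.smul_apply, numberCharge_single, map_smul, annihilate_single]
  split_ifs with h
  · rw [numberCharge_single, ← Finset.add_sum_erase S s h, ← sub_smul]
    push_cast; ring_nf
  · simp

/-- The energies of the excitations: `ω_j` for particles, `-ω_j` for antiparticles. -/
def excitation (freq : ℤ → ℝ) (j : ℤ) : ℝ := if 0 ≤ j then freq j else -freq j

/-- For `j < 0` the operator removes an excitation of energy `-freq j`; the two signs cancel and
both cases agree. -/
theorem lie_numberCharge_fieldCoeffAdj (freq : ℤ → ℝ) (c : ℝ) (j : ℤ) :
    ⁅numberCharge (excitation freq) c, fieldCoeffAdj j⁆ = (freq j : ℂ) • fieldCoeffAdj j := by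
  unfold fieldCoeffAdj
  split_ifs with h
  · rw [lie_numberCharge_create, excitation, if_pos h]
  · rw [lie_numberCharge_annihilate, excitation, if_neg h]; simp

theorem lie_numberCharge_fieldCoeff (freq : ℤ → ℝ) (c : ℝ) (j : ℤ) :
    ⁅numberCharge (excitation freq) c, fieldCoeff j⁆ = -(freq j : ℂ) • fieldCoeff j := by
  unfold fieldCoeff
  split_ifs with h
  · rw [lie_numberCharge_annihilate, excitation, if_pos h]
  · rw [lie_numberCharge_create, excitation, if_neg h]; simp

/-! ## Operators commuting with the field -/

/-- The vacuum is cyclic: every occupation state arises from it by creation operators, past which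
`C` can be moved. -/
theorem eq_zero_of_lie_create {C : Module.End ℂ FockDomain} (hC : ∀ j, ⁅C, create j⁆ = 0)
    (h0 : C vacuum = 0) : C = 0 := by
  have hcomm : ∀ j v, C (create j v) = create j (C v) := fun j v => by
    have := LinearMap.congr_fun (hC j) v
    rwa [Ring.lie_def, LinearMap.sub_apply, LinearMap.zero_apply, sub_eq_zero] at this
  have key : ∀ S : Finset ℤ, C (Finsupp.single S 1) = 0 := fun S => by
    induction S using Finset.induction_on with
    | empty => exact h0
    | insert j S hj ih =>
      have e : Finsupp.single (insert j S) (1 : ℂ)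
          = fockSign j S • create j (Finsupp.single S 1) := by
        rw [create_single, if_neg hj, Finsupp.smul_single, smul_eq_mul, one_mul, fockSign_mul_self]
      rw [e, map_smul, hcomm, ih, map_zero, smul_zero]
  refine Finsupp.lhom_ext fun S z => ?_
  rw [← mul_one z, ← smul_eq_mul, ← Finsupp.smul_single, map_smul, key]
  simp

theorem eq_zero_of_lie_field {C : Module.End ℂ FockDomain} (h1 : ∀ j, ⁅C, fieldCoeff j⁆ = 0)
    (h2 : ∀ j, ⁅C, fieldCoeffAdj j⁆ = 0) (h0 : C vacuum = 0) : C = 0 := by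
  refine eq_zero_of_lie_create (fun j => ?_) h0
  by_cases h : 0 ≤ j
  · simpa [fieldCoeffAdj, h] using h2 j
  · simpa [fieldCoeff, h] using h1 j

/-- Lowering cannot create a pair: for `k < 0` the index `k - 1` is again negative, so the outer
operator annihilates an empty mode. -/
theorem shiftCharge_neg_one_vacuum (c : ℤ → ℂ) (hd : (-1 : ℤ) ≠ 0) :
    shiftCharge c hd vacuum = 0 := by
  rw [shiftCharge, sumOperator_apply]
  refine finsum_eq_zero_of_forall_eq_zero fun k => ?_
  rw [chargeTerm_apply, vacuum, fieldCoeff]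
  split_ifs with h
  · simp [annihilate_single]
  · rw [fieldCoeffAdj, if_neg (by omega), create_single, if_neg (by simp), annihilate_single,
      if_neg (by simp), smul_zero]

theorem annihilate_vacuum (j : ℤ) : annihilate j vacuum = 0 := by simp [vacuum, annihilate_single]

/-- Only `k = -1` crosses from negative to nonnegative modes, and so only this term creates a pair.
-/
theorem shiftCharge_one_vacuum (c : ℤ → ℂ) (hd : (1 : ℤ) ≠ 0) :
    shiftCharge c hd vacuum = c (-1) • create 0 (create (-1) vacuum) := by
  rw [shiftCharge, sumOperator_apply, finsum_eq_single _ (-1)]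
  · simp [chargeTerm_apply, fieldCoeff, fieldCoeffAdj]
  · intro k hk
    rw [chargeTerm_apply, vacuum, fieldCoeff]
    split_ifs with h
    · simp [annihilate_single]
    · rw [fieldCoeffAdj, if_neg (by omega), create_single, if_neg (by simp), annihilate_single,
        if_neg (by simp), smul_zero]

theorem apply_of_lie {A B D : Module.End ℂ FockDomain} (h : ⁅A, B⁆ = D) (v : FockDomain) :
    A (B v) = B (A v) + D v := by
  rw [← h, Ring.lie_def]; simp

theorem numberCharge_vacuum (s : ℤ → ℝ) (c : ℝ) : numberCharge s c vacuum = (c : ℂ) • vacuum := by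
  rw [vacuum, numberCharge_single]; simp

/-- The commutator replaces `create 0` by `fieldCoeffAdj (-1)`, an annihilator, which kills the
vacuum. -/
theorem lowering_create_zero_vacuum (c : ℤ → ℂ) (hd : (-1 : ℤ) ≠ 0) :
    shiftCharge c hd (create 0 vacuum) = 0 := by
  have h := apply_of_lie (lie_shiftCharge_fieldCoeffAdj c hd 0) vacuum
  rw [shiftCharge_neg_one_vacuum] at h
  simpa [fieldCoeffAdj, annihilate_vacuum] using h

/-- Commuting past `create (-1)` yields `annihilate 0`, which gives zero; commuting past `create 0`
yields `annihilate (-1)`, which removes the remaining excitation. -/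
theorem lowering_pair (c : ℤ → ℂ) (hd : (-1 : ℤ) ≠ 0) :
    shiftCharge c hd (create 0 (create (-1) vacuum)) = c 0 • vacuum := by
  have h := apply_of_lie (lie_shiftCharge_fieldCoeffAdj c hd 0) (create (-1) vacuum)
  have h' := apply_of_lie (lie_shiftCharge_fieldCoeff c hd (-1)) vacuum
  rw [shiftCharge_neg_one_vacuum] at h'
  simp [fieldCoeff, annihilate_vacuum] at h'
  simp [fieldCoeffAdj, h'] at h
  have := annihilate_create_apply (-1) (-1) vacuum
  rw [annihilate_vacuum] at this
  simp at this
  rw [h, this]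

/-! ### Bilinearity and the Jacobi identity for commutators of operators -/

section Commutators

variable (a b c : Module.End ℂ FockDomain) (x y z : ℂ)

theorem commutator_sub : ⁅a - b, c⁆ = ⁅a, c⁆ - ⁅b, c⁆ :=
  LinearMap.ext fun v => by simp [Ring.lie_def]; abel

theorem commutator_add : ⁅a + b, c⁆ = ⁅a, c⁆ + ⁅b, c⁆ :=
  LinearMap.ext fun v => by simp [Ring.lie_def]; abel

theorem commutator_commutator : ⁅⁅a, b⁆, c⁆ = ⁅a, ⁅b, c⁆⁆ - ⁅b, ⁅a, c⁆⁆ :=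
  LinearMap.ext fun v => by simp [Ring.lie_def]; abel

theorem commutator_smul : ⁅a, z • b⁆ = z • ⁅a, b⁆ :=
  LinearMap.ext fun v => by simp [Ring.lie_def, smul_sub]

theorem smul_commutator : ⁅z • a, b⁆ = z • ⁅a, b⁆ :=
  LinearMap.ext fun v => by simp [Ring.lie_def, smul_sub]

variable {x y z}

theorem smul_sub_smul_sub_smul (h : x - y - z = 0) : x • a - y • a - z • a = 0 := by
  refine LinearMap.ext fun v => ?_
  simp only [LinearMap.sub_apply, LinearMap.smul_apply, ← sub_smul, h, zero_smul,
    LinearMap.zero_apply]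

theorem smul_sub_smul_add_smul (h : x - y + z = 0) : x • a - y • a + z • a = 0 := by
  refine LinearMap.ext fun v => ?_
  simp only [LinearMap.sub_apply, LinearMap.add_apply, LinearMap.smul_apply, ← sub_smul,
    ← add_smul, h, zero_smul, LinearMap.zero_apply]

end Commutators

/-- The commutation relations of the charges: the one-particle relations determine the quantum
ones up to a central term, which is read off on the vacuum. -/
theorem isUnitarySl2Action_charges {p m : ℤ → ℂ} {freq : ℤ → ℝ} {c : ℝ}
    (hd : (1 : ℤ) ≠ 0) (hd' : (-1 : ℤ) ≠ 0)
    (hpm : ∀ k, m (k + 1) = -star (p k)) (hfreq : ∀ k, freq (k + 1) = freq k + 1)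
    (hp : ∀ k, Complex.normSq (p (k + 1)) - Complex.normSq (p k) = 2 * freq (k + 1))
    (hc : Complex.normSq (p (-1)) = 2 * c) :
    IsUnitarySl2Action (numberCharge (excitation freq) c) (shiftCharge p hd)
      (shiftCharge m hd') := by
  set L₀ := numberCharge (excitation freq) c
  set Lp := shiftCharge p hd
  set Lm := shiftCharge m hd'
  have hm : ∀ k, m k = -star (p (k - 1)) := fun k => by rw [← hpm, sub_add_cancel]
  have hf : ∀ k, (freq (k + 1) : ℂ) = freq k + 1 := fun k => by rw [hfreq]; push_cast; rfl
  have hf' : ∀ k, (freq (k - 1) : ℂ) = freq k - 1 := fun k => by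
    have := hf (k - 1); rw [sub_add_cancel] at this; rw [this]; ring
  -- This is the one-particle relation `[L₊, L₋] = 2 L₀`, read on mode `k`.
  have hn : ∀ k, p k * star (p k) - p (k - 1) * star (p (k - 1)) = 2 * freq k := fun k => by
    have := hp (k - 1)
    rw [sub_add_cancel] at this
    have h2 : ∀ z : ℂ, z * star z = Complex.normSq z := Complex.mul_conj
    rw [h2, h2, ← Complex.ofReal_sub, this]; push_cast; ring
  have hpm' : ⁅Lp, Lm⁆ - (2 : ℂ) • L₀ = 0 := by
    refine eq_zero_of_lie_field (fun j => ?_) (fun j => ?_) ?_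
    · rw [commutator_sub, commutator_commutator, lie_shiftCharge_fieldCoeff, lie_shiftCharge_fieldCoeff, commutator_smul,
        commutator_smul, lie_shiftCharge_fieldCoeff, lie_shiftCharge_fieldCoeff, smul_commutator,
        lie_numberCharge_fieldCoeff, smul_smul, smul_smul, smul_smul]
      simp only [sub_neg_eq_add, sub_add_cancel, add_sub_cancel_right, hm]
      refine smul_sub_smul_sub_smul _ ?_
      linear_combination -hn j
    · rw [commutator_sub, commutator_commutator, lie_shiftCharge_fieldCoeffAdj, lie_shiftCharge_fieldCoeffAdj, commutator_smul,
        commutator_smul, lie_shiftCharge_fieldCoeffAdj, lie_shiftCharge_fieldCoeffAdj, smul_commutator,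
        lie_numberCharge_fieldCoeffAdj, smul_smul, smul_smul, smul_smul]
      simp only [← sub_eq_add_neg, sub_add_cancel, add_sub_cancel_right, hm]
      refine smul_sub_smul_sub_smul _ ?_
      linear_combination hn j
    -- On the vacuum the commutator is minus `Lm ∘ Lp`, which creates and removes one pair; `hc`
    -- matches the resulting `|p (-1)|²` with `2 * c`.
    · rw [LinearMap.sub_apply, Ring.lie_def, LinearMap.sub_apply, Module.End.mul_apply,
        Module.End.mul_apply, shiftCharge_neg_one_vacuum, shiftCharge_one_vacuum, map_smul,
        lowering_pair, map_zero, LinearMap.smul_apply, numberCharge_vacuum, smul_smul, smul_smul,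
        zero_sub, ← neg_smul, ← sub_smul]
      refine (congrArg (· • vacuum) ?_).trans (zero_smul ℂ _)
      have h2 : p (-1) * star (p (-1)) = Complex.normSq (p (-1)) := Complex.mul_conj _
      rw [hm, zero_sub, mul_neg, h2, hc]; push_cast; ring
  have h0p : ⁅L₀, Lp⁆ - Lp = 0 := by
    refine eq_zero_of_lie_field (fun j => ?_) (fun j => ?_) ?_
    · rw [commutator_sub, commutator_commutator, lie_shiftCharge_fieldCoeff, lie_numberCharge_fieldCoeff, commutator_smul,
        commutator_smul, lie_shiftCharge_fieldCoeff, lie_numberCharge_fieldCoeff, smul_smul, smul_smul]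
      refine smul_sub_smul_sub_smul _ ?_
      rw [hf']; ring
    · rw [commutator_sub, commutator_commutator, lie_shiftCharge_fieldCoeffAdj, lie_numberCharge_fieldCoeffAdj, commutator_smul,
        commutator_smul, lie_shiftCharge_fieldCoeffAdj, lie_numberCharge_fieldCoeffAdj, smul_smul,
        smul_smul]
      refine smul_sub_smul_sub_smul _ ?_
      rw [hf]; ring
    -- The created pair has energy `freq 0 - freq (-1) = 1`, as a raising operator requires.
    · have e1 := apply_of_lie (lie_numberCharge_create (excitation freq) c 0) (create (-1) vacuum)
      have e2 := apply_of_lie (lie_numberCharge_create (excitation freq) c (-1)) vacuum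
      rw [numberCharge_vacuum] at e2
      rw [e2] at e1
      rw [LinearMap.sub_apply, Ring.lie_def, LinearMap.sub_apply, Module.End.mul_apply,
        Module.End.mul_apply, numberCharge_vacuum, map_smul, shiftCharge_one_vacuum, map_smul, e1]
      have := hf (-1)
      simp only [map_smul, LinearMap.smul_apply, smul_smul, ← add_smul,
        ← sub_smul]
      refine (congrArg (· • create 0 (create (-1) vacuum)) ?_).trans (zero_smul ℂ _)
      simp only [excitation] at this ⊢
      norm_num at this ⊢
      rw [this]; ring
  have h0m : ⁅L₀, Lm⁆ + Lm = 0 := by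
    refine eq_zero_of_lie_field (fun j => ?_) (fun j => ?_) ?_
    · rw [commutator_add, commutator_commutator, lie_shiftCharge_fieldCoeff, lie_numberCharge_fieldCoeff, commutator_smul,
        commutator_smul, lie_shiftCharge_fieldCoeff, lie_numberCharge_fieldCoeff, smul_smul, smul_smul]
      refine smul_sub_smul_add_smul _ ?_
      rw [sub_neg_eq_add, hf]; ring
    · rw [commutator_add, commutator_commutator, lie_shiftCharge_fieldCoeffAdj, lie_numberCharge_fieldCoeffAdj, commutator_smul,
        commutator_smul, lie_shiftCharge_fieldCoeffAdj, lie_numberCharge_fieldCoeffAdj, smul_smul,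
        smul_smul]
      refine smul_sub_smul_add_smul _ ?_
      rw [← sub_eq_add_neg, hf']; ring
    · rw [LinearMap.add_apply, Ring.lie_def, LinearMap.sub_apply, Module.End.mul_apply,
        Module.End.mul_apply, numberCharge_vacuum, map_smul, shiftCharge_neg_one_vacuum]
      simp
  refine ⟨fun v => ?_, fun v => ?_, fun v => ?_, fun u v => ?_, fun u v => ?_⟩
  · have := LinearMap.congr_fun hpm' v
    rwa [LinearMap.sub_apply, LinearMap.zero_apply, sub_eq_zero, Ring.lie_def] at this
  · have := LinearMap.congr_fun h0p v
    rwa [LinearMap.sub_apply, LinearMap.zero_apply, sub_eq_zero, Ring.lie_def] at this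
  · have := LinearMap.congr_fun h0m v
    rwa [LinearMap.add_apply, LinearMap.zero_apply, add_eq_zero_iff_eq_neg, Ring.lie_def] at this
  -- `L₀` is diagonal with real entries in the occupation basis.
  · rw [inner_toL2, inner_toL2, Finsupp.sum, Finsupp.sum_of_support_subset _ (s := v.support)]
    · refine Finset.sum_congr rfl fun S _ => ?_
      rw [numberCharge_apply, numberCharge_apply, star_mul']
      simp only [RCLike.star_def, Complex.conj_ofReal]
      ring
    · intro S hS
      rw [Finsupp.mem_support_iff, numberCharge_apply] at hS
      exact Finsupp.mem_support_iff.2 (right_ne_zero_of_mul hS)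
    · simp
  · exact inner_shiftCharge hd hd' rfl hpm u v

section DiscreteSeries

/-! ## Weights of the Fock space -/

theorem real_smul_eq (r : ℝ) (v : FockDomain) : r • v = (r : ℂ) • v := by
  ext S; simp

theorem isTimeTranslationCharge_numberCharge (freq : ℤ → ℝ) (c : ℝ) :
    IsTimeTranslationCharge freq c (numberCharge (excitation freq) c) := by
  intro v
  have h : (fun j : ℤ => (if 0 ≤ j then freq j else -freq j) • create j (annihilate j v))
      = fun j => numberTerm (excitation freq) j v := by
    funext j; rw [real_smul_eq]; rfl
  rw [h, real_smul_eq]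
  exact ⟨isLocallyFinite_numberTerm _ v, rfl⟩

/-- The operator is diagonal in the occupation basis, so an eigenvector may only involve states of
one total energy. -/
theorem mem_eigenspace_numberCharge {s : ℤ → ℝ} {c : ℝ} {z : ℂ} {v : FockDomain} :
    v ∈ Module.End.eigenspace (numberCharge s c) z
      ↔ ∀ S, v S ≠ 0 → z = ((∑ j ∈ S, s j + c : ℝ) : ℂ) := by
  rw [Module.End.mem_eigenspace_iff, Finsupp.ext_iff]
  refine forall_congr' fun S => ?_
  rw [numberCharge_apply, Finsupp.smul_apply, smul_eq_mul]
  constructor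
  · intro h hv; exact (mul_right_cancel₀ hv h).symm
  · intro h
    by_cases hv : v S = 0
    · simp [hv]
    · rw [← h hv]

theorem isWeightModuleWithLowest_numberCharge {s : ℤ → ℝ} (hs : ∀ j, 0 ≤ s j) (c : ℝ) :
    IsWeightModuleWithLowest (numberCharge s c) c := by
  refine ⟨?_, ?_, fun z hz => ?_⟩
  · rw [eq_top_iff]
    rintro v -
    induction v using Finsupp.induction_linear with
    | zero => exact zero_mem _
    | add x y hx hy => exact add_mem hx hy
    | single S z =>
      exact (le_iSup (Module.End.eigenspace (numberCharge s c)) ((∑ j ∈ S, s j + c : ℝ) : ℂ))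
        (Module.End.mem_eigenspace_iff.2 (numberCharge_single s c S z))
  · exact Module.End.hasEigenvalue_of_hasEigenvector (x := vacuum)
      ⟨Module.End.mem_eigenspace_iff.2 (numberCharge_vacuum s c), by simp [vacuum]⟩
  · obtain ⟨v, hv, hv0⟩ := hz.exists_hasEigenvector
    obtain ⟨S, hS⟩ := Finsupp.ne_iff.1 hv0
    refine ⟨∑ j ∈ S, s j + c, ?_, mem_eigenspace_numberCharge.1 hv S hS⟩
    exact le_add_of_nonneg_left (Finset.sum_nonneg fun j _ => hs j)

theorem create_zero_vacuum : create 0 vacuum = Finsupp.single {0} 1 := by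
  rw [vacuum, create_single, if_neg (by simp)]
  simp [fockSign]

theorem linearIndependent_vacuum_pair :
    LinearIndependent ℂ ![vacuum, create 0 vacuum] := by
  rw [create_zero_vacuum, LinearIndependent.pair_iff]
  intro a b h
  have h0 := DFunLike.congr_fun h ∅
  have h1 := DFunLike.congr_fun h {0}
  simp [vacuum] at h0 h1
  exact ⟨h0, h1⟩

/-- A sum of nonnegative energies vanishes only if each does, which leaves mode `0` alone free to be
filled or empty. -/
theorem eigenspace_numberCharge_lowest {s : ℤ → ℝ} (h0 : s 0 = 0) (hs : ∀ j, j ≠ 0 → 0 < s j)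
    (c : ℝ) :
    Module.End.eigenspace (numberCharge s c) (c : ℂ)
      = Submodule.span ℂ {vacuum, create 0 vacuum} := by
  have hs' : ∀ j, 0 ≤ s j := fun j => by
    by_cases h : j = 0
    · rw [h, h0]
    · exact (hs j h).le
  refine le_antisymm (fun v hv => ?_) (Submodule.span_le.2 ?_)
  · rw [mem_eigenspace_numberCharge] at hv
    have hS : ∀ S, v S ≠ 0 → S = ∅ ∨ S = {0} := fun S h => by
      have h1 := hv S h
      have h2 : ∑ j ∈ S, s j = 0 := by
        have := Complex.ofReal_injective h1; linarith
      rw [Finset.sum_eq_zero_iff_of_nonneg fun j _ => hs' j] at h2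
      refine Finset.subset_singleton_iff.1 fun j hj => Finset.mem_singleton.2 ?_
      by_contra hj0
      exact (hs j hj0).ne' (h2 j hj)
    rw [Submodule.mem_span_pair]
    refine ⟨v ∅, v {0}, Finsupp.ext fun S => ?_⟩
    rw [create_zero_vacuum, vacuum]
    by_cases h : S = ∅
    · simp [h]
    · by_cases h' : S = {0}
      · simp [h']
      · have : v S = 0 := by
          by_contra hv0
          exact (hS S hv0).elim h h'
        simp [this, Ne.symm h, Ne.symm h']
  · rintro v (rfl | rfl)
    · exact Module.End.mem_eigenspace_iff.2 (numberCharge_vacuum s c)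
    · refine Module.End.mem_eigenspace_iff.2 ?_
      rw [create_zero_vacuum, numberCharge_single]
      simp [h0]

theorem finrank_span_vacuum_pair :
    Module.finrank ℂ (Submodule.span ℂ {vacuum, create 0 vacuum}) = 2 := by
  have := finrank_span_eq_card linearIndependent_vacuum_pair
  rw [Matrix.range_cons_cons_empty] at this
  simpa using this

/-- The coefficients never vanish together, since the second is `1` at `α = 0`; hence no bound on
`α` is needed. -/
theorem vacuumFamily_ne_zero (α : ℂ) : vacuumFamily α ≠ 0 := by
  intro h
  obtain ⟨h1, h2⟩ := LinearIndependent.pair_iff.1 linearIndependent_vacuum_pair _ _ h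
  subst h1
  simp at h2

/-- The bound makes the radicand nonnegative, so the principal complex root is the real square root
and the squared moduli add up to one. -/
theorem norm_vacuumFamily {α : ℂ} (hα : ‖α‖ ≤ 1) : ‖toL2 (vacuumFamily α)‖ = 1 := by
  have h0 : 0 ≤ 1 - ‖α‖ ^ 2 := by nlinarith [norm_nonneg α]
  have e : ((1 - ‖α‖ ^ 2 : ℝ) : ℂ) ^ (1 / 2 : ℂ) = (Real.sqrt (1 - ‖α‖ ^ 2) : ℝ) := by
    rw [Real.sqrt_eq_rpow, Complex.ofReal_cpow h0]; norm_num
  have h2 : ‖toL2 (vacuumFamily α)‖ ^ 2 = 1 := by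
    have := @inner_self_eq_norm_sq_to_K ℂ _ _ _ _ (toL2 (vacuumFamily α))
    have h3 : inner ℂ (toL2 (vacuumFamily α)) (toL2 (vacuumFamily α)) = (1 : ℂ) := by
      rw [vacuumFamily, e, create_zero_vacuum, vacuum, inner_toL2]
      rw [Finsupp.sum_of_support_subset _ (s := {∅, {0}})]
      · rw [Finset.sum_pair (by decide)]
        simp [Complex.mul_conj]
        norm_cast
        rw [Complex.normSq_eq_norm_sq, Real.mul_self_sqrt h0]; ring
      · intro S hS
        by_contra h
        simp at h
        simp [Ne.symm h.1, Ne.symm h.2] at hS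
      · simp
    rw [h3] at this
    exact Complex.ofReal_injective (by push_cast; exact this.symm)
  nlinarith [norm_nonneg (toL2 (vacuumFamily α))]

/-! ## Lowest weight modules -/

variable {L₀ Lp Lm : FockDomain →ₗ[ℂ] FockDomain} {Ω : FockDomain} {w : ℝ}

/-- The coefficient `√((n+1)(n+2w))` of the discrete series. -/
def weightCoeff (w : ℝ) (n : ℕ) : ℝ := Real.sqrt ((n + 1) * (n + 2 * w))

/-- The weight vectors obtained from a lowest weight vector by raising and normalising. -/
def weightVector (Lp : FockDomain →ₗ[ℂ] FockDomain) (Ω : FockDomain) (w : ℝ) : ℕ → FockDomain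
  | 0 => ((‖toL2 Ω‖⁻¹ : ℝ) : ℂ) • Ω
  | n + 1 => (Complex.I / (weightCoeff w n : ℂ)) • Lp (weightVector Lp Ω w n)

theorem weightCoeff_sq (hw : 0 < w) (n : ℕ) : weightCoeff w n ^ 2 = (n + 1) * (n + 2 * w) :=
  Real.sq_sqrt (by positivity)

theorem weightCoeff_pos (hw : 0 < w) (n : ℕ) : 0 < weightCoeff w n :=
  Real.sqrt_pos.2 (by positivity)

theorem weightCoeff_ne_zero (hw : 0 < w) (n : ℕ) : (weightCoeff w n : ℂ) ≠ 0 :=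
  Complex.ofReal_ne_zero.2 (weightCoeff_pos hw n).ne'

/-- The factor in `weightVector` was chosen to reproduce exactly the phase and modulus of
`discretePlus`. -/
theorem raise_weightVector (hw : 0 < w) (n : ℕ) :
    Lp (weightVector Lp Ω w n)
      = (-(Complex.I * weightCoeff w n)) • weightVector Lp Ω w (n + 1) := by
  rw [weightVector, smul_smul]
  have h := weightCoeff_ne_zero hw n
  rw [show -(Complex.I * (weightCoeff w n : ℂ)) * (Complex.I / weightCoeff w n) = 1 by
    field_simp; simp, one_smul]

theorem zero_weightVector (h : IsUnitarySl2Action L₀ Lp Lm) (hΩ : L₀ Ω = (w : ℂ) • Ω) (n : ℕ) :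
    L₀ (weightVector Lp Ω w n) = ((w + n : ℝ) : ℂ) • weightVector Lp Ω w n := by
  induction n with
  | zero => rw [weightVector, map_smul, hΩ, smul_comm]; simp
  | succ n ih =>
    have := h.comm_zero_plus (weightVector Lp Ω w n)
    rw [sub_eq_iff_eq_add, ih, map_smul] at this
    rw [weightVector, map_smul, this, smul_add, smul_comm _ ((w + n : ℝ) : ℂ)]
    push_cast
    module

theorem lower_weightVector_zero (hΩ' : Lm Ω = 0) : Lm (weightVector Lp Ω w 0) = 0 := by
  rw [weightVector, map_smul, hΩ', smul_zero]

/-- Induction on `L₋ L₊ = L₊ L₋ - 2 L₀`; it closes because the squares of `weightCoeff` at `n + 1`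
and `n` differ by `2 (w + n + 1)`, twice the weight. -/
theorem lower_weightVector_succ (h : IsUnitarySl2Action L₀ Lp Lm) (hw : 0 < w)
    (hΩ : L₀ Ω = (w : ℂ) • Ω) (hΩ' : Lm Ω = 0) (n : ℕ) :
    Lm (weightVector Lp Ω w (n + 1))
      = (-(Complex.I * weightCoeff w n)) • weightVector Lp Ω w n := by
  induction n with
  | zero =>
    have h1 := h.comm_plus_minus (weightVector Lp Ω w 0)
    rw [lower_weightVector_zero hΩ', map_zero, zero_weightVector h hΩ, zero_sub, neg_eq_iff_eq_neg]
      at h1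
    rw [weightVector.eq_2, map_smul, h1, smul_neg, smul_smul, smul_smul, ← neg_smul]
    congr 1
    have h2 : (weightCoeff w 0 : ℂ) ^ 2 = 2 * w := by
      exact_mod_cast (weightCoeff_sq hw 0).trans (by simp)
    have h3 := weightCoeff_ne_zero hw 0
    field_simp
    rw [h2]; push_cast; ring
  | succ n ih =>
    have h1 := h.comm_plus_minus (weightVector Lp Ω w (n + 1))
    rw [ih, map_smul, raise_weightVector hw, zero_weightVector h hΩ, smul_smul, smul_smul,
      sub_eq_iff_eq_add, ← sub_eq_iff_eq_add'] at h1
    rw [weightVector, map_smul, ← h1, ← sub_smul, smul_smul]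
    congr 1
    have h2 : (weightCoeff w (n + 1) : ℂ) ^ 2 = (n + 2) * (n + 1 + 2 * w) := by
      have := weightCoeff_sq hw (n + 1)
      push_cast at this
      rw [add_assoc, one_add_one_eq_two] at this
      exact_mod_cast this
    have h4 : (weightCoeff w n : ℂ) ^ 2 = (n + 1) * (n + 2 * w) := by
      exact_mod_cast weightCoeff_sq hw n
    have h3 := weightCoeff_ne_zero hw (n + 1)
    field_simp
    rw [h2, h4, Complex.I_sq]; push_cast; ring

/-- Unitarity turns the raising operator into minus the lowering one, whose coefficient cancels the
normalising factors. -/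
theorem inner_weightVector_self (h : IsUnitarySl2Action L₀ Lp Lm) (hw : 0 < w)
    (hΩ : L₀ Ω = (w : ℂ) • Ω) (hΩ' : Lm Ω = 0) (hΩ0 : Ω ≠ 0) (n : ℕ) :
    inner ℂ (toL2 (weightVector Lp Ω w n)) (toL2 (weightVector Lp Ω w n)) = (1 : ℂ) := by
  induction n with
  | zero =>
    have h0 : (‖toL2 Ω‖ : ℂ) ≠ 0 := Complex.ofReal_ne_zero.2
      (norm_ne_zero_iff.2 ((map_ne_zero_iff _ toL2_injective).2 hΩ0))
    rw [weightVector, map_smul, inner_smul_left, inner_smul_right, inner_self_eq_norm_sq_to_K]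
    simp
    field_simp
  | succ n ih =>
    have h3 := weightCoeff_ne_zero hw n
    nth_rewrite 1 [weightVector]
    rw [map_smul, inner_smul_left, h.adjoint_plus, lower_weightVector_succ h hw hΩ hΩ', map_smul,
      inner_smul_right, ih]
    simp
    field_simp
    simp

/-- Different indices belong to different eigenvalues of the symmetric operator `L₀`. -/
theorem orthonormal_weightVector (h : IsUnitarySl2Action L₀ Lp Lm) (hw : 0 < w)
    (hΩ : L₀ Ω = (w : ℂ) • Ω) (hΩ' : Lm Ω = 0) (hΩ0 : Ω ≠ 0) :
    Orthonormal ℂ fun n => toL2 (weightVector Lp Ω w n) := by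
  rw [orthonormal_iff_ite]
  intro m n
  split_ifs with hmn
  · subst hmn; exact inner_weightVector_self h hw hΩ hΩ' hΩ0 m
  · have := h.adjoint_zero (weightVector Lp Ω w m) (weightVector Lp Ω w n)
    rw [zero_weightVector h hΩ, zero_weightVector h hΩ, map_smul, map_smul, inner_smul_left,
      inner_smul_right, Complex.conj_ofReal, ← sub_eq_zero, ← sub_mul, mul_eq_zero] at this
    refine this.resolve_left fun h' => hmn ?_
    rw [← Complex.ofReal_sub, Complex.ofReal_eq_zero] at h'
    have h'' : (m : ℝ) = n := by linarith
    exact_mod_cast h''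

/-- The intertwiner from the discrete series. -/
def weightMap (Lp : FockDomain →ₗ[ℂ] FockDomain) (Ω : FockDomain) (w : ℝ) :
    (ℕ →₀ ℂ) →ₗ[ℂ] FockDomain := Finsupp.linearCombination ℂ (weightVector Lp Ω w)

theorem weightMap_single (n : ℕ) (z : ℂ) :
    weightMap Lp Ω w (Finsupp.single n z) = z • weightVector Lp Ω w n :=
  Finsupp.linearCombination_single ..

theorem weightMap_zero (h : IsUnitarySl2Action L₀ Lp Lm) (hΩ : L₀ Ω = (w : ℂ) • Ω) (x : ℕ →₀ ℂ) :
    weightMap Lp Ω w (discreteZero w x) = L₀ (weightMap Lp Ω w x) := by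
  refine LinearMap.congr_fun (f := weightMap Lp Ω w ∘ₗ discreteZero w)
    (g := L₀ ∘ₗ weightMap Lp Ω w) (Finsupp.lhom_ext fun n z => ?_) x
  simp only [LinearMap.comp_apply, discreteZero, Finsupp.linearCombination_single, map_smul,
    weightMap_single, zero_weightVector h hΩ]

theorem weightMap_plus (hw : 0 < w) (x : ℕ →₀ ℂ) :
    weightMap Lp Ω w (discretePlus w x) = Lp (weightMap Lp Ω w x) := by
  refine LinearMap.congr_fun (f := weightMap Lp Ω w ∘ₗ discretePlus w)
    (g := Lp ∘ₗ weightMap Lp Ω w) (Finsupp.lhom_ext fun n z => ?_) x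
  simp only [LinearMap.comp_apply, discretePlus, Finsupp.linearCombination_single, map_smul,
    weightMap_single, raise_weightVector hw, weightCoeff]

theorem discreteMinus_single (n : ℕ) (z : ℂ) : discreteMinus w (Finsupp.single n z)
    = z • Finsupp.single (n - 1) (-(Complex.I * (Real.sqrt (n * (n + 2 * w - 1)) : ℂ))) :=
  Finsupp.linearCombination_single ..

theorem discreteMinus_single_succ (n : ℕ) (z : ℂ) : discreteMinus w (Finsupp.single (n + 1) z)
    = z • Finsupp.single n (-(Complex.I * (weightCoeff w n : ℂ))) := by
  rw [discreteMinus_single, weightCoeff]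
  push_cast
  rw [add_sub_right_comm, add_sub_cancel_right]

theorem discreteMinus_single_zero (z : ℂ) : discreteMinus w (Finsupp.single 0 z) = 0 := by
  rw [discreteMinus_single]; simp

theorem weightMap_minus (h : IsUnitarySl2Action L₀ Lp Lm) (hw : 0 < w)
    (hΩ : L₀ Ω = (w : ℂ) • Ω) (hΩ' : Lm Ω = 0) (x : ℕ →₀ ℂ) :
    weightMap Lp Ω w (discreteMinus w x) = Lm (weightMap Lp Ω w x) := by
  refine LinearMap.congr_fun (f := weightMap Lp Ω w ∘ₗ discreteMinus w)
    (g := Lm ∘ₗ weightMap Lp Ω w) (Finsupp.lhom_ext fun n z => ?_) x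
  cases n with
  | zero =>
    simp only [LinearMap.comp_apply, discreteMinus_single_zero, weightMap_single, map_zero,
      map_smul, lower_weightVector_zero hΩ', smul_zero]
  | succ n =>
    simp only [LinearMap.comp_apply, discreteMinus_single_succ, map_smul,
      weightMap_single, lower_weightVector_succ h hw hΩ hΩ']

/-- In coordinates, lowering shifts the top index down by one; for `w > 0` the top coefficient stays
nonzero. -/
theorem discreteMinus_apply (x : ℕ →₀ ℂ) (n : ℕ) :
    discreteMinus w x n = -(Complex.I * (weightCoeff w n : ℂ)) * x (n + 1) := by
  induction x using Finsupp.induction_linear with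
  | zero => simp
  | add x y hx hy => simp only [map_add, Finsupp.add_apply, hx, hy, mul_add]
  | single k z =>
    cases k with
    | zero => simp [discreteMinus_single_zero]
    | succ k =>
      rw [discreteMinus_single_succ, Finsupp.smul_apply, Finsupp.single_apply, Finsupp.single_apply]
      by_cases hk : k = n
      · subst hk; simp; ring
      · simp [hk]

theorem weightVector_mem {W : Submodule ℂ FockDomain} (hW : IsInvariant L₀ Lp Lm W)
    (h0 : weightVector Lp Ω w 0 ∈ W) (n : ℕ) : weightVector Lp Ω w n ∈ W := by
  induction n with
  | zero => exact h0
  | succ n ih => exact W.smul_mem _ (hW _ ih).2.1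

theorem range_weightMap_le {W : Submodule ℂ FockDomain} (hW : IsInvariant L₀ Lp Lm W)
    (h0 : weightVector Lp Ω w 0 ∈ W) : LinearMap.range (weightMap Lp Ω w) ≤ W := by
  rw [weightMap, Finsupp.range_linearCombination, Submodule.span_le]
  rintro _ ⟨n, rfl⟩
  exact weightVector_mem hW h0 n

/-- Repeated lowering reaches the lowest weight vector. -/
theorem weightVector_zero_mem (h : IsUnitarySl2Action L₀ Lp Lm) (hw : 0 < w)
    (hΩ : L₀ Ω = (w : ℂ) • Ω) (hΩ' : Lm Ω = 0) {W : Submodule ℂ FockDomain}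
    (hW : IsInvariant L₀ Lp Lm W) (n : ℕ) (x : ℕ →₀ ℂ) (hx : x n ≠ 0)
    (hx' : ∀ m, n < m → x m = 0) (hxW : weightMap Lp Ω w x ∈ W) : weightVector Lp Ω w 0 ∈ W := by
  induction n generalizing x with
  | zero =>
    have e : x = Finsupp.single 0 (x 0) := by
      ext m
      cases m with
      | zero => simp
      | succ m => rw [hx' _ m.succ_pos]; simp
    rw [e, weightMap_single] at hxW
    exact (W.smul_mem_iff hx).1 hxW
  | succ n ih =>
    refine ih (discreteMinus w x) ?_ (fun m hm => ?_) ?_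
    · rw [discreteMinus_apply]
      exact mul_ne_zero (neg_ne_zero.2 (mul_ne_zero Complex.I_ne_zero (weightCoeff_ne_zero hw n))) hx
    · rw [discreteMinus_apply, hx' _ (by omega), mul_zero]
    · rw [weightMap_minus h hw hΩ hΩ']
      exact (hW _ hxW).2.2

theorem generated_eq_range (h : IsUnitarySl2Action L₀ Lp Lm) (hw : 0 < w)
    (hΩ : L₀ Ω = (w : ℂ) • Ω) (hΩ' : Lm Ω = 0) (hΩ0 : Ω ≠ 0) :
    generated L₀ Lp Lm Ω = LinearMap.range (weightMap Lp Ω w) := by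
  refine le_antisymm (sInf_le ⟨?_, ?_⟩) (le_sInf fun W hW => ?_)
  · have h0 : (‖toL2 Ω‖ : ℂ) ≠ 0 := Complex.ofReal_ne_zero.2
      (norm_ne_zero_iff.2 ((map_ne_zero_iff _ toL2_injective).2 hΩ0))
    refine ⟨Finsupp.single 0 (‖toL2 Ω‖ : ℂ), ?_⟩
    rw [weightMap_single, weightVector, smul_smul, Complex.ofReal_inv, mul_inv_cancel₀ h0, one_smul]
  · rintro _ ⟨x, rfl⟩
    exact ⟨⟨_, weightMap_zero h hΩ x⟩, ⟨_, weightMap_plus hw x⟩, ⟨_, weightMap_minus h hw hΩ hΩ' x⟩⟩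
  · exact range_weightMap_le hW.2 (W.smul_mem _ hW.1)

/-- A lowest weight vector of positive weight in a unitary module generates a discrete series
representation. -/
theorem generatesDiscreteSeries (h : IsUnitarySl2Action L₀ Lp Lm) (hw : 0 < w)
    (hΩ : L₀ Ω = (w : ℂ) • Ω) (hΩ' : Lm Ω = 0) (hΩ0 : Ω ≠ 0) :
    GeneratesDiscreteSeries L₀ Lp Lm Ω w := by
  have ho := orthonormal_weightVector h hw hΩ hΩ' hΩ0
  have hg := generated_eq_range h hw hΩ hΩ' hΩ0
  refine ⟨hw, fun W hW hWi => ?_, weightMap Lp Ω w, ho.orthogonalFamily.linearIsometry, fun x => ?_,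
    hg.symm, ?_, weightMap_zero h hΩ, weightMap_plus hw, weightMap_minus h hw hΩ hΩ'⟩
  -- Irreducibility: lower a nonzero vector from its highest occupied index to the lowest weight
  -- vector, then raise again.
  · refine or_iff_not_imp_left.2 fun hb => le_antisymm hW ?_
    obtain ⟨v, hv, hv0⟩ := Submodule.exists_mem_ne_zero_of_ne_bot hb
    obtain ⟨x, rfl⟩ : v ∈ LinearMap.range (weightMap Lp Ω w) := hg ▸ hW hv
    have hx : x.support.Nonempty := by
      rw [Finsupp.support_nonempty_iff]
      rintro rfl
      exact hv0 (map_zero _)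
    rw [hg]
    refine range_weightMap_le hWi (weightVector_zero_mem h hw hΩ hΩ' hWi (x.support.max' hx) x
      (Finsupp.mem_support_iff.1 (x.support.max'_mem hx)) (fun m hm => ?_) hv)
    by_contra hm'
    exact absurd (x.support.le_max' m (Finsupp.mem_support_iff.2 hm')) (not_le.2 hm)
  · induction x using Finsupp.induction_linear with
    | zero => simp
    | add x y hx hy => simp only [map_add, hx, hy]
    | single n z =>
      have e : toL2 (Finsupp.single n z) = lp.single 2 n z := by
        ext m
        rw [lp.single_apply, Pi.single_apply]
        exact Finsupp.single_apply.trans (by simp only [eq_comm])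
      rw [e, OrthogonalFamily.linearIsometry_apply_single, weightMap_single, map_smul]
      rfl
  -- The range of the isometry is the closed span of the orthonormal weight vectors.
  · rw [OrthogonalFamily.range_linearIsometry, hg, weightMap, Finsupp.range_linearCombination,
      Submodule.map_span, ← Set.range_comp, Submodule.span_range_eq_iSup]
    congr 2
    funext n
    exact LinearMap.range_toSpanSingleton _

end DiscreteSeries

/-! ## Charges of a family of modes on which the symmetries act as ladder operators -/

/-- The domain of the coordinate `ρ`. -/
abbrev strip : Set ℝ := Set.Ioo (-(Real.pi / 2)) (Real.pi / 2)

theorem cos_pos_of_mem_strip {ρ : ℝ} (h : ρ ∈ strip) : 0 < Real.cos ρ := Real.cos_pos_of_mem_Ioo h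

theorem neg_half_pi_lt_half_pi : -(Real.pi / 2) < Real.pi / 2 := by linarith [Real.pi_pos]

/-- The half-open interval of integration exceeds the strip only by the null set `{π/2}`, so nothing
need be known on the boundary. -/
theorem ae_strip {P : ℝ → Prop} (h : ∀ ρ ∈ strip, P ρ) :
    ∀ᵐ ρ, ρ ∈ Set.uIoc (-(Real.pi / 2)) (Real.pi / 2) → P ρ := by
  have : ∀ᵐ ρ : ℝ, ρ ≠ Real.pi / 2 := by
    simp [MeasureTheory.ae_iff, MeasureTheory.measure_singleton]
  filter_upwards [this] with ρ hρ hρ'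
  rw [Set.uIoc_of_le neg_half_pi_lt_half_pi.le] at hρ'
  exact h ρ ⟨hρ'.1, lt_of_le_of_ne hρ'.2 hρ⟩

theorem integral_congr_strip {E : Type*} [NormedAddCommGroup E] [NormedSpace ℝ E] {f g : ℝ → E}
    (h : ∀ ρ ∈ strip, f ρ = g ρ) :
    ∫ ρ in (-(Real.pi / 2))..(Real.pi / 2), f ρ = ∫ ρ in (-(Real.pi / 2))..(Real.pi / 2), g ρ :=
  intervalIntegral.integral_congr_ae (ae_strip h)

theorem intervalIntegrable_congr_strip {E : Type*} [NormedAddCommGroup E] {f g : ℝ → E}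
    (h : ∀ ρ ∈ strip, f ρ = g ρ)
    (hf : IntervalIntegrable f MeasureTheory.volume (-(Real.pi / 2)) (Real.pi / 2)) :
    IntervalIntegrable g MeasureTheory.volume (-(Real.pi / 2)) (Real.pi / 2) :=
  hf.congr_ae ((MeasureTheory.ae_restrict_iff' measurableSet_uIoc).2 (ae_strip h))

/-- Orthonormality leaves only the matrix elements at `(k + d, k)`, so the double sum collapses to a
single one. Its coefficients do not involve `t`. -/
theorem isQuantumCharge_shiftCharge {mode : ℤ → SpinorField} {X : SpinorField → SpinorField}
    {c : ℤ → ℂ} {d : ℤ} (hd : d ≠ 0) (ho : IsOrthonormalModes mode)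
    (hX : ∀ k t, ∀ ρ ∈ strip, X (mode k) t ρ = c k • mode (k + d) t ρ) :
    IsQuantumCharge mode X (shiftCharge c hd) := by
  intro t
  have hden : ∀ j k, ∀ ρ ∈ strip, c k • diracDensity (mode j) (mode (k + d)) t ρ
      = diracDensity (mode j) (X (mode k)) t ρ := fun j k ρ hρ => by
    simp only [diracDensity, hX k t ρ hρ, dotProduct_smul, smul_eq_mul, mul_div_assoc]
  have hin : ∀ j k, diracInner (mode j) (X (mode k)) t = if j = k + d then c k else 0 :=
    fun j k => by
      rw [diracInner, ← integral_congr_strip (hden j k), intervalIntegral.integral_smul,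
        ← diracInner, (ho t j (k + d)).2]
      split_ifs <;> simp
  refine ⟨fun j k => intervalIntegrable_congr_strip (hden j k)
    ((ho t j (k + d)).1.const_mul (c k)), fun v => ?_⟩
  have hv := isLocallyFinite_chargeTerm c hd v
  obtain ⟨g, hg⟩ : ∃ g : ℤ ↪ ℤ × ℤ, ∀ k, g k = (k + d, k) :=
    ⟨⟨fun k => (k + d, k), fun _ _ h => congrArg Prod.snd h⟩, fun _ => rfl⟩
  have hsub : (Function.support fun p : ℤ × ℤ =>
      diracInner (mode p.1) (X (mode p.2)) t • fieldCoeffAdj p.1 (fieldCoeff p.2 v))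
      ⊆ hv.toFinset.map g := by
    rintro ⟨j, k⟩ hjk
    rw [Function.mem_support, hin] at hjk
    by_cases h : j = k + d
    · subst h
      rw [if_pos rfl] at hjk
      exact Finset.mem_coe.2 (Finset.mem_map.2 ⟨k, hv.mem_toFinset.2 hjk, hg k⟩)
    · rw [if_neg h, zero_smul] at hjk
      exact absurd rfl hjk
  refine ⟨(Finset.finite_toSet _).subset hsub, ?_⟩
  rw [finsum_eq_sum_of_support_subset _ hsub, Finset.sum_map, shiftCharge, sumOperator_apply,
    finsum_eq_sum_of_support_subset (s := hv.toFinset) _ (by simp)]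
  refine Finset.sum_congr rfl fun k _ => ?_
  rw [hg, hin, if_pos rfl, chargeTerm_apply]

/-- Spatial mode functions `(U_n, V_n)` of the rescaled Dirac equation of mass `M` and frequencies
`ω_n`, orthonormal and related by the raising operator with coefficients `κ_n`. -/
structure LadderModes (M : ℝ) (ω : ℤ → ℝ) (U V : ℤ → ℝ → ℝ) (κ : ℤ → ℝ) : Prop where
  freq_succ : ∀ n, ω (n + 1) = ω n + 1
  deriv_fst : ∀ n, ∀ ρ ∈ strip,
    HasDerivAt (U n) (ω n * V n ρ - M / Real.cos ρ * U n ρ) ρ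
  deriv_snd : ∀ n, ∀ ρ ∈ strip,
    HasDerivAt (V n) (M / Real.cos ρ * V n ρ - ω n * U n ρ) ρ
  raise_fst : ∀ n, ∀ ρ ∈ strip, κ n * U (n + 1) ρ
    = (ω n + 1 / 2) * (Real.cos ρ * V n ρ - Real.sin ρ * U n ρ) - M * U n ρ
  raise_snd : ∀ n, ∀ ρ ∈ strip, κ n * V (n + 1) ρ
    = M * V n ρ - (ω n + 1 / 2) * (Real.cos ρ * U n ρ + Real.sin ρ * V n ρ)
  coeff_sq : ∀ n, κ n ^ 2 = (ω n + 1 / 2) ^ 2 - M ^ 2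
  coeff_ne_zero : ∀ n, κ n ≠ 0
  integrable : ∀ j k, IntervalIntegrable (fun ρ => U j ρ * U k ρ + V j ρ * V k ρ)
    MeasureTheory.volume (-(Real.pi / 2)) (Real.pi / 2)
  integral : ∀ j k, ∫ ρ in (-(Real.pi / 2))..(Real.pi / 2), (U j ρ * U k ρ + V j ρ * V k ρ)
    = if j = k then 1 else 0

/-! ### Stationary spinor fields and the ladder operators in components -/

/-- The spinor field of frequency `ω` with spatial part `(cos ρ)^{1/2} (U, V)`. -/
def stationaryField (ω : ℝ) (U V : ℝ → ℝ) : SpinorField := rescale fun t ρ =>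
  Complex.exp (-(Complex.I * (ω : ℂ) * (t : ℂ))) • ![(U ρ : ℂ), (V ρ : ℂ)]

theorem stationaryField_apply (ω : ℝ) (U V : ℝ → ℝ) (t ρ : ℝ) : stationaryField ω U V t ρ
    = ![Real.sqrt (Real.cos ρ) * (Complex.exp (-(Complex.I * ω * t)) * U ρ),
        Real.sqrt (Real.cos ρ) * (Complex.exp (-(Complex.I * ω * t)) * V ρ)] := by
  ext i
  fin_cases i <;> simp [stationaryField, rescale]

theorem hasDerivAt_exp_time (ω t : ℝ) :
    HasDerivAt (fun s : ℝ => Complex.exp (-(Complex.I * ω * s)))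
      (-(Complex.I * ω) * Complex.exp (-(Complex.I * ω * t))) t := by
  have h : HasDerivAt (fun s : ℝ => -(Complex.I * ω * (s : ℂ))) (-(Complex.I * ω * 1)) t :=
    ((Complex.ofRealCLM.hasDerivAt (x := t)).const_mul (Complex.I * ω)).neg
  convert h.cexp using 1
  ring

theorem deriv_time_stationaryField (ω : ℝ) (U V : ℝ → ℝ) (t ρ : ℝ) :
    deriv (fun s => stationaryField ω U V s ρ) t
      = (-(Complex.I * ω)) • stationaryField ω U V t ρ := by
  refine HasDerivAt.deriv (hasDerivAt_pi.2 fun i => ?_)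
  have h := hasDerivAt_exp_time ω t
  simp only [stationaryField_apply]
  fin_cases i
  · simp only [Fin.zero_eta, Matrix.cons_val_zero, Pi.smul_apply, smul_eq_mul]
    exact ((h.mul_const (U ρ : ℂ)).const_mul (Real.sqrt (Real.cos ρ) : ℂ)).congr_deriv (by ring)
  · simp only [Fin.mk_one, Matrix.cons_val_one, Pi.smul_apply, smul_eq_mul]
    exact ((h.mul_const (V ρ : ℂ)).const_mul (Real.sqrt (Real.cos ρ) : ℂ)).congr_deriv
      (by simp only [Matrix.cons_val_fin_one]; ring)

theorem timeTranslation_stationaryField (ω : ℝ) (U V : ℝ → ℝ) :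
    timeTranslation (stationaryField ω U V) = fun t ρ => ω • stationaryField ω U V t ρ := by
  funext t ρ
  rw [timeTranslation, deriv_time_stationaryField, smul_smul]
  ext i
  simp only [Pi.smul_apply, smul_eq_mul, Complex.real_smul]
  linear_combination (-(ω : ℂ) * stationaryField ω U V t ρ i) * Complex.I_mul_I

/-- The factor `(cos ρ)^{1/2}` contributes `-(sin ρ)/2` to `cos ρ ∂_ρ`. -/
theorem hasDerivAt_sqrt_cos_mul {f : ℝ → ℝ} {f' ρ : ℝ} (hρ : ρ ∈ strip) (hf : HasDerivAt f f' ρ)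
    (z : ℂ) : HasDerivAt (fun r : ℝ => (Real.sqrt (Real.cos r) : ℂ) * (z * f r))
      (((Real.sqrt (Real.cos ρ) / Real.cos ρ * (Real.cos ρ * f' - Real.sin ρ / 2 * f ρ) : ℝ) : ℂ)
        * z) ρ := by
  have hc := cos_pos_of_mem_strip hρ
  have h1 := ((Real.hasDerivAt_cos ρ).sqrt hc.ne').mul hf
  have h2 := (h1.ofReal_comp).mul_const z
  have e : (fun r : ℝ => (Real.sqrt (Real.cos r) : ℂ) * (z * f r))
      = fun r => ((((fun r => Real.sqrt (Real.cos r)) * f) r : ℝ) : ℂ) * z := by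
    funext r; rw [Pi.mul_apply]; push_cast; ring
  rw [e]
  refine h2.congr_deriv ?_
  congr 2
  have hs := Real.sqrt_pos.2 hc
  have hs2 := Real.sq_sqrt hc.le
  field_simp
  rw [hs2]; ring

theorem deriv_space_stationaryField {ω : ℝ} {U V : ℝ → ℝ} {t ρ U' V' : ℝ} (hρ : ρ ∈ strip)
    (hU : HasDerivAt U U' ρ) (hV : HasDerivAt V V' ρ) :
    (Real.cos ρ : ℂ) • deriv (stationaryField ω U V t) ρ
      = ((Real.sqrt (Real.cos ρ) : ℂ) * Complex.exp (-(Complex.I * ω * t)))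
        • ![((Real.cos ρ * U' - Real.sin ρ / 2 * U ρ : ℝ) : ℂ),
          ((Real.cos ρ * V' - Real.sin ρ / 2 * V ρ : ℝ) : ℂ)] := by
  have hc : (Real.cos ρ : ℂ) ≠ 0 := Complex.ofReal_ne_zero.2 (cos_pos_of_mem_strip hρ).ne'
  have h : HasDerivAt (stationaryField ω U V t)
      (![((Real.sqrt (Real.cos ρ) / Real.cos ρ
          * (Real.cos ρ * U' - Real.sin ρ / 2 * U ρ) : ℝ) : ℂ)
            * Complex.exp (-(Complex.I * ω * t)),
        ((Real.sqrt (Real.cos ρ) / Real.cos ρ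
          * (Real.cos ρ * V' - Real.sin ρ / 2 * V ρ) : ℝ) : ℂ)
            * Complex.exp (-(Complex.I * ω * t))]) ρ := by
    refine hasDerivAt_pi.2 fun i => ?_
    simp only [stationaryField_apply]
    fin_cases i
    · exact hasDerivAt_sqrt_cos_mul hρ hU _
    · exact hasDerivAt_sqrt_cos_mul hρ hV _
  rw [h.deriv]
  ext i
  fin_cases i
  · simp only [Fin.zero_eta, Pi.smul_apply, Matrix.cons_val_zero, smul_eq_mul, Complex.ofReal_mul,
      Complex.ofReal_div]
    field_simp
  · simp only [Fin.mk_one, Pi.smul_apply, Matrix.cons_val_one, Matrix.cons_val_fin_one, smul_eq_mul,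
      Complex.ofReal_mul, Complex.ofReal_div]
    field_simp

theorem exp_freq_succ (ω t : ℝ) : Complex.exp (-(Complex.I * ((ω + 1 : ℝ) : ℂ) * t))
    = Complex.exp (-(Complex.I * ω * t)) * (Real.cos t - Complex.I * Real.sin t) := by
  have h : Complex.exp (-(t : ℂ) * Complex.I) = Real.cos t - Complex.I * Real.sin t := by
    rw [Complex.exp_mul_I, Complex.cos_neg, Complex.sin_neg, Complex.ofReal_cos, Complex.ofReal_sin]
    ring
  rw [← h, ← Complex.exp_add]
  congr 1
  push_cast
  ring

theorem exp_freq_pred (ω t : ℝ) : Complex.exp (-(Complex.I * (ω : ℂ) * t))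
    = Complex.exp (-(Complex.I * ((ω + 1 : ℝ) : ℂ) * t)) * (Real.cos t + Complex.I * Real.sin t) := by
  have h : Complex.exp ((t : ℂ) * Complex.I) = Real.cos t + Complex.I * Real.sin t := by
    rw [Complex.exp_mul_I, Complex.ofReal_cos, Complex.ofReal_sin]
    ring
  rw [← h, ← Complex.exp_add]
  congr 1
  push_cast
  ring

/-- The two Killing fields combine so that `e^{-it}` factors out; this factor is what raises the
frequency by one. -/
theorem ladderPlus_apply (ψ : SpinorField) (t ρ : ℝ) : ladderPlus ψ t ρ
    = ((Real.cos t : ℂ) - Complex.I * Real.sin t) • (Complex.I • (Real.cos ρ : ℂ) • deriv (ψ t) ρ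
      + (Real.sin ρ : ℂ) • deriv (fun s => ψ s ρ) t
      + (Real.cos ρ : ℂ) • Matrix.mulVec sigma01 (ψ t ρ)) := by
  ext i
  simp only [ladderPlus, lieKilling1, lieKilling2, Pi.add_apply, Pi.sub_apply, Pi.smul_apply,
    smul_eq_mul, Complex.real_smul]
  push_cast
  linear_combination (Complex.sin t * Complex.cos ρ * deriv (ψ t) ρ i) * Complex.I_mul_I

theorem ladderMinus_apply (ψ : SpinorField) (t ρ : ℝ) : ladderMinus ψ t ρ
    = ((Real.cos t : ℂ) + Complex.I * Real.sin t) • (-Complex.I • (Real.cos ρ : ℂ) • deriv (ψ t) ρ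
      + (Real.sin ρ : ℂ) • deriv (fun s => ψ s ρ) t
      + (Real.cos ρ : ℂ) • Matrix.mulVec sigma01 (ψ t ρ)) := by
  ext i
  simp only [ladderMinus, lieKilling1, lieKilling2, Pi.add_apply, Pi.sub_apply, Pi.smul_apply,
    smul_eq_mul, Complex.real_smul]
  push_cast
  linear_combination (Complex.sin t * Complex.cos ρ * deriv (ψ t) ρ i) * Complex.I_mul_I

theorem sigma01_mulVec (a b : ℂ) :
    Matrix.mulVec sigma01 ![a, b] = ![Complex.I / 2 * b, -(Complex.I / 2) * a] := by
  ext i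
  fin_cases i <;> simp [sigma01, Matrix.mulVec, dotProduct]

/-- The constant `ω + 1/2` collects `ω` from the time derivative and `1/2` from differentiating
`√(cos ρ)`. -/
theorem ladderPlus_stationaryField {ω : ℝ} {U V : ℝ → ℝ} {t ρ U' V' : ℝ} (hρ : ρ ∈ strip)
    (hU : HasDerivAt U U' ρ) (hV : HasDerivAt V V' ρ) :
    ladderPlus (stationaryField ω U V) t ρ
      = (Complex.I * Real.sqrt (Real.cos ρ) * Complex.exp (-(Complex.I * ((ω + 1 : ℝ) : ℂ) * t)))
        • ![((Real.cos ρ * U' - (ω + 1 / 2) * Real.sin ρ * U ρ + Real.cos ρ / 2 * V ρ : ℝ) : ℂ),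
          ((Real.cos ρ * V' - (ω + 1 / 2) * Real.sin ρ * V ρ - Real.cos ρ / 2 * U ρ : ℝ) : ℂ)] := by
  rw [ladderPlus_apply, deriv_space_stationaryField hρ hU hV, deriv_time_stationaryField,
    stationaryField_apply, sigma01_mulVec, exp_freq_succ]
  ext i
  fin_cases i
  · simp only [Fin.zero_eta, Pi.smul_apply, Pi.add_apply, Matrix.cons_val_zero, smul_eq_mul]
    push_cast
    ring
  · simp only [Fin.mk_one, Pi.smul_apply, Pi.add_apply, Matrix.cons_val_one,
      Matrix.cons_val_fin_one, smul_eq_mul]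
    push_cast
    ring

/-- Starting at frequency `ω + 1`, the half from the square root is now subtracted, so the same
constant `ω + 1/2` appears as for raising. -/
theorem ladderMinus_stationaryField {ω : ℝ} {U V : ℝ → ℝ} {t ρ U' V' : ℝ} (hρ : ρ ∈ strip)
    (hU : HasDerivAt U U' ρ) (hV : HasDerivAt V V' ρ) :
    ladderMinus (stationaryField (ω + 1) U V) t ρ
      = (-Complex.I * Real.sqrt (Real.cos ρ) * Complex.exp (-(Complex.I * (ω : ℂ) * t)))
        • ![((Real.cos ρ * U' + (ω + 1 / 2) * Real.sin ρ * U ρ - Real.cos ρ / 2 * V ρ : ℝ) : ℂ),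
          ((Real.cos ρ * V' + (ω + 1 / 2) * Real.sin ρ * V ρ + Real.cos ρ / 2 * U ρ : ℝ) : ℂ)] := by
  rw [ladderMinus_apply, deriv_space_stationaryField hρ hU hV, deriv_time_stationaryField,
    stationaryField_apply, sigma01_mulVec, exp_freq_pred ω]
  ext i
  fin_cases i
  · simp only [Fin.zero_eta, Pi.smul_apply, Pi.add_apply, Matrix.cons_val_zero, smul_eq_mul]
    push_cast
    ring
  · simp only [Fin.mk_one, Pi.smul_apply, Pi.add_apply, Matrix.cons_val_one,
      Matrix.cons_val_fin_one, smul_eq_mul]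
    push_cast
    ring

theorem diracDensity_stationaryField {ω ω' : ℝ} {U V U' V' : ℝ → ℝ} {t ρ : ℝ} (hρ : ρ ∈ strip) :
    Complex.exp (Complex.I * (ω - ω') * t) * ((U ρ * U' ρ + V ρ * V' ρ : ℝ) : ℂ)
      = diracDensity (stationaryField ω U V) (stationaryField ω' U' V') t ρ := by
  have hc : (Real.cos ρ : ℂ) ≠ 0 := Complex.ofReal_ne_zero.2 (cos_pos_of_mem_strip hρ).ne'
  have hs : (Real.sqrt (Real.cos ρ) : ℂ) ^ 2 = Real.cos ρ := by
    exact_mod_cast Real.sq_sqrt (cos_pos_of_mem_strip hρ).le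
  have he : Complex.exp (Complex.I * (ω - ω') * t)
      = Complex.exp (Complex.I * ω * t) * Complex.exp (-(Complex.I * ω' * t)) := by
    rw [← Complex.exp_add]; congr 1; ring
  have hstar : star (Complex.exp (-(Complex.I * ω * t))) = Complex.exp (Complex.I * ω * t) := by
    rw [Complex.star_def, ← Complex.exp_conj]; simp
  rw [diracDensity, stationaryField_apply, stationaryField_apply, eq_div_iff hc, he, ← hs]
  simp only [dotProduct, Fin.sum_univ_two, Pi.star_apply, Matrix.cons_val_zero,
    Matrix.cons_val_one, Matrix.cons_val_fin_one, star_mul', hstar]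
  simp only [Complex.star_def, Complex.conj_ofReal]
  push_cast
  ring

/-- The lowering relations follow from the raising relations by inverting a matrix. -/
theorem lower_of_raise {κ u u' v v' c s a M : ℝ} (hu : κ * u' = a * (c * v - s * u) - M * u)
    (hv : κ * v' = M * v - a * (c * u + s * v)) (hκ : κ ^ 2 = a ^ 2 - M ^ 2) (hκ0 : κ ≠ 0)
    (hsc : s ^ 2 + c ^ 2 = 1) :
    a * (c * v' + s * u') - M * u' = -κ * u ∧ M * v' - a * (c * u' - s * v') = -κ * v := by
  constructor <;> refine mul_left_cancel₀ hκ0 ?_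
  · linear_combination (a * s - M) * hu + a * c * hv + u * hκ - a ^ 2 * u * hsc
  · linear_combination (a * s + M) * hv - a * c * hu + v * hκ - a ^ 2 * v * hsc

namespace LadderModes

variable {M : ℝ} {ω : ℤ → ℝ} {U V : ℤ → ℝ → ℝ} {κ : ℤ → ℝ}

theorem lower (h : LadderModes M ω U V κ) (n : ℤ) {ρ : ℝ} (hρ : ρ ∈ strip) :
    (ω n + 1 / 2) * (Real.cos ρ * V (n + 1) ρ + Real.sin ρ * U (n + 1) ρ) - M * U (n + 1) ρ
      = -κ n * U n ρ ∧
    M * V (n + 1) ρ - (ω n + 1 / 2) * (Real.cos ρ * U (n + 1) ρ - Real.sin ρ * V (n + 1) ρ)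
      = -κ n * V n ρ :=
  lower_of_raise (h.raise_fst n ρ hρ) (h.raise_snd n ρ hρ) (h.coeff_sq n) (h.coeff_ne_zero n)
    (Real.sin_sq_add_cos_sq ρ)

/-- The Dirac equation eliminates the derivatives and leaves the algebraic raising relations. -/
theorem ladderPlus_mode (h : LadderModes M ω U V κ) (n : ℤ) (t : ℝ) {ρ : ℝ} (hρ : ρ ∈ strip) :
    ladderPlus (stationaryField (ω n) (U n) (V n)) t ρ
      = (Complex.I * κ n) • stationaryField (ω (n + 1)) (U (n + 1)) (V (n + 1)) t ρ := by
  have hc := (cos_pos_of_mem_strip hρ).ne'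
  rw [ladderPlus_stationaryField hρ (h.deriv_fst n ρ hρ) (h.deriv_snd n ρ hρ),
    stationaryField_apply, h.freq_succ]
  have h1 : Real.cos ρ * (ω n * V n ρ - M / Real.cos ρ * U n ρ)
      - (ω n + 1 / 2) * Real.sin ρ * U n ρ + Real.cos ρ / 2 * V n ρ = κ n * U (n + 1) ρ := by
    rw [h.raise_fst n ρ hρ]; field_simp; ring
  have h2 : Real.cos ρ * (M / Real.cos ρ * V n ρ - ω n * U n ρ)
      - (ω n + 1 / 2) * Real.sin ρ * V n ρ - Real.cos ρ / 2 * U n ρ = κ n * V (n + 1) ρ := by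
    rw [h.raise_snd n ρ hρ]; field_simp; ring
  rw [h1, h2]
  ext i
  fin_cases i
  · simp only [Fin.zero_eta, Pi.smul_apply, Matrix.cons_val_zero, smul_eq_mul]
    push_cast
    ring
  · simp only [Fin.mk_one, Pi.smul_apply, Matrix.cons_val_one, Matrix.cons_val_fin_one, smul_eq_mul]
    push_cast
    ring

theorem ladderMinus_mode (h : LadderModes M ω U V κ) (n : ℤ) (t : ℝ) {ρ : ℝ} (hρ : ρ ∈ strip) :
    ladderMinus (stationaryField (ω (n + 1)) (U (n + 1)) (V (n + 1))) t ρ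
      = (Complex.I * κ n) • stationaryField (ω n) (U n) (V n) t ρ := by
  have hc := (cos_pos_of_mem_strip hρ).ne'
  have hU := h.deriv_fst (n + 1) ρ hρ
  have hV := h.deriv_snd (n + 1) ρ hρ
  rw [h.freq_succ] at hU hV ⊢
  rw [ladderMinus_stationaryField hρ hU hV, stationaryField_apply]
  have h1 : Real.cos ρ * ((ω n + 1) * V (n + 1) ρ - M / Real.cos ρ * U (n + 1) ρ)
      + (ω n + 1 / 2) * Real.sin ρ * U (n + 1) ρ - Real.cos ρ / 2 * V (n + 1) ρ
        = -κ n * U n ρ := by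
    rw [← (h.lower n hρ).1]; field_simp; ring
  have h2 : Real.cos ρ * (M / Real.cos ρ * V (n + 1) ρ - (ω n + 1) * U (n + 1) ρ)
      + (ω n + 1 / 2) * Real.sin ρ * V (n + 1) ρ + Real.cos ρ / 2 * U (n + 1) ρ
        = -κ n * V n ρ := by
    rw [← (h.lower n hρ).2]; field_simp; ring
  rw [h1, h2]
  ext i
  fin_cases i
  · simp only [Fin.zero_eta, Pi.smul_apply, Matrix.cons_val_zero, smul_eq_mul]
    push_cast
    ring
  · simp only [Fin.mk_one, Pi.smul_apply, Matrix.cons_val_one, Matrix.cons_val_fin_one, smul_eq_mul]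
    push_cast
    ring

theorem isOrthonormalModes (h : LadderModes M ω U V κ) :
    IsOrthonormalModes fun n => stationaryField (ω n) (U n) (V n) := by
  intro t j k
  have hd := fun ρ hρ => diracDensity_stationaryField (ω := ω j) (ω' := ω k) (U := U j) (V := V j)
    (U' := U k) (V' := V k) (t := t) (ρ := ρ) hρ
  have hi : IntervalIntegrable (fun ρ => ((U j ρ * U k ρ + V j ρ * V k ρ : ℝ) : ℂ))
      MeasureTheory.volume (-(Real.pi / 2)) (Real.pi / 2) :=
    ⟨(h.integrable j k).1.ofReal, (h.integrable j k).2.ofReal⟩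
  refine ⟨intervalIntegrable_congr_strip hd (hi.const_mul _), ?_⟩
  rw [diracInner, ← integral_congr_strip hd, intervalIntegral.integral_const_mul,
    intervalIntegral.integral_ofReal, h.integral]
  split_ifs with hjk
  · subst hjk; simp
  · simp

theorem areCharges (h : LadderModes M ω U V κ) (hd : (1 : ℤ) ≠ 0) (hd' : (-1 : ℤ) ≠ 0) (c : ℝ) :
    AreCharges (fun n => stationaryField (ω n) (U n) (V n)) ω c
      (numberCharge (excitation ω) c) (shiftCharge (fun n => Complex.I * κ n) hd)
      (shiftCharge (fun n => Complex.I * κ (n - 1)) hd') where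
  plus := isQuantumCharge_shiftCharge hd h.isOrthonormalModes fun k t _ hρ =>
    h.ladderPlus_mode k t hρ
  minus := isQuantumCharge_shiftCharge hd' h.isOrthonormalModes fun k t ρ hρ => by
    have := h.ladderMinus_mode (k - 1) t hρ
    rwa [sub_add_cancel] at this
  frequency j := timeTranslation_stationaryField (ω j) (U j) (V j)
  zero := isTimeTranslationCharge_numberCharge ω c

/-- In consecutive differences of `κ²` the mass drops out, and `(ω + 3/2)² - (ω + 1/2)² = 2 (ω +
1)`. -/
theorem isUnitarySl2Action (h : LadderModes M ω U V κ) (hd : (1 : ℤ) ≠ 0) (hd' : (-1 : ℤ) ≠ 0)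
    {c : ℝ} (hc : κ (-1) ^ 2 = 2 * c) :
    IsUnitarySl2Action (numberCharge (excitation ω) c)
      (shiftCharge (fun n => Complex.I * κ n) hd)
      (shiftCharge (fun n => Complex.I * κ (n - 1)) hd') := by
  have hn : ∀ x : ℝ, Complex.normSq (Complex.I * x) = x ^ 2 := fun x => by
    rw [Complex.normSq_mul, Complex.normSq_I, Complex.normSq_ofReal]; ring
  refine isUnitarySl2Action_charges hd hd' (fun k => ?_) h.freq_succ (fun k => ?_) ?_
  · simp
  · rw [hn, hn, h.coeff_sq, h.coeff_sq, h.freq_succ]; ring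
  · rw [hn, hc]

end LadderModes

section Massless

/-! ## Massless modes -/

theorem LadderModes.shift {M : ℝ} {ω : ℤ → ℝ} {U V : ℤ → ℝ → ℝ} {κ : ℤ → ℝ}
    (h : LadderModes M ω U V κ) (j₀ : ℤ) :
    LadderModes M (fun n => ω (j₀ + n)) (fun n => U (j₀ + n)) (fun n => V (j₀ + n))
      (fun n => κ (j₀ + n)) where
  freq_succ n := by simp only [← add_assoc, h.freq_succ]
  deriv_fst n := h.deriv_fst (j₀ + n)
  deriv_snd n := h.deriv_snd (j₀ + n)
  raise_fst n ρ hρ := by simp only [← add_assoc, h.raise_fst _ ρ hρ]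
  raise_snd n ρ hρ := by simp only [← add_assoc, h.raise_snd _ ρ hρ]
  coeff_sq n := h.coeff_sq (j₀ + n)
  coeff_ne_zero n := h.coeff_ne_zero (j₀ + n)
  integrable j k := h.integrable (j₀ + j) (j₀ + k)
  integral j k := by simp only [h.integral, add_right_inj]

variable (βp βm : ℝ)

/-- The phase `ν_j ρ - (β₊ - β₋)/2` of the massless modes. -/
def masslessPhase (j : ℤ) (ρ : ℝ) : ℝ := masslessFreq βp βm j * ρ - (βp - βm) / 2

/-- The first component of the massless modes. -/
def masslessFst (j : ℤ) (ρ : ℝ) : ℝ := 1 / Real.sqrt Real.pi *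
  if Even j then Real.cos (masslessPhase βp βm j ρ) else Real.sin (masslessPhase βp βm j ρ)

/-- The second component of the massless modes. -/
def masslessSnd (j : ℤ) (ρ : ℝ) : ℝ := 1 / Real.sqrt Real.pi *
  if Even j then -Real.sin (masslessPhase βp βm j ρ) else Real.cos (masslessPhase βp βm j ρ)

/-- The raising coefficient of the massless modes. -/
def masslessCoeff (j : ℤ) : ℝ :=
  if Even j then -(masslessFreq βp βm j + 1 / 2) else masslessFreq βp βm j + 1 / 2

theorem masslessMode_eq (j : ℤ) : masslessMode βp βm j
    = stationaryField (masslessFreq βp βm j) (masslessFst βp βm j) (masslessSnd βp βm j) := by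
  unfold masslessMode stationaryField
  congr 1
  funext t ρ
  by_cases hj : Even j
  · ext i
    fin_cases i <;> simp [hj, masslessFst, masslessSnd, masslessPhase] <;> ring
  · ext i
    fin_cases i <;> simp [hj, masslessFst, masslessSnd, masslessPhase] <;> ring

theorem masslessFreq_add (j k : ℤ) : masslessFreq βp βm (j + k) = masslessFreq βp βm j + k := by
  simp only [masslessFreq]; push_cast; ring

theorem masslessFreq_succ (j : ℤ) : masslessFreq βp βm (j + 1) = masslessFreq βp βm j + 1 := by
  rw [masslessFreq_add]; push_cast; rfl

theorem masslessPhase_succ (j : ℤ) (ρ : ℝ) :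
    masslessPhase βp βm (j + 1) ρ = masslessPhase βp βm j ρ + ρ := by
  rw [masslessPhase, masslessFreq_succ, masslessPhase]; ring

theorem masslessPhase_sub (j k : ℤ) (ρ : ℝ) :
    masslessPhase βp βm j ρ - masslessPhase βp βm k ρ = ((j - k : ℤ) : ℝ) * ρ := by
  simp only [masslessPhase, masslessFreq]; push_cast; ring

theorem hasDerivAt_masslessPhase (j : ℤ) (ρ : ℝ) :
    HasDerivAt (masslessPhase βp βm j) (masslessFreq βp βm j) ρ :=
  (((hasDerivAt_id ρ).const_mul (masslessFreq βp βm j)).sub_const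
    ((βp - βm) / 2)).congr_deriv (mul_one _)

/-- By the addition formulas only the phase difference enters, and there the boundary parameters
cancel. -/
theorem massless_density (j k : ℤ) (ρ : ℝ) :
    masslessFst βp βm j ρ * masslessFst βp βm k ρ + masslessSnd βp βm j ρ * masslessSnd βp βm k ρ
      = 1 / Real.pi * (if Even (j - k) then Real.cos (((j - k : ℤ) : ℝ) * ρ) else
          (if Even k then 1 else -1) * Real.sin (((j - k : ℤ) : ℝ) * ρ)) := by
  have hp : 1 / Real.pi = 1 / Real.sqrt Real.pi * (1 / Real.sqrt Real.pi) := by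
    rw [div_mul_div_comm, Real.mul_self_sqrt Real.pi_pos.le, one_mul]
  rw [hp, ← masslessPhase_sub βp βm, Real.cos_sub, Real.sin_sub]
  by_cases hj : Even j <;> by_cases hk : Even k <;>
    simp only [masslessFst, masslessSnd, Int.even_sub, hj, hk, if_true, if_false, iff_true,
      iff_false, not_true] <;> ring

theorem integral_cos_even {n : ℤ} (hn : Even n) :
    ∫ ρ in (-(Real.pi / 2))..(Real.pi / 2), Real.cos ((n : ℝ) * ρ)
      = if n = 0 then Real.pi else 0 := by
  split_ifs with h0
  · subst h0
    simp
  · obtain ⟨m, rfl⟩ := hn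
    have h : ((m + m : ℤ) : ℝ) ≠ 0 := by exact_mod_cast h0
    rw [intervalIntegral.integral_comp_mul_left _ h, integral_cos]
    have h1 : ((m + m : ℤ) : ℝ) * (Real.pi / 2) = m * Real.pi := by push_cast; ring
    rw [mul_neg, h1, Real.sin_neg, Real.sin_int_mul_pi]
    simp

theorem integral_sin_mul (a : ℝ) :
    ∫ ρ in (-(Real.pi / 2))..(Real.pi / 2), Real.sin (a * ρ) = 0 := by
  have h := intervalIntegral.integral_comp_neg (fun ρ => Real.sin (a * ρ))
    (a := -(Real.pi / 2)) (b := Real.pi / 2)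
  simp only [mul_neg, Real.sin_neg, intervalIntegral.integral_neg, neg_neg] at h
  linarith

theorem integral_massless_density (j k : ℤ) : ∫ ρ in (-(Real.pi / 2))..(Real.pi / 2),
    (masslessFst βp βm j ρ * masslessFst βp βm k ρ + masslessSnd βp βm j ρ * masslessSnd βp βm k ρ)
      = if j = k then 1 else 0 := by
  simp only [massless_density]
  rw [intervalIntegral.integral_const_mul]
  by_cases he : Even (j - k)
  · simp only [he, if_true]
    rw [integral_cos_even he]
    simp only [sub_eq_zero]
    split_ifs
    · exact one_div_mul_cancel Real.pi_ne_zero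
    · simp
  · simp only [he, if_false]
    have hjk : j ≠ k := fun h => he (by simp [h])
    rw [intervalIntegral.integral_const_mul, integral_sin_mul, if_neg hjk, mul_zero, mul_zero]

/-- Raising is the angle addition `masslessPhase_succ`; the alternating sign of the coefficient
reflects the alternation of cosine and sine. The frequency `-1/2` is excluded because its raising
coefficient vanishes. -/
theorem ladderModes_massless (hν : ∀ n, masslessFreq βp βm n + 1 / 2 ≠ 0) :
    LadderModes 0 (masslessFreq βp βm) (masslessFst βp βm) (masslessSnd βp βm)
      (masslessCoeff βp βm) where
  freq_succ := masslessFreq_succ βp βm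
  deriv_fst n ρ _ := by
    have h := hasDerivAt_masslessPhase βp βm n ρ
    unfold masslessFst masslessSnd
    by_cases hn : Even n
    · simp only [hn, if_true]
      exact (h.cos.const_mul _).congr_deriv (by ring)
    · simp only [hn, if_false]
      exact (h.sin.const_mul _).congr_deriv (by ring)
  deriv_snd n ρ _ := by
    have h := hasDerivAt_masslessPhase βp βm n ρ
    unfold masslessFst masslessSnd
    by_cases hn : Even n
    · simp only [hn, if_true]
      exact (h.sin.neg.const_mul _).congr_deriv (by ring)
    · simp only [hn, if_false]
      exact (h.cos.const_mul _).congr_deriv (by ring)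
  raise_fst n ρ _ := by
    by_cases hn : Even n <;>
      simp only [masslessFst, masslessSnd, masslessCoeff, masslessPhase_succ, hn, Int.even_add_one,
        not_true, not_false_iff, if_true, if_false, Real.sin_add, Real.cos_add] <;> ring
  raise_snd n ρ _ := by
    by_cases hn : Even n <;>
      simp only [masslessFst, masslessSnd, masslessCoeff, masslessPhase_succ, hn, Int.even_add_one,
        not_true, not_false_iff, if_true, if_false, Real.sin_add, Real.cos_add] <;> ring
  coeff_sq n := by rw [masslessCoeff]; split_ifs <;> ring
  coeff_ne_zero n := by
    rw [masslessCoeff]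
    split_ifs
    · exact neg_ne_zero.2 (hν n)
    · exact hν n
  integrable j k := by
    simp only [massless_density]
    refine Continuous.intervalIntegrable ?_ _ _
    by_cases he : Even (j - k) <;> simp only [he, if_true, if_false] <;> fun_prop
  integral := integral_massless_density βp βm

end Massless

section Jacobi

/-! ## Jacobi polynomials -/

open Polynomial in
/-- The Jacobi polynomial `P_n^{(a,b)}` as a polynomial in `(1 - x)/2`. -/
def jacobiPoly (n : ℕ) (a b : ℝ) : ℝ[X] :=
  ∑ k ∈ Finset.range (n + 1), monomial k
    (Real.Gamma (n + a + 1) / (n.factorial * Real.Gamma (a + 1)) *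
      ((ascPochhammer ℝ k).eval ((n : ℝ) + a + b + 1) * (ascPochhammer ℝ k).eval (-(n : ℝ))
        / ((ascPochhammer ℝ k).eval (a + 1) * k.factorial)))

/-- No bound on `k` is needed: beyond degree `n` the Pochhammer symbol of `-n` vanishes. -/
theorem coeff_jacobiPoly (n : ℕ) (a b : ℝ) (k : ℕ) : (jacobiPoly n a b).coeff k
    = Real.Gamma (n + a + 1) / (n.factorial * Real.Gamma (a + 1)) *
      ((ascPochhammer ℝ k).eval ((n : ℝ) + a + b + 1) * (ascPochhammer ℝ k).eval (-(n : ℝ))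
        / ((ascPochhammer ℝ k).eval (a + 1) * k.factorial)) := by
  simp only [jacobiPoly, Polynomial.finsetSum_coeff, Polynomial.coeff_monomial]
  rw [Finset.sum_ite_eq' (Finset.range (n + 1)) k]
  split_ifs with h
  · rfl
  · rw [ascPochhammer_eval_neg_coe_nat_of_lt (by simpa [Nat.lt_succ_iff] using h)]
    simp

theorem jacobiP_eq_eval (n : ℕ) (a b x : ℝ) :
    jacobiP n a b x = (jacobiPoly n a b).eval ((1 - x) / 2) := by
  simp only [jacobiP, jacobiPoly, Polynomial.eval_finsetSum, Polynomial.eval_monomial,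
    Finset.mul_sum, mul_assoc]

theorem ascPochhammer_eval_succ_right (x : ℝ) (k : ℕ) :
    (ascPochhammer ℝ (k + 1)).eval x = (ascPochhammer ℝ k).eval x * (x + k) :=
  ascPochhammer_succ_eval k x

theorem ascPochhammer_eval_succ_left (x : ℝ) (k : ℕ) :
    (ascPochhammer ℝ (k + 1)).eval x = x * (ascPochhammer ℝ k).eval (x + 1) := by
  rw [ascPochhammer_succ_left]; simp

theorem ascPochhammer_eval_pos {x : ℝ} (hx : 0 < x) (k : ℕ) : 0 < (ascPochhammer ℝ k).eval x :=
  ascPochhammer_pos k x hx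

variable {M : ℝ}

/-- The polynomial `P_n^{(-1/2-M,-1/2+M)}` in `(1 - x)/2`. -/
def modePoly (M : ℝ) (n : ℕ) : Polynomial ℝ := jacobiPoly n (-(1 / 2) - M) (-(1 / 2) + M)

/-- Here `a + b + 1 = 0`, so the series is a multiple of `F(n, -n; 1/2 - M; y)`. -/
theorem coeff_modePoly (M : ℝ) (n k : ℕ) : (modePoly M n).coeff k
    = Real.Gamma (n + (1 / 2 - M)) / (n.factorial * Real.Gamma (1 / 2 - M)) *
      ((ascPochhammer ℝ k).eval (n : ℝ) * (ascPochhammer ℝ k).eval (-(n : ℝ))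
        / ((ascPochhammer ℝ k).eval (1 / 2 - M) * k.factorial)) := by
  rw [modePoly, coeff_jacobiPoly]
  ring_nf

theorem coeff_modePoly_succ (hM : M < 1 / 2) (n k : ℕ) :
    (k + 1) * (1 / 2 - M + k) * (modePoly M n).coeff (k + 1)
      = (n + k) * (k - n) * (modePoly M n).coeff k := by
  have h : 0 < 1 / 2 - M := by linarith
  have h1 := (ascPochhammer_eval_pos h k).ne'
  have h2 : 1 / 2 - M + k ≠ 0 := by positivity
  rw [coeff_modePoly, coeff_modePoly, ascPochhammer_eval_succ_right, ascPochhammer_eval_succ_right,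
    ascPochhammer_eval_succ_right, Nat.factorial_succ]
  generalize 1 / 2 - M = c at *
  push_cast
  field_simp
  ring

theorem modePoly_prefactor_succ (hM : M < 1 / 2) (n : ℕ) :
    Real.Gamma ((n + 1 : ℕ) + (1 / 2 - M)) / ((n + 1).factorial * Real.Gamma (1 / 2 - M))
      = (1 / 2 - M + n) / (n + 1)
        * (Real.Gamma (n + (1 / 2 - M)) / (n.factorial * Real.Gamma (1 / 2 - M))) := by
  have h : 0 < 1 / 2 - M := by linarith
  have h1 := (Real.Gamma_pos_of_pos h).ne'
  have h2 : (n : ℝ) + (1 / 2 - M) ≠ 0 := by positivity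
  have e : ((n + 1 : ℕ) : ℝ) + (1 / 2 - M) = n + (1 / 2 - M) + 1 := by push_cast; ring
  rw [e, Real.Gamma_add_one h2, Nat.factorial_succ]
  generalize 1 / 2 - M = c at *
  push_cast
  field_simp
  ring

theorem coeff_modePoly_zero_succ (hM : M < 1 / 2) (n : ℕ) :
    (n + 1) * (modePoly M (n + 1)).coeff 0 = (1 / 2 - M + n) * (modePoly M n).coeff 0 := by
  rw [coeff_modePoly, coeff_modePoly, modePoly_prefactor_succ hM]
  simp only [ascPochhammer_zero, Polynomial.eval_one]
  field_simp

/-- The factor `n` completes `(n+1)_{k+1}` to `(n)_{k+2}`, which expresses everything through the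
degree `n` polynomial. -/
theorem coeff_modePoly_succ_succ (hM : M < 1 / 2) (n k : ℕ) :
    n * ((k + 1) * (1 / 2 - M + k) * (modePoly M (n + 1)).coeff (k + 1))
      = -((1 / 2 - M + n) * (n + k) * (n + k + 1)) * (modePoly M n).coeff k := by
  have h : 0 < 1 / 2 - M := by linarith
  have h1 := (ascPochhammer_eval_pos h k).ne'
  have h2 : 1 / 2 - M + k ≠ 0 := by positivity
  have e1 : (n : ℝ) * (ascPochhammer ℝ (k + 1)).eval (((n + 1 : ℕ) : ℝ))
      = (ascPochhammer ℝ k).eval (n : ℝ) * (n + k) * (n + k + 1) := by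
    rw [Nat.cast_succ, ← ascPochhammer_eval_succ_left, ascPochhammer_eval_succ_right,
      ascPochhammer_eval_succ_right]
    push_cast; ring
  have e2 : (ascPochhammer ℝ (k + 1)).eval (-((n + 1 : ℕ) : ℝ))
      = -(n + 1) * (ascPochhammer ℝ k).eval (-(n : ℝ)) := by
    rw [ascPochhammer_eval_succ_left]; push_cast; ring_nf
  rw [coeff_modePoly, coeff_modePoly, modePoly_prefactor_succ hM, e2,
    ascPochhammer_eval_succ_right (1 / 2 - M), Nat.factorial_succ]
  have e3 : ∀ A B C D E : ℝ, (n : ℝ) * (A * (B * (C * D / E))) = A * (B * ((n * C) * D / E)) :=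
    fun A B C D E => by ring
  rw [e3, e1]
  generalize 1 / 2 - M = c at *
  push_cast
  field_simp

theorem coeff_X_mul_derivative (p : Polynomial ℝ) (k : ℕ) :
    (Polynomial.X * Polynomial.derivative p).coeff k = k * p.coeff k := by
  cases k with
  | zero => simp
  | succ k => rw [Polynomial.coeff_X_mul, Polynomial.coeff_derivative]; push_cast; ring

open Polynomial in
/-- The hypergeometric equation. -/
theorem modePoly_ode (hM : M < 1 / 2) (n : ℕ) :
    X * derivative (derivative (modePoly M n)) - X * (X * derivative (derivative (modePoly M n)))
      + C (1 / 2 - M) * derivative (modePoly M n) - X * derivative (modePoly M n)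
      + C ((n : ℝ) ^ 2) * modePoly M n = 0 := by
  ext k
  have h := coeff_modePoly_succ hM n k
  have e : (X * (X * derivative (derivative (modePoly M n)))).coeff k
      = k * (k - 1) * (modePoly M n).coeff k := by
    cases k with
    | zero => simp
    | succ k =>
      rw [coeff_X_mul, coeff_X_mul_derivative, coeff_derivative]; push_cast; ring
  simp only [coeff_add, coeff_sub, coeff_C_mul, coeff_X_mul_derivative, e, coeff_derivative,
    coeff_zero]
  linear_combination h

open Polynomial in
-- A contiguous relation, the polynomial form of raising. Each coefficient is reduced to the `k`-th
-- one of `modePoly M n`. It is empty at `n = 0`, so that case is treated separately later.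
theorem modePoly_succ (hM : M < 1 / 2) (n : ℕ) :
    C ((n : ℝ) * (n + 1)) * modePoly M (n + 1)
      = C ((n : ℝ) * (n + (1 / 2 - M))) * modePoly M n
        - C ((n : ℝ) * (2 * n + 1)) * (X * modePoly M n)
        + C (2 * (n : ℝ) + 1) * (X * derivative (modePoly M n))
        - C (2 * (n : ℝ) + 1) * (X * (X * derivative (modePoly M n))) := by
  ext k
  cases k with
  | zero =>
    have h := coeff_modePoly_zero_succ hM n
    simp only [coeff_add, coeff_sub, coeff_C_mul, coeff_X_mul_zero]
    linear_combination n * h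
  | succ k =>
    have h1 := coeff_modePoly_succ hM n k
    have h2 := coeff_modePoly_succ_succ hM n k
    have h : 0 < 1 / 2 - M := by linarith
    have h3 : ((k : ℝ) + 1) * (1 / 2 - M + k) ≠ 0 := by positivity
    have e1 : (X * (X * derivative (modePoly M n))).coeff (k + 1) = k * (modePoly M n).coeff k := by
      rw [coeff_X_mul, coeff_X_mul_derivative]
    have e2 := coeff_X_mul_derivative (modePoly M n) (k + 1)
    have e3 := coeff_X_mul (modePoly M n) k
    simp only [coeff_add, coeff_sub, coeff_C_mul, e1, e2, e3]
    push_cast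
    refine mul_left_cancel₀ h3 ?_
    linear_combination (n + 1) * h2 - (n * (n + (1 / 2 - M)) + (2 * n + 1) * (k + 1)) * h1

open Polynomial in
-- Differentiate the contiguous relation, remove the second derivative by the hypergeometric
-- equation, and cancel `n + 1`.
theorem derivative_modePoly_succ (hM : M < 1 / 2) (n : ℕ) :
    C (n : ℝ) * derivative (modePoly M (n + 1))
      = C ((n : ℝ) + 1 - (1 / 2 - M)) * derivative (modePoly M n)
        - C (2 * (n : ℝ) + 1) * (X * derivative (modePoly M n))
        - C ((n : ℝ) * (2 * n + 1)) * modePoly M n := by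
  have h1 := congrArg derivative (modePoly_succ hM n)
  have h2 := modePoly_ode hM n
  have h3 : (C ((n : ℝ) + 1)) ≠ 0 := C_ne_zero.2 (by positivity)
  refine mul_left_cancel₀ h3 ?_
  simp only [derivative_add, derivative_sub, derivative_mul, derivative_C, derivative_X, zero_mul,
    zero_add, one_mul] at h1
  simp only [map_add, map_sub, map_mul, map_pow, map_one, map_ofNat] at h1 h2 ⊢
  linear_combination h1 + (2 * C (n : ℝ) + 1) * h2

/-- The derivative rule for Jacobi polynomials: peeling the first factor off each Pochhammer symbol
raises both parameters by one and lowers the degree. -/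
theorem coeff_jacobiPoly_pred (hM : M < 1 / 2) (n k : ℕ) :
    (n + 1) * (jacobiPoly n (1 / 2 - M) (1 / 2 + M)).coeff k
      = -((k + 1) * (modePoly M (n + 1)).coeff (k + 1)) := by
  have h : 0 < 1 / 2 - M := by linarith
  have h1 := (ascPochhammer_eval_pos (add_pos h one_pos) k).ne'
  have h2 := (Real.Gamma_pos_of_pos h).ne'
  have e1 : (n : ℝ) + (1 / 2 - M) + (1 / 2 + M) + 1 = ((n + 1 : ℕ) : ℝ) + 1 := by push_cast; ring
  have e2 : -((n + 1 : ℕ) : ℝ) + 1 = -(n : ℝ) := by push_cast; ring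
  have e3 : (n : ℝ) + (1 / 2 - M) + 1 = ((n + 1 : ℕ) : ℝ) + (1 / 2 - M) := by push_cast; ring
  rw [coeff_jacobiPoly, coeff_modePoly, ascPochhammer_eval_succ_left,
    ascPochhammer_eval_succ_left (-((n + 1 : ℕ) : ℝ)), ascPochhammer_eval_succ_left (1 / 2 - M),
    Nat.factorial_succ k, Nat.factorial_succ n, e1, e2, e3, Real.Gamma_add_one h.ne']
  generalize 1 / 2 - M = c at *
  push_cast
  field_simp

open Polynomial in
theorem derivative_modePoly (hM : M < 1 / 2) (n : ℕ) : derivative (modePoly M (n + 1))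
    = -(C ((n : ℝ) + 1) * jacobiPoly n (1 / 2 - M) (1 / 2 + M)) := by
  ext k
  rw [coeff_derivative, coeff_neg, coeff_C_mul, coeff_jacobiPoly_pred hM]
  ring

/-- The polynomial part of the first component of the type III modes. -/
def jacobiFst (M : ℝ) (n : ℕ) (x : ℝ) : ℝ :=
  if n = 0 then 0 else jacobiP (n - 1) (1 / 2 - M) (1 / 2 + M) x

/-- The polynomial part of the second component of the type III modes. -/
def jacobiSnd (M : ℝ) (n : ℕ) (x : ℝ) : ℝ := -2 * jacobiP n (-(1 / 2) - M) (-(1 / 2) + M) x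

theorem jacobiSnd_eq (M : ℝ) (n : ℕ) (x : ℝ) :
    jacobiSnd M n x = -2 * (modePoly M n).eval ((1 - x) / 2) := by
  rw [jacobiSnd, jacobiP_eq_eval, modePoly]

theorem modePoly_zero (hM : M < 1 / 2) : modePoly M 0 = 1 := by
  have h : 0 < 1 / 2 - M := by linarith
  have h2 := (Real.Gamma_pos_of_pos h).ne'
  rw [show 1 / 2 - M = -2⁻¹ - M + 1 by ring] at h2
  simp [modePoly, jacobiPoly, h2]

theorem nat_mul_jacobiFst (hM : M < 1 / 2) (n : ℕ) (x : ℝ) : n * jacobiFst M n x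
    = -(Polynomial.derivative (modePoly M n)).eval ((1 - x) / 2) := by
  cases n with
  | zero => simp [modePoly_zero hM]
  | succ n =>
    rw [derivative_modePoly hM, jacobiFst, if_neg n.succ_ne_zero, jacobiP_eq_eval]
    simp

theorem hasDerivAt_eval_half (p : Polynomial ℝ) (x : ℝ) :
    HasDerivAt (fun x => p.eval ((1 - x) / 2))
      (-(1 / 2) * (Polynomial.derivative p).eval ((1 - x) / 2)) x := by
  have h : HasDerivAt (fun x : ℝ => (1 - x) / 2) (-1 / 2) x :=
    ((hasDerivAt_id x).const_sub 1).div_const 2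
  refine ((p.hasDerivAt ((1 - x) / 2)).comp x h).congr_deriv ?_
  ring

theorem hasDerivAt_jacobiSnd (hM : M < 1 / 2) (n : ℕ) (x : ℝ) :
    HasDerivAt (jacobiSnd M n) (-(n * jacobiFst M n x)) x := by
  rw [funext (jacobiSnd_eq M n), nat_mul_jacobiFst hM]
  exact ((hasDerivAt_eval_half (modePoly M n) x).const_mul (-2)).congr_deriv (by ring)

/-- `jacobiFst` is proportional to the derivative of `modePoly`, so this is the hypergeometric
equation. Keeping `1 - x²` as a factor avoids division at `x = ±1`. -/
theorem hasDerivAt_jacobiFst (hM : M < 1 / 2) (n : ℕ) (x : ℝ) :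
    ∃ d, HasDerivAt (jacobiFst M n) d x ∧
      (1 - x ^ 2) * d = n * jacobiSnd M n x - (2 * M - x) * jacobiFst M n x := by
  by_cases hn : n = 0
  · subst hn
    refine ⟨0, ?_, by simp [jacobiFst]⟩
    exact hasDerivAt_const x (0 : ℝ)
  have hn' : (n : ℝ) ≠ 0 := Nat.cast_ne_zero.2 hn
  have e : jacobiFst M n
      = fun x => -1 / n * (Polynomial.derivative (modePoly M n)).eval ((1 - x) / 2) := by
    funext x
    have := nat_mul_jacobiFst hM n x
    field_simp
    linarith
  have hd := (hasDerivAt_eval_half (Polynomial.derivative (modePoly M n)) x).const_mul (-1 / (n : ℝ))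
  rw [← e] at hd
  refine ⟨_, hd, ?_⟩
  have h := congrArg (Polynomial.eval ((1 - x) / 2)) (modePoly_ode hM n)
  simp only [Polynomial.eval_add, Polynomial.eval_sub, Polynomial.eval_mul, Polynomial.eval_X,
    Polynomial.eval_C, Polynomial.eval_zero] at h
  rw [congrFun e x, jacobiSnd_eq]
  field_simp
  -- With `y = (1 - x)/2` one has `1 - x² = 4 y (1 - y)`.
  linear_combination 4 * h

theorem modePoly_one (hM : M < 1 / 2) (y : ℝ) : (modePoly M 1).eval y = 1 / 2 - M - y := by
  have h : 0 < 1 / 2 - M := by linarith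
  have h2 := (Real.Gamma_pos_of_pos h).ne'
  have e : -(1 / 2) - M + 1 = 1 / 2 - M := by ring
  have e1 : 1 + (-(1 / 2) - M) + 1 = 1 / 2 - M + 1 := by ring
  have e2 : 1 + (-(1 / 2) - M) + (-(1 / 2) + M) + 1 = 1 := by ring
  simp only [modePoly, jacobiPoly, Finset.sum_range_succ, Finset.sum_range_zero, Nat.cast_one,
    Polynomial.eval_add, Polynomial.eval_monomial, e, e1, e2,
    Real.Gamma_add_one h.ne', ascPochhammer_zero, ascPochhammer_one, Polynomial.eval_one,
    Polynomial.eval_X, zero_add, Nat.factorial_zero, Nat.factorial_one, pow_zero, pow_one]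
  generalize 1 / 2 - M = c at *
  field_simp
  ring

theorem jacobiFst_zero (x : ℝ) : jacobiFst M 0 x = 0 := if_pos rfl

theorem jacobiSnd_zero (hM : M < 1 / 2) (x : ℝ) : jacobiSnd M 0 x = -2 := by
  rw [jacobiSnd_eq, modePoly_zero hM]; simp

theorem jacobiSnd_succ (hM : M < 1 / 2) (n : ℕ) (x : ℝ) : (n + 1) * jacobiSnd M (n + 1) x
    = (n + 1 / 2) * ((1 - x ^ 2) * jacobiFst M n x + x * jacobiSnd M n x)
      - M * jacobiSnd M n x := by
  rcases Nat.eq_zero_or_pos n with rfl | hn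
  · rw [jacobiSnd_zero hM, jacobiFst_zero, jacobiSnd_eq, zero_add, modePoly_one hM]
    push_cast; ring
  have hn' : (n : ℝ) ≠ 0 := Nat.cast_ne_zero.2 hn.ne'
  have h := congrArg (Polynomial.eval ((1 - x) / 2)) (modePoly_succ hM n)
  simp only [Polynomial.eval_add, Polynomial.eval_sub, Polynomial.eval_mul, Polynomial.eval_X,
    Polynomial.eval_C] at h
  have h1 := nat_mul_jacobiFst hM n x
  rw [jacobiSnd_eq, jacobiSnd_eq]
  refine mul_left_cancel₀ hn' ?_
  linear_combination -2 * h - (n + 1 / 2) * (1 - x ^ 2) * h1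

theorem jacobiFst_succ (hM : M < 1 / 2) (n : ℕ) (x : ℝ) : (n + 1) * jacobiFst M (n + 1) x
    = (n + 1 / 2) * (x * jacobiFst M n x - jacobiSnd M n x) + M * jacobiFst M n x := by
  rcases Nat.eq_zero_or_pos n with rfl | hn
  · have h := nat_mul_jacobiFst hM 1 x
    have e : modePoly M 1 = Polynomial.C (1 / 2 - M) - Polynomial.X :=
      Polynomial.funext fun y => by rw [modePoly_one hM]; simp
    rw [e] at h
    simp at h
    rw [jacobiSnd_zero hM, jacobiFst_zero, zero_add, h]
    push_cast; ring
  have hn' : (n : ℝ) ≠ 0 := Nat.cast_ne_zero.2 hn.ne'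
  have h := congrArg (Polynomial.eval ((1 - x) / 2)) (derivative_modePoly_succ hM n)
  simp only [Polynomial.eval_sub, Polynomial.eval_mul, Polynomial.eval_X,
    Polynomial.eval_C] at h
  have h1 := nat_mul_jacobiFst hM n x
  have h2 := nat_mul_jacobiFst hM (n + 1) x
  push_cast at h2
  rw [jacobiSnd_eq]
  refine mul_left_cancel₀ hn' ?_
  linear_combination n * h2 - h - ((n + 1 / 2) * x + M) * h1

end Jacobi

section MassFactor

open Filter Topology

/-! ## The weight `((1 + sin ρ)/(1 - sin ρ))^M` -/

variable {M : ℝ}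

theorem sin_mem_of_mem_strip {ρ : ℝ} (h : ρ ∈ strip) : -1 < Real.sin ρ ∧ Real.sin ρ < 1 := by
  have := cos_pos_of_mem_strip h
  have h2 := Real.sin_sq_add_cos_sq ρ
  constructor <;> nlinarith

/-- The factor `((1 + sin ρ)/(1 - sin ρ))^{M/2}` of the massive modes. -/
def massFactor (M ρ : ℝ) : ℝ := ((1 + Real.sin ρ) / (1 - Real.sin ρ)) ^ (M / 2)

theorem massFactor_sq {ρ : ℝ} (h : ρ ∈ strip) :
    massFactor M ρ ^ 2 = ((1 + Real.sin ρ) / (1 - Real.sin ρ)) ^ M := by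
  obtain ⟨h1, h2⟩ := sin_mem_of_mem_strip h
  have h0 : 0 ≤ (1 + Real.sin ρ) / (1 - Real.sin ρ) := div_nonneg (by linarith) (by linarith)
  rw [massFactor, ← Real.rpow_natCast, ← Real.rpow_mul h0]
  congr 1; push_cast; ring

theorem hasDerivAt_massFactor {ρ : ℝ} (h : ρ ∈ strip) :
    HasDerivAt (massFactor M) (M / Real.cos ρ * massFactor M ρ) ρ := by
  obtain ⟨h1, h2⟩ := sin_mem_of_mem_strip h
  have hc := cos_pos_of_mem_strip h
  have h3 : 0 < 1 + Real.sin ρ := by linarith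
  have h4 : 0 < 1 - Real.sin ρ := by linarith
  have h5 : 0 < (1 + Real.sin ρ) / (1 - Real.sin ρ) := div_pos h3 h4
  have hs := Real.hasDerivAt_sin ρ
  have hd := ((hs.const_add 1).div (hs.const_sub 1) h4.ne').rpow_const (p := M / 2)
    (Or.inl h5.ne')
  refine hd.congr_deriv ?_
  rw [massFactor, Pi.div_apply, Real.rpow_sub_one h5.ne']
  have h6 : Real.cos ρ ^ 2 = (1 + Real.sin ρ) * (1 - Real.sin ρ) := by
    linear_combination Real.sin_sq_add_cos_sq ρ
  field_simp
  rw [h6]; ring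

/-- Under `x = (1 + sin ρ)/2`, with `dx = (cos ρ / 2) dρ`, the squared weight becomes a Beta
density. -/
theorem massFactor_sq_eq_beta {ρ : ℝ} (h : ρ ∈ strip) :
    massFactor M ρ ^ 2 = Real.cos ρ / 2 * (((1 + Real.sin ρ) / 2) ^ (1 / 2 + M - 1)
      * (1 - (1 + Real.sin ρ) / 2) ^ (1 / 2 - M - 1)) := by
  obtain ⟨h1, h2⟩ := sin_mem_of_mem_strip h
  have hc := cos_pos_of_mem_strip h
  have h3 : 0 < (1 + Real.sin ρ) / 2 := by linarith
  have h4 : 0 < (1 - Real.sin ρ) / 2 := by linarith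
  have h6 : Real.cos ρ / 2
      = ((1 + Real.sin ρ) / 2) ^ (1 / 2 : ℝ) * ((1 - Real.sin ρ) / 2) ^ (1 / 2 : ℝ) := by
    rw [← Real.mul_rpow h3.le h4.le, ← Real.sqrt_eq_rpow, eq_comm, Real.sqrt_eq_iff_mul_self_eq
      (by positivity) (by positivity)]
    linear_combination -Real.sin_sq_add_cos_sq ρ / 4
  rw [massFactor_sq h, show 1 - (1 + Real.sin ρ) / 2 = (1 - Real.sin ρ) / 2 by ring,
    show (1 + Real.sin ρ) / (1 - Real.sin ρ) = ((1 + Real.sin ρ) / 2) / ((1 - Real.sin ρ) / 2) by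
      field_simp, Real.div_rpow h3.le h4.le, h6]
  generalize (1 + Real.sin ρ) / 2 = a at *
  generalize (1 - Real.sin ρ) / 2 = b at *
  have e1 : a ^ M = a ^ (1 / 2 : ℝ) * a ^ (1 / 2 + M - 1) := by
    rw [← Real.rpow_add h3]; congr 1; ring
  have e2 : (b ^ M)⁻¹ = b ^ (1 / 2 : ℝ) * b ^ (1 / 2 - M - 1) := by
    rw [← Real.rpow_add h4, ← Real.rpow_neg h4.le]; congr 1; ring
  rw [div_eq_mul_inv, e1, e2]; ring

theorem image_half_one_add_sin : (fun ρ => (1 + Real.sin ρ) / 2) '' strip = Set.Ioo 0 1 := by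
  ext x
  constructor
  · rintro ⟨ρ, hρ, rfl⟩
    obtain ⟨h1, h2⟩ := sin_mem_of_mem_strip hρ
    constructor <;> simp only <;> linarith
  · rintro ⟨h0, h1⟩
    refine ⟨Real.arcsin (2 * x - 1), ⟨?_, ?_⟩, ?_⟩
    · exact Real.neg_pi_div_two_lt_arcsin.2 (by linarith)
    · exact Real.arcsin_lt_pi_div_two.2 (by linarith)
    · simp only
      rw [Real.sin_arcsin (by linarith) (by linarith)]; ring

/-- The Beta parameters `1/2 ± M` are positive and sum to one, so the denominator is `Γ(1) = 1`. -/
theorem massFactor_sq_integral (h1 : -(1 / 2) < M) (h2 : M < 1 / 2) :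
    IntervalIntegrable (fun ρ => massFactor M ρ ^ 2) MeasureTheory.volume
      (-(Real.pi / 2)) (Real.pi / 2) ∧
    ∫ ρ in (-(Real.pi / 2))..(Real.pi / 2), massFactor M ρ ^ 2
      = Real.Gamma (1 / 2 + M) * Real.Gamma (1 / 2 - M) := by
  set g : ℝ → ℂ := fun x => (x : ℂ) ^ (((1 / 2 + M : ℝ) : ℂ) - 1)
    * (1 - (x : ℂ)) ^ (((1 / 2 - M : ℝ) : ℂ) - 1) with hg
  have hu : 0 < (((1 / 2 + M : ℝ) : ℂ)).re := by rw [Complex.ofReal_re]; linarith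
  have hv : 0 < (((1 / 2 - M : ℝ) : ℂ)).re := by rw [Complex.ofReal_re]; linarith
  have hgi : MeasureTheory.IntegrableOn g (Set.Ioo 0 1) :=
    (intervalIntegrable_iff_integrableOn_Ioo_of_le zero_le_one).1
      (Complex.betaIntegral_convergent hu hv)
  have hgv : ∫ x in Set.Ioo 0 1, g x
      = ((Real.Gamma (1 / 2 + M) * Real.Gamma (1 / 2 - M) : ℝ) : ℂ) := by
    have := Complex.Gamma_mul_Gamma_eq_betaIntegral hu hv
    rw [Complex.betaIntegral, intervalIntegral.integral_of_le zero_le_one,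
      MeasureTheory.integral_Ioc_eq_integral_Ioo, ← Complex.ofReal_add,
      show 1 / 2 + M + (1 / 2 - M) = 1 by ring, Complex.ofReal_one, Complex.Gamma_one, one_mul,
      Complex.Gamma_ofReal, Complex.Gamma_ofReal] at this
    rw [← this]; push_cast; rfl
  have hd : ∀ ρ ∈ strip, HasDerivWithinAt (fun ρ => (1 + Real.sin ρ) / 2) (Real.cos ρ / 2) strip ρ :=
    fun ρ _ => (((Real.hasDerivAt_sin ρ).const_add 1).div_const 2).hasDerivWithinAt
  have hinj : Set.InjOn (fun ρ => (1 + Real.sin ρ) / 2) strip := fun x hx y hy hxy =>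
    Real.injOn_sin ⟨hx.1.le, hx.2.le⟩ ⟨hy.1.le, hy.2.le⟩ (by simp only at hxy; linarith)
  have he : ∀ ρ ∈ strip, |Real.cos ρ / 2| • g ((1 + Real.sin ρ) / 2)
      = ((massFactor M ρ ^ 2 : ℝ) : ℂ) := fun ρ hρ => by
    obtain ⟨h3, h4⟩ := sin_mem_of_mem_strip hρ
    have hc := cos_pos_of_mem_strip hρ
    rw [massFactor_sq_eq_beta hρ, abs_of_pos (by positivity), hg, Complex.real_smul,
      Complex.ofReal_mul, Complex.ofReal_mul, Complex.ofReal_cpow (by linarith),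
      Complex.ofReal_cpow (by linarith)]
    push_cast; rfl
  have hi := (MeasureTheory.integrableOn_image_iff_integrableOn_abs_deriv_smul measurableSet_Ioo hd
    hinj g).1 (by rwa [image_half_one_add_sin])
  have hv' := MeasureTheory.integral_image_eq_integral_abs_deriv_smul measurableSet_Ioo hd hinj g
  rw [image_half_one_add_sin, hgv, MeasureTheory.setIntegral_congr_fun measurableSet_Ioo he] at hv'
  have hi' := (hi.congr_fun he measurableSet_Ioo).re
  constructor
  · rw [intervalIntegrable_iff_integrableOn_Ioo_of_le neg_half_pi_lt_half_pi.le]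
    exact hi'
  · rw [intervalIntegral.integral_of_le neg_half_pi_lt_half_pi.le,
      MeasureTheory.integral_Ioc_eq_integral_Ioo]
    exact (Complex.ofReal_injective (hv'.trans integral_ofReal)).symm

/-- Since `(1 + s)/(1 - s) = ((1 + s)/c)²`, the behaviour at `π/2` is isolated in `cos ρ ^ (1 -
2M)`, whose exponent is positive for `M < 1/2`. The other endpoint follows by reflection. -/
theorem massFactor_sq_mul_cos {ρ : ℝ} (h : ρ ∈ strip) : massFactor M ρ ^ 2 * Real.cos ρ
    = Real.cos ρ ^ (1 - 2 * M) * (1 + Real.sin ρ) ^ (2 * M) := by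
  obtain ⟨h1, h2⟩ := sin_mem_of_mem_strip h
  have hc := cos_pos_of_mem_strip h
  have h3 : 0 < 1 + Real.sin ρ := by linarith
  have h4 : 0 < 1 - Real.sin ρ := by linarith
  rw [massFactor_sq h, show (1 + Real.sin ρ) / (1 - Real.sin ρ)
      = ((1 + Real.sin ρ) / Real.cos ρ) ^ (2 : ℝ) by
    rw [Real.rpow_two, div_pow, div_eq_div_iff h4.ne' (by positivity)]
    linear_combination (1 + Real.sin ρ) * Real.sin_sq_add_cos_sq ρ,
    ← Real.rpow_mul (by positivity), Real.div_rpow h3.le hc.le, Real.rpow_sub hc, Real.rpow_one]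
  ring

theorem massFactor_neg_arg (M ρ : ℝ) : massFactor M (-ρ) = massFactor (-M) ρ := by
  have h : 0 ≤ (1 + Real.sin ρ) / (1 - Real.sin ρ) :=
    div_nonneg (by linarith [Real.neg_one_le_sin ρ]) (by linarith [Real.sin_le_one ρ])
  rw [massFactor, massFactor, neg_div, Real.rpow_neg h, ← Real.inv_rpow h, inv_div, Real.sin_neg,
    sub_neg_eq_add, sub_eq_add_neg]

theorem tendsto_massFactor_right (h2 : M < 1 / 2) {F : ℝ → ℝ} (hF : Continuous F) :
    Tendsto (fun ρ => massFactor M ρ ^ 2 * Real.cos ρ * F ρ) (𝓝[<] (Real.pi / 2)) (𝓝 0) := by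
  have hc : ContinuousAt (fun ρ => Real.cos ρ ^ (1 - 2 * M) * (1 + Real.sin ρ) ^ (2 * M) * F ρ)
      (Real.pi / 2) := by
    refine ((Real.continuous_cos.continuousAt.rpow_const (Or.inr (by linarith))).mul
      (ContinuousAt.rpow_const (by fun_prop) (Or.inl ?_))).mul hF.continuousAt
    rw [Real.sin_pi_div_two]; norm_num
  have h := hc.tendsto
  rw [Real.cos_pi_div_two, Real.zero_rpow (by linarith), zero_mul, zero_mul] at h
  refine (h.mono_left nhdsWithin_le_nhds).congr' ?_
  filter_upwards [Ioo_mem_nhdsLT neg_half_pi_lt_half_pi] with ρ hρ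
  rw [massFactor_sq_mul_cos hρ]

theorem tendsto_massFactor_left (h1 : -(1 / 2) < M) {F : ℝ → ℝ} (hF : Continuous F) :
    Tendsto (fun ρ => massFactor M ρ ^ 2 * Real.cos ρ * F ρ) (𝓝[>] (-(Real.pi / 2))) (𝓝 0) := by
  have h := tendsto_massFactor_right (M := -M) (by linarith) (hF.comp continuous_neg)
  have hn : Tendsto (fun ρ : ℝ => -ρ) (𝓝[>] (-(Real.pi / 2))) (𝓝[<] (Real.pi / 2)) := by
    have := tendsto_neg_nhdsGT (a := -(Real.pi / 2))
    rwa [neg_neg] at this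
  refine (h.comp hn).congr fun ρ => ?_
  simp only [Function.comp_apply, massFactor_neg_arg, neg_neg, Real.cos_neg]

/-- Solutions of the Dirac equation with frequency spectrum `ℤ` related by the raising operator,
whose boundary behaviour is that of the factor `((1 + sin ρ)/(1 - sin ρ))^{M/2}`, are orthonormal
as soon as the zero mode is normalised. -/
theorem ladderModes_of_massFactor (h1 : -(1 / 2) < M) (h2 : M < 1 / 2) {U V f g : ℤ → ℝ → ℝ}
    {κ : ℤ → ℝ} (hf : ∀ n, Continuous (f n)) (hg : ∀ n, Continuous (g n))
    (hU : ∀ n ρ, U n ρ = massFactor M ρ * (Real.cos ρ * f n ρ))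
    (hV : ∀ n ρ, V n ρ = massFactor M ρ * g n ρ)
    (dU : ∀ n, ∀ ρ ∈ strip, HasDerivAt (U n) (n * V n ρ - M / Real.cos ρ * U n ρ) ρ)
    (dV : ∀ n, ∀ ρ ∈ strip, HasDerivAt (V n) (M / Real.cos ρ * V n ρ - n * U n ρ) ρ)
    (rU : ∀ n, ∀ ρ ∈ strip, κ n * U (n + 1) ρ
      = (n + 1 / 2) * (Real.cos ρ * V n ρ - Real.sin ρ * U n ρ) - M * U n ρ)
    (rV : ∀ n, ∀ ρ ∈ strip, κ n * V (n + 1) ρ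
      = M * V n ρ - (n + 1 / 2) * (Real.cos ρ * U n ρ + Real.sin ρ * V n ρ))
    (hκ : ∀ n : ℤ, κ n ^ 2 = ((n : ℝ) + 1 / 2) ^ 2 - M ^ 2) (hκ0 : ∀ n, κ n ≠ 0)
    (h0 : ∫ ρ in (-(Real.pi / 2))..(Real.pi / 2), (U 0 ρ * U 0 ρ + V 0 ρ * V 0 ρ) = 1) :
    LadderModes M (fun n => (n : ℝ)) U V κ := by
  have hint : ∀ j k, IntervalIntegrable (fun ρ => U j ρ * U k ρ + V j ρ * V k ρ)
      MeasureTheory.volume (-(Real.pi / 2)) (Real.pi / 2) := fun j k => by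
    have hc : Continuous fun ρ => Real.cos ρ ^ 2 * f j ρ * f k ρ + g j ρ * g k ρ := by
      have := hf j; have := hf k; have := hg j; have := hg k; fun_prop
    refine ((massFactor_sq_integral h1 h2).1.mul_continuousOn hc.continuousOn).congr
      fun ρ _ => ?_
    simp only [hU, hV]; ring
  -- Boundary terms containing the squared weight times `cos ρ` vanish at both ends.
  have hzero : ∀ (F F' G : ℝ → ℝ), Continuous G →
      (∀ ρ, F ρ = massFactor M ρ ^ 2 * Real.cos ρ * G ρ) →
      (∀ ρ ∈ strip, HasDerivAt F (F' ρ) ρ) →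
      IntervalIntegrable F' MeasureTheory.volume (-(Real.pi / 2)) (Real.pi / 2) →
      ∫ ρ in (-(Real.pi / 2))..(Real.pi / 2), F' ρ = 0 := fun F F' G hG hF hd hi => by
    have := intervalIntegral.integral_eq_sub_of_hasDerivAt_of_tendsto neg_half_pi_lt_half_pi hd hi
      (by rw [funext hF]; exact tendsto_massFactor_left h1 hG)
      (by rw [funext hF]; exact tendsto_massFactor_right h2 hG)
    rw [this, sub_zero]
  -- The Wronskian identity: the mass terms cancel, so modes of different frequency are orthogonal.
  have hW : ∀ j k, ∀ ρ ∈ strip, HasDerivAt (fun ρ => U j ρ * V k ρ - V j ρ * U k ρ)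
      (((j : ℝ) - k) * (U j ρ * U k ρ + V j ρ * V k ρ)) ρ := fun j k ρ hρ =>
    (((dU j ρ hρ).mul (dV k ρ hρ)).sub ((dV j ρ hρ).mul (dU k ρ hρ))).congr_deriv (by ring)
  have horth : ∀ j k, j ≠ k →
      ∫ ρ in (-(Real.pi / 2))..(Real.pi / 2), (U j ρ * U k ρ + V j ρ * V k ρ) = 0 :=
    fun j k hjk => by
      have hc : Continuous fun ρ => f j ρ * g k ρ - g j ρ * f k ρ := by
        have := hf j; have := hf k; have := hg j; have := hg k; fun_prop
      have := hzero _ _ _ hc (fun ρ => by simp only [hU, hV]; ring) (hW j k)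
        ((hint j k).const_mul _)
      rw [intervalIntegral.integral_const_mul, mul_eq_zero] at this
      refine this.resolve_left (sub_ne_zero.2 ?_)
      exact_mod_cast hjk
  have hnorm : ∀ j : ℤ,
      ∫ ρ in (-(Real.pi / 2))..(Real.pi / 2), (U (j + 1) ρ * U (j + 1) ρ + V (j + 1) ρ * V (j + 1) ρ)
        = ∫ ρ in (-(Real.pi / 2))..(Real.pi / 2), (U j ρ * U j ρ + V j ρ * V j ρ) := fun j => by
    -- Raising and lowering have opposite coefficients, so the difference of consecutive norm
    -- densities, times `κ j`, is a total derivative.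
    have hd : ∀ ρ ∈ strip, HasDerivAt (fun ρ => Real.cos ρ * (U j ρ * U (j + 1) ρ + V j ρ * V (j + 1) ρ)
        - Real.sin ρ * (U j ρ * V (j + 1) ρ - V j ρ * U (j + 1) ρ))
        (κ j * ((U (j + 1) ρ * U (j + 1) ρ + V (j + 1) ρ * V (j + 1) ρ)
          - (U j ρ * U j ρ + V j ρ * V j ρ))) ρ := fun ρ hρ => by
      have hc := (cos_pos_of_mem_strip hρ).ne'
      refine (((Real.hasDerivAt_cos ρ).mul (((dU j ρ hρ).mul (dU (j + 1) ρ hρ)).add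
        ((dV j ρ hρ).mul (dV (j + 1) ρ hρ)))).sub
        ((Real.hasDerivAt_sin ρ).mul (hW j (j + 1) ρ hρ))).congr_deriv ?_
      obtain ⟨lU, lV⟩ := lower_of_raise (rU j ρ hρ) (rV j ρ hρ) (hκ j) (hκ0 j)
        (Real.sin_sq_add_cos_sq ρ)
      have hm : M / Real.cos ρ * Real.cos ρ = M := div_mul_cancel₀ M hc
      simp only [Pi.add_apply, Pi.mul_apply]
      push_cast
      linear_combination -U (j + 1) ρ * rU j ρ hρ - V (j + 1) ρ * rV j ρ hρ + U j ρ * lU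
        + V j ρ * lV + (2 * V j ρ * V (j + 1) ρ - 2 * U j ρ * U (j + 1) ρ) * hm
    have hc : Continuous fun ρ => Real.cos ρ ^ 2 * f j ρ * f (j + 1) ρ + g j ρ * g (j + 1) ρ
        - Real.sin ρ * (f j ρ * g (j + 1) ρ - g j ρ * f (j + 1) ρ) := by
      have := hf j; have := hf (j + 1); have := hg j; have := hg (j + 1); fun_prop
    have := hzero _ _ _ hc (fun ρ => by simp only [hU, hV]; ring) hd
      (((hint (j + 1) (j + 1)).sub (hint j j)).const_mul _)
    rw [intervalIntegral.integral_const_mul, mul_eq_zero,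
      intervalIntegral.integral_sub (hint _ _) (hint _ _), sub_eq_zero] at this
    exact this.resolve_left (hκ0 j)
  refine ⟨fun n => by push_cast; rfl, dU, dV, rU, rV, hκ, hκ0, hint, fun j k => ?_⟩
  split_ifs with hjk
  · subst hjk
    induction j using Int.induction_on with
    | zero => exact h0
    | succ i ih => rw [hnorm, ih]
    | pred i ih => rw [← hnorm, sub_add_cancel, ih]
  · exact horth j k hjk

end MassFactor

section Massive

/-! ## Type III and type IV modes -/

variable {M : ℝ}

theorem massiveNorm_neg (M : ℝ) (n : ℕ) : massiveNorm (-M) n = massiveNorm M n := by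
  rw [massiveNorm, massiveNorm, sub_neg_eq_add, ← sub_eq_add_neg, mul_comm (Real.Gamma _)]

/-- The modulus of the raising coefficients of the massive modes. -/
def massiveCoeff (M : ℝ) (x : ℝ) : ℝ := Real.sqrt ((x + 1 / 2) ^ 2 - M ^ 2)

/-- For an integer `n (n + 1) ≥ 0`, hence `(n + 1/2)² ≥ 1/4 > M²`. -/
theorem massiveCoeff_arg_pos (h1 : -(1 / 2) < M) (h2 : M < 1 / 2) (n : ℤ) :
    0 < ((n : ℝ) + 1 / 2) ^ 2 - M ^ 2 := by
  have h : (0 : ℝ) ≤ n * (n + 1) := by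
    rcases le_or_gt 0 n with h | h
    · have : (0 : ℝ) ≤ n := by exact_mod_cast h
      positivity
    · have h3 : (n : ℝ) + 1 ≤ 0 := by exact_mod_cast h
      nlinarith
  nlinarith

/-- By the Gamma recursion the normalisation absorbs the factor `m + 1` from the Jacobi recurrences
and replaces it by the raising coefficient. -/
theorem massiveNorm_succ (h1 : -(1 / 2) < M) (h2 : M < 1 / 2) (m : ℕ) :
    massiveCoeff M m * massiveNorm M (m + 1) = (m + 1) * massiveNorm M m := by
  have ha : 0 < 1 / 2 + M + m := by have := m.cast_nonneg (α := ℝ); linarith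
  have hb : 0 < 1 / 2 - M + m := by have := m.cast_nonneg (α := ℝ); linarith
  have hga := Real.Gamma_pos_of_pos ha
  have hgb := Real.Gamma_pos_of_pos hb
  have hs : Real.sqrt (Real.Gamma (1 / 2 + M + m) * Real.Gamma (1 / 2 - M + m)) ≠ 0 :=
    (Real.sqrt_pos.2 (mul_pos hga hgb)).ne'
  have hk : Real.sqrt ((1 / 2 + M + m) * (1 / 2 - M + m)) ≠ 0 := (Real.sqrt_pos.2 (mul_pos ha hb)).ne'
  rw [massiveCoeff, massiveNorm, massiveNorm, Nat.factorial_succ]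
  push_cast
  rw [← add_assoc, ← add_assoc, Real.Gamma_add_one ha.ne', Real.Gamma_add_one hb.ne',
    mul_mul_mul_comm, Real.sqrt_mul (mul_pos ha hb).le,
    show ((m : ℝ) + 1 / 2) ^ 2 - M ^ 2 = (1 / 2 + M + m) * (1 / 2 - M + m) by ring]
  generalize Real.sqrt ((1 / 2 + M + m) * (1 / 2 - M + m)) = A at hk ⊢
  generalize Real.sqrt (Real.Gamma (1 / 2 + M + m) * Real.Gamma (1 / 2 - M + m)) = B at hs ⊢
  field_simp

/-- The first component of the type III modes of frequency `n ≥ 0`. -/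
def massiveFst (M : ℝ) (n : ℕ) (ρ : ℝ) : ℝ :=
  massiveNorm M n * massFactor M ρ * (Real.cos ρ * jacobiFst M n (Real.sin ρ))

/-- The second component of the type III modes of frequency `n ≥ 0`. -/
def massiveSnd (M : ℝ) (n : ℕ) (ρ : ℝ) : ℝ :=
  massiveNorm M n * massFactor M ρ * jacobiSnd M n (Real.sin ρ)

theorem hasDerivAt_massiveFst (h2 : M < 1 / 2) (n : ℕ) {ρ : ℝ} (hρ : ρ ∈ strip) :
    HasDerivAt (massiveFst M n) (n * massiveSnd M n ρ - M / Real.cos ρ * massiveFst M n ρ) ρ := by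
  obtain ⟨d, hd, hd'⟩ := hasDerivAt_jacobiFst h2 n (Real.sin ρ)
  have hc := (cos_pos_of_mem_strip hρ).ne'
  have h := ((hasDerivAt_massFactor (M := M) hρ).const_mul (massiveNorm M n)).mul
    ((Real.hasDerivAt_cos ρ).mul (hd.comp ρ (Real.hasDerivAt_sin ρ)))
  refine h.congr_deriv ?_
  have h6 : 1 - Real.sin ρ ^ 2 = Real.cos ρ ^ 2 := by
    linear_combination -Real.sin_sq_add_cos_sq ρ
  rw [h6] at hd'
  have hm : M / Real.cos ρ * Real.cos ρ = M := div_mul_cancel₀ M hc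
  simp only [massiveFst, massiveSnd, Function.comp_apply, Pi.mul_apply]
  linear_combination massiveNorm M n * massFactor M ρ * hd'
    + 2 * massiveNorm M n * massFactor M ρ * jacobiFst M n (Real.sin ρ) * hm

theorem hasDerivAt_massiveSnd (h2 : M < 1 / 2) (n : ℕ) {ρ : ℝ} (hρ : ρ ∈ strip) :
    HasDerivAt (massiveSnd M n) (M / Real.cos ρ * massiveSnd M n ρ - n * massiveFst M n ρ) ρ := by
  have h := ((hasDerivAt_massFactor (M := M) hρ).const_mul (massiveNorm M n)).mul
    ((hasDerivAt_jacobiSnd h2 n (Real.sin ρ)).comp ρ (Real.hasDerivAt_sin ρ))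
  refine h.congr_deriv ?_
  simp only [massiveFst, massiveSnd, Function.comp_apply]
  ring

theorem massive_raise (h1 : -(1 / 2) < M) (h2 : M < 1 / 2) (n : ℕ) (ρ : ℝ) :
    -massiveCoeff M n * massiveFst M (n + 1) ρ
      = (n + 1 / 2) * (Real.cos ρ * massiveSnd M n ρ - Real.sin ρ * massiveFst M n ρ)
        - M * massiveFst M n ρ ∧
    -massiveCoeff M n * massiveSnd M (n + 1) ρ
      = M * massiveSnd M n ρ
        - (n + 1 / 2) * (Real.cos ρ * massiveFst M n ρ + Real.sin ρ * massiveSnd M n ρ) := by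
  have hN := massiveNorm_succ h1 h2 n
  have hF := jacobiFst_succ h2 n (Real.sin ρ)
  have hS := jacobiSnd_succ h2 n (Real.sin ρ)
  simp only [massiveFst, massiveSnd]
  constructor
  · linear_combination -(massFactor M ρ * Real.cos ρ * jacobiFst M (n + 1) (Real.sin ρ)) * hN
      - massiveNorm M n * massFactor M ρ * Real.cos ρ * hF
  · linear_combination -(massFactor M ρ * jacobiSnd M (n + 1) (Real.sin ρ)) * hN
      - massiveNorm M n * massFactor M ρ * hS
      + (n + 1 / 2) * massiveNorm M n * massFactor M ρ * jacobiFst M n (Real.sin ρ)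
        * Real.sin_sq_add_cos_sq ρ

theorem massive_lower (h1 : -(1 / 2) < M) (h2 : M < 1 / 2) (n : ℕ) (ρ : ℝ) :
    (n + 1 / 2) * (Real.cos ρ * massiveSnd M (n + 1) ρ + Real.sin ρ * massiveFst M (n + 1) ρ)
        - M * massiveFst M (n + 1) ρ = massiveCoeff M n * massiveFst M n ρ ∧
    M * massiveSnd M (n + 1) ρ
        - (n + 1 / 2) * (Real.cos ρ * massiveFst M (n + 1) ρ - Real.sin ρ * massiveSnd M (n + 1) ρ)
      = massiveCoeff M n * massiveSnd M n ρ := by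
  have hpos := massiveCoeff_arg_pos h1 h2 n
  rw [Int.cast_natCast] at hpos
  obtain ⟨hr1, hr2⟩ := massive_raise h1 h2 n ρ
  have := lower_of_raise hr1 hr2 (by rw [neg_sq, massiveCoeff, Real.sq_sqrt hpos.le])
    (neg_ne_zero.2 (Real.sqrt_pos.2 hpos).ne') (Real.sin_sq_add_cos_sq ρ)
  rwa [neg_neg] at this

/-- The sign relating the modes of frequency `±n`. -/
def freqSign (n : ℤ) : ℝ := if n < 0 then -1 else 1

theorem freqSign_mul_self (n : ℤ) : freqSign n * freqSign n = 1 := by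
  rw [freqSign]; split_ifs <;> norm_num

/-- The raising coefficients of the type III modes. -/
def typeIIICoeff (M : ℝ) (n : ℤ) : ℝ := (if n < -1 then 1 else -1) * massiveCoeff M n

theorem freqSign_mul_natAbs (n : ℤ) : freqSign n * n.natAbs = n := by
  rw [freqSign]
  split_ifs with h
  · rw [← Int.cast_natCast, Int.natCast_natAbs, abs_of_neg h]; push_cast; ring
  · rw [← Int.cast_natCast, Int.natCast_natAbs, abs_of_nonneg (not_lt.1 h)]; ring

theorem massiveFst_zero (M ρ : ℝ) : massiveFst M 0 ρ = 0 := by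
  rw [massiveFst, jacobiFst_zero, mul_zero, mul_zero]

/-- Modes of opposite nonzero frequency differ by the sign of the second component, so raising below
zero is lowering above zero. The step from `-1` is separate: the zero mode carries sign `+1`, which
flips the coefficient, and its first component vanishes. -/
theorem typeIII_raise (h1 : -(1 / 2) < M) (h2 : M < 1 / 2) (n : ℤ) (ρ : ℝ) :
    typeIIICoeff M n * massiveFst M (n + 1).natAbs ρ
      = (n + 1 / 2) * (Real.cos ρ * (freqSign n * massiveSnd M n.natAbs ρ)
        - Real.sin ρ * massiveFst M n.natAbs ρ) - M * massiveFst M n.natAbs ρ ∧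
    typeIIICoeff M n * (freqSign (n + 1) * massiveSnd M (n + 1).natAbs ρ)
      = M * (freqSign n * massiveSnd M n.natAbs ρ)
        - (n + 1 / 2) * (Real.cos ρ * massiveFst M n.natAbs ρ
          + Real.sin ρ * (freqSign n * massiveSnd M n.natAbs ρ)) := by
  obtain ⟨m, rfl⟩ | rfl | ⟨m, rfl⟩ : (∃ m : ℕ, n = m) ∨ n = -1 ∨ ∃ m : ℕ, n = -(m + 1 : ℕ) - 1 := by
    rcases le_or_gt 0 n with h | h
    · exact Or.inl ⟨n.toNat, by omega⟩
    · rcases eq_or_ne n (-1) with h' | h'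
      · exact Or.inr (Or.inl h')
      · exact Or.inr (Or.inr ⟨(-n - 2).toNat, by omega⟩)
  · have e1 : ((m : ℤ) + 1).natAbs = m + 1 := by omega
    rw [typeIIICoeff, freqSign, freqSign, e1, Int.natAbs_natCast, if_neg (by omega),
      if_neg (by omega), if_neg (by omega), Int.cast_natCast]
    simpa using massive_raise h1 h2 m ρ
  · obtain ⟨l1, l2⟩ := massive_lower h1 h2 0 ρ
    have e : massiveCoeff M ((-1 : ℤ) : ℝ) = massiveCoeff M ((0 : ℕ) : ℝ) := by
      simp only [massiveCoeff]; norm_num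
    rw [massiveFst_zero] at l1
    simp only [typeIIICoeff, freqSign, e, zero_add] at l1 l2 ⊢
    norm_num [massiveFst_zero] at l1 l2 ⊢
    constructor
    · linear_combination -l1
    · linear_combination l2
  · obtain ⟨l1, l2⟩ := massive_lower h1 h2 (m + 1) ρ
    have e : massiveCoeff M ((-(m + 1 : ℕ) - 1 : ℤ) : ℝ) = massiveCoeff M ((m + 1 : ℕ) : ℝ) := by
      simp only [massiveCoeff]; push_cast; congr 1; ring
    have e1 : (-((m + 1 : ℕ) : ℤ) - 1 + 1).natAbs = m + 1 := by omega
    have e2 : (-((m + 1 : ℕ) : ℤ) - 1).natAbs = m + 1 + 1 := by omega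
    rw [typeIIICoeff, freqSign, freqSign, e, e1, e2, if_pos (by omega), if_pos (by omega),
      if_pos (by omega)]
    push_cast at l1 l2 ⊢
    constructor
    · linear_combination -l1
    · linear_combination l2

theorem ladderModes_typeIII (h1 : -(1 / 2) < M) (h2 : M < 1 / 2) :
    LadderModes M (fun n => (n : ℝ)) (fun n => massiveFst M n.natAbs)
      (fun n ρ => freqSign n * massiveSnd M n.natAbs ρ) (typeIIICoeff M) := by
  have hcont1 : ∀ n, Continuous (jacobiFst M n) := fun n =>
    continuous_iff_continuousAt.2 fun x => by
      obtain ⟨d, hd, -⟩ := hasDerivAt_jacobiFst h2 n x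
      exact hd.continuousAt
  have hcont2 : ∀ n, Continuous (jacobiSnd M n) := fun n =>
    continuous_iff_continuousAt.2 fun x => (hasDerivAt_jacobiSnd h2 n x).continuousAt
  refine ladderModes_of_massFactor h1 h2
    (f := fun n ρ => massiveNorm M n.natAbs * jacobiFst M n.natAbs (Real.sin ρ))
    (g := fun n ρ => freqSign n * (massiveNorm M n.natAbs * jacobiSnd M n.natAbs (Real.sin ρ)))
    (fun n => ((hcont1 n.natAbs).comp Real.continuous_sin).const_mul _)
    (fun n => (((hcont2 n.natAbs).comp Real.continuous_sin).const_mul _).const_mul _)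
    (fun n ρ => by rw [massiveFst]; ring) (fun n ρ => by rw [massiveSnd]; ring)
    (fun n ρ hρ => ?_) (fun n ρ hρ => ?_) (fun n ρ _ => (typeIII_raise h1 h2 n ρ).1)
    (fun n ρ _ => (typeIII_raise h1 h2 n ρ).2) (fun n => ?_) (fun n => ?_) ?_
  · refine (hasDerivAt_massiveFst h2 n.natAbs hρ).congr_deriv ?_
    linear_combination massiveSnd M n.natAbs ρ * freqSign n * freqSign_mul_natAbs n
      - n.natAbs * massiveSnd M n.natAbs ρ * freqSign_mul_self n
  · refine ((hasDerivAt_massiveSnd h2 n.natAbs hρ).const_mul (freqSign n)).congr_deriv ?_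
    linear_combination -massiveFst M n.natAbs ρ * freqSign_mul_natAbs n
  · have hp := massiveCoeff_arg_pos h1 h2 n
    rw [typeIIICoeff, mul_pow, massiveCoeff, Real.sq_sqrt hp.le]
    split_ifs <;> norm_num
  · have hp := Real.sqrt_pos.2 (massiveCoeff_arg_pos h1 h2 n)
    rw [typeIIICoeff]
    refine mul_ne_zero ?_ hp.ne'
    split_ifs <;> norm_num
  -- The zero mode density is `4 N_0²` times the squared weight, and `N_0` was chosen to cancel the
  -- Beta integral.
  · have hga := Real.Gamma_pos_of_pos (show 0 < 1 / 2 + M by linarith)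
    have hgb := Real.Gamma_pos_of_pos (show 0 < 1 / 2 - M by linarith)
    have e : ∀ ρ, massiveFst M (0 : ℤ).natAbs ρ * massiveFst M (0 : ℤ).natAbs ρ
        + freqSign 0 * massiveSnd M (0 : ℤ).natAbs ρ * (freqSign 0 * massiveSnd M (0 : ℤ).natAbs ρ)
        = 4 * massiveNorm M 0 ^ 2 * massFactor M ρ ^ 2 := fun ρ => by
      rw [Int.natAbs_zero, massiveFst_zero, massiveSnd, jacobiSnd_zero h2]
      linear_combination (4 * massiveNorm M 0 ^ 2 * massFactor M ρ ^ 2) * freqSign_mul_self 0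
    simp only [e]
    rw [intervalIntegral.integral_const_mul, (massFactor_sq_integral h1 h2).2, massiveNorm]
    simp only [Nat.factorial_zero, Nat.cast_one, Nat.cast_zero, add_zero, div_pow, mul_pow, one_pow,
      Real.sq_sqrt (mul_pos hga hgb).le]
    generalize Real.Gamma (1 / 2 + M) = A at hga ⊢
    generalize Real.Gamma (1 / 2 - M) = B at hgb ⊢
    field_simp
    norm_num

theorem typeIIIMode_eq (h2 : M < 1 / 2) (n : ℤ) : typeIIIMode M n
    = stationaryField n (massiveFst M n.natAbs)
      (fun ρ => freqSign n * massiveSnd M n.natAbs ρ) := by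
  unfold typeIIIMode stationaryField
  congr 1
  funext t ρ
  rcases lt_trichotomy n 0 with hn | rfl | hn
  · have hn' : ¬ n.natAbs = 0 := by omega
    ext i
    fin_cases i
    · simp [hn.ne, hn', massiveFst, jacobiFst, massFactor]; ring
    · simp [hn.ne, hn, freqSign, massiveSnd, jacobiSnd, massFactor, Int.sign_eq_neg_one_of_neg hn]
      ring
  · ext i
    fin_cases i
    · simp [massiveFst_zero]
    · simp [massiveSnd, jacobiSnd_zero h2, freqSign, massFactor]
  · have hn' : ¬ n.natAbs = 0 := by omega
    ext i
    fin_cases i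
    · simp [hn.ne', hn', massiveFst, jacobiFst, massFactor]; ring
    · simp [hn.ne', hn.not_gt, freqSign, massiveSnd, jacobiSnd, massFactor,
        Int.sign_eq_one_of_pos hn]
      ring

/-- The rotation `(U, V) ↦ (-V, U)`, combined with signs, exchanges the modes of mass `±M`. -/
theorem LadderModes.rotate {ω : ℤ → ℝ} {U V : ℤ → ℝ → ℝ} {κ σ : ℤ → ℝ}
    (h : LadderModes M ω U V κ) (hσ : ∀ n, σ n * σ n = 1) :
    LadderModes (-M) ω (fun n ρ => -(σ n * V n ρ)) (fun n ρ => σ n * U n ρ)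
      (fun n => σ n * σ (n + 1) * κ n) where
  freq_succ := h.freq_succ
  deriv_fst n ρ hρ := (((h.deriv_snd n ρ hρ).const_mul (σ n)).neg).congr_deriv (by ring)
  deriv_snd n ρ hρ := ((h.deriv_fst n ρ hρ).const_mul (σ n)).congr_deriv (by ring)
  raise_fst n ρ hρ := by
    linear_combination -(σ n) * h.raise_snd n ρ hρ
      - σ n * κ n * V (n + 1) ρ * hσ (n + 1)
  raise_snd n ρ hρ := by
    linear_combination σ n * h.raise_fst n ρ hρ
      + σ n * κ n * U (n + 1) ρ * hσ (n + 1)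
  coeff_sq n := by
    linear_combination h.coeff_sq n + κ n ^ 2 * (σ (n + 1) * σ (n + 1)) * hσ n
      + κ n ^ 2 * hσ (n + 1)
  coeff_ne_zero n := mul_ne_zero (mul_ne_zero (left_ne_zero_of_mul_eq_one (hσ n))
    (left_ne_zero_of_mul_eq_one (hσ (n + 1)))) (h.coeff_ne_zero n)
  integrable j k := ((h.integrable j k).const_mul (σ j * σ k)).congr fun ρ _ => by
    ring
  integral j k := by
    have e : ∀ ρ, -(σ j * V j ρ) * -(σ k * V k ρ) + σ j * U j ρ * (σ k * U k ρ)
        = σ j * σ k * (U j ρ * U k ρ + V j ρ * V k ρ) := fun ρ => by ring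
    simp only [e]
    rw [intervalIntegral.integral_const_mul, h.integral]
    split_ifs with hjk
    · rw [hjk, hσ, mul_one]
    · rw [mul_zero]

theorem massFactor_neg (M ρ : ℝ) :
    massFactor (-M) ρ = ((1 - Real.sin ρ) / (1 + Real.sin ρ)) ^ (M / 2) := by
  rw [← massFactor_neg_arg, massFactor, Real.sin_neg, sub_neg_eq_add, ← sub_eq_add_neg]

/-- These are the rotated type III modes of mass `-M`. Taking `freqSign` as the sign `σ` of
`LadderModes.rotate` cancels the sign in the first component and moves it to the second. -/
theorem typeIVMode_eq (h1 : -(1 / 2) < M) (n : ℤ) : typeIVMode M n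
    = stationaryField n
      (fun ρ => -(freqSign n * (freqSign n * massiveSnd (-M) n.natAbs ρ)))
      (fun ρ => freqSign n * massiveFst (-M) n.natAbs ρ) := by
  unfold typeIVMode stationaryField
  congr 1
  funext t ρ
  simp only [← mul_assoc, freqSign_mul_self, one_mul]
  rcases lt_trichotomy n 0 with hn | rfl | hn
  · have hn' : ¬ n.natAbs = 0 := by omega
    ext i
    fin_cases i
    · simp [hn.ne, massiveSnd, jacobiSnd, massFactor_neg, massiveNorm_neg, sub_eq_add_neg]; ring
    · simp [hn.ne, hn, hn', freqSign, massiveFst, jacobiFst, massFactor_neg, massiveNorm_neg,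
        Int.sign_eq_neg_one_of_neg hn, sub_eq_add_neg]
      ring
  · ext i
    fin_cases i
    · simp [massiveSnd, jacobiSnd_zero (M := -M) (by linarith), massFactor_neg, massiveNorm_neg]
    · simp [massiveFst_zero]
  · have hn' : ¬ n.natAbs = 0 := by omega
    ext i
    fin_cases i
    · simp [hn.ne', massiveSnd, jacobiSnd, massFactor_neg, massiveNorm_neg, sub_eq_add_neg]; ring
    · simp [hn.ne', hn.not_gt, hn', freqSign, massiveFst, jacobiFst, massFactor_neg,
        massiveNorm_neg, Int.sign_eq_one_of_pos hn, sub_eq_add_neg]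
      ring

/-! ## The theories -/

theorem excitation_pos_of_ne_zero {j : ℤ} (hj : j ≠ 0) : 0 < excitation (fun n => (n : ℝ)) j := by
  rw [excitation]
  split_ifs with h
  · exact_mod_cast lt_of_le_of_ne h hj.symm
  · rw [neg_pos]; exact_mod_cast not_le.1 h

theorem excitation_zero : excitation (fun n => (n : ℝ)) 0 = 0 := by simp [excitation]

theorem exists_charges_of_zero_mode {U V : ℤ → ℝ → ℝ} {κ : ℤ → ℝ}
    (hM1 : -(1 / 2) < M) (hM2 : M < 1 / 2) {mode : ℤ → SpinorField}
    (h : LadderModes M (fun n => (n : ℝ)) U V κ)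
    (hmode : mode = fun n : ℤ => stationaryField n (U n) (V n)) :
    IsOrthonormalModes mode ∧
      ∃ L₀ Lp Lm : FockDomain →ₗ[ℂ] FockDomain,
        AreCharges mode (fun j => (j : ℝ)) ((1 / 4 - M ^ 2) / 2) L₀ Lp Lm ∧
        IsUnitarySl2Action L₀ Lp Lm ∧
        IsWeightModuleWithLowest L₀ ((1 / 4 - M ^ 2) / 2) ∧
        Module.End.eigenspace L₀ (((1 / 4 - M ^ 2) / 2 : ℝ) : ℂ)
          = Submodule.span ℂ {vacuum, create 0 vacuum} ∧
        Module.finrank ℂ (Module.End.eigenspace L₀ (((1 / 4 - M ^ 2) / 2 : ℝ) : ℂ)) = 2 ∧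
        ∀ α : ℂ,
          (‖α‖ ≤ 1 → ‖toL2 (vacuumFamily α)‖ = 1) ∧
          L₀ (vacuumFamily α) = ((1 / 4 - M ^ 2) / 2) • vacuumFamily α ∧
          Lm (vacuumFamily α) = 0 ∧
          GeneratesDiscreteSeries L₀ Lp Lm (vacuumFamily α) ((1 / 4 - M ^ 2) / 2) := by
  subst hmode
  have hd : (1 : ℤ) ≠ 0 := by norm_num
  have hd' : (-1 : ℤ) ≠ 0 := by norm_num
  have hpos : 0 < (1 / 4 - M ^ 2) / 2 := by nlinarith
  -- At frequency `-1` the squared coefficient is `(-1/2)² - M²`, which fixes the constant.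
  have hact := h.isUnitarySl2Action hd hd' (c := (1 / 4 - M ^ 2) / 2) (by
    rw [h.coeff_sq]; push_cast; ring)
  have heig := eigenspace_numberCharge_lowest excitation_zero
    (fun j hj => excitation_pos_of_ne_zero hj) ((1 / 4 - M ^ 2) / 2)
  refine ⟨h.isOrthonormalModes, _, _, _, h.areCharges hd hd' ((1 / 4 - M ^ 2) / 2), hact,
    isWeightModuleWithLowest_numberCharge (fun j => ?_) _, heig, ?_, fun α => ?_⟩
  · by_cases hj : j = 0
    · rw [hj, excitation_zero]
    · exact (excitation_pos_of_ne_zero hj).le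
  · rw [heig]; exact finrank_span_vacuum_pair
  · have hmem : vacuumFamily α ∈ Module.End.eigenspace
        (numberCharge (excitation fun n => (n : ℝ)) ((1 / 4 - M ^ 2) / 2))
        (((1 / 4 - M ^ 2) / 2 : ℝ) : ℂ) := by
      rw [heig]
      exact Submodule.mem_span_pair.2 ⟨_, _, rfl⟩
    have hΩ := Module.End.mem_eigenspace_iff.1 hmem
    have hΩ' : shiftCharge (fun n => Complex.I * κ (n - 1)) hd' (vacuumFamily α) = 0 := by
      rw [vacuumFamily, map_add, map_smul, map_smul, shiftCharge_neg_one_vacuum,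
        lowering_create_zero_vacuum, smul_zero, smul_zero, add_zero]
    refine ⟨norm_vacuumFamily, ?_, hΩ',
      generatesDiscreteSeries hact hpos hΩ hΩ' (vacuumFamily_ne_zero α)⟩
    rw [real_smul_eq]; exact hΩ

theorem exists_charges_of_zeroModeTheory {mode : ℤ → SpinorField} (h : IsZeroModeTheory M mode) :
    -(1 / 2) < M ∧ M < 1 / 2 ∧ ∃ U V κ, LadderModes M (fun n => (n : ℝ)) U V κ ∧
      mode = fun n : ℤ => stationaryField n (U n) (V n) := by
  rcases h with ⟨rfl, βp, -, βm, -, j₀, hj, rfl⟩ | ⟨h0, h2, rfl⟩ | ⟨h0, h2, rfl⟩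
  · have hf : ∀ n, masslessFreq βp βm (j₀ + n) = n := fun n => by rw [masslessFreq_add, hj, zero_add]
    have hl := (ladderModes_massless βp βm fun n => by
      have := hf (n - j₀)
      rw [add_sub_cancel] at this
      rw [this]
      intro h
      -- Integer frequencies never equal `-1/2`, by parity.
      have h' : ((2 * (n - j₀) + 1 : ℤ) : ℝ) = 0 := by push_cast at h ⊢; linarith
      have : 2 * (n - j₀) + 1 = 0 := by exact_mod_cast h'
      omega).shift j₀
    simp only [hf] at hl
    refine ⟨by norm_num, by norm_num, _, _, _, hl, funext fun n => ?_⟩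
    rw [masslessMode_eq, hf]
  · exact ⟨by linarith, h2, _, _, _, ladderModes_typeIII (by linarith) h2,
      funext fun n => typeIIIMode_eq h2 n⟩
  · have hl := (ladderModes_typeIII (M := -M) (by linarith) (by linarith)).rotate freqSign_mul_self
    rw [neg_neg] at hl
    exact ⟨by linarith, h2, _, _, _, hl, funext fun n => typeIVMode_eq (by linarith) n⟩

end Massive

end

end AdS2Dirac

/-! ### The theories without and with a zero frequency -/

theorem mainTheorem5 :
    -- massless theories without zero frequency, lowest positive frequency `μ ≠ 1/2`
    (∀ βp ∈ Set.Icc 0 Real.pi, ∀ βm ∈ Set.Icc 0 Real.pi, ∀ (j₀ : ℤ) (μ : ℝ),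
      μ = AdS2Dirac.masslessFreq βp βm j₀ → 0 < μ → μ < 1 → μ ≠ 1 / 2 →
      AdS2Dirac.IsOrthonormalModes (fun j => AdS2Dirac.masslessMode βp βm (j₀ + j)) ∧
      ∃ L₀ Lp Lm : AdS2Dirac.FockDomain →ₗ[ℂ] AdS2Dirac.FockDomain,
        AdS2Dirac.AreCharges (fun j => AdS2Dirac.masslessMode βp βm (j₀ + j))
          (fun j => AdS2Dirac.masslessFreq βp βm (j₀ + j)) ((μ - 1 / 2) ^ 2 / 2) L₀ Lp Lm ∧
        AdS2Dirac.IsUnitarySl2Action L₀ Lp Lm ∧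
        AdS2Dirac.IsWeightModuleWithLowest L₀ ((μ - 1 / 2) ^ 2 / 2) ∧
        L₀ AdS2Dirac.vacuum = ((μ - 1 / 2) ^ 2 / 2) • AdS2Dirac.vacuum ∧
        Lm AdS2Dirac.vacuum = 0 ∧
        AdS2Dirac.GeneratesDiscreteSeries L₀ Lp Lm AdS2Dirac.vacuum ((μ - 1 / 2) ^ 2 / 2)) ∧
    -- massless theories with a zero frequency, and type III and type IV theories
    (∀ (M : ℝ) (mode : ℤ → AdS2Dirac.SpinorField), AdS2Dirac.IsZeroModeTheory M mode →
      AdS2Dirac.IsOrthonormalModes mode ∧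
      ∃ L₀ Lp Lm : AdS2Dirac.FockDomain →ₗ[ℂ] AdS2Dirac.FockDomain,
        AdS2Dirac.AreCharges mode (fun j => (j : ℝ)) ((1 / 4 - M ^ 2) / 2) L₀ Lp Lm ∧
        AdS2Dirac.IsUnitarySl2Action L₀ Lp Lm ∧
        AdS2Dirac.IsWeightModuleWithLowest L₀ ((1 / 4 - M ^ 2) / 2) ∧
        Module.End.eigenspace L₀ (((1 / 4 - M ^ 2) / 2 : ℝ) : ℂ)
          = Submodule.span ℂ {AdS2Dirac.vacuum, AdS2Dirac.create 0 AdS2Dirac.vacuum} ∧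
        Module.finrank ℂ (Module.End.eigenspace L₀ (((1 / 4 - M ^ 2) / 2 : ℝ) : ℂ)) = 2 ∧
        ∀ α : ℂ,
          (‖α‖ ≤ 1 → ‖AdS2Dirac.toL2 (AdS2Dirac.vacuumFamily α)‖ = 1) ∧
          L₀ (AdS2Dirac.vacuumFamily α) = ((1 / 4 - M ^ 2) / 2) • AdS2Dirac.vacuumFamily α ∧
          Lm (AdS2Dirac.vacuumFamily α) = 0 ∧
          AdS2Dirac.GeneratesDiscreteSeries L₀ Lp Lm (AdS2Dirac.vacuumFamily α)
            ((1 / 4 - M ^ 2) / 2)) := by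
  refine ⟨fun βp _ βm _ j₀ μ hμ h0 h1 hne => ?_, fun M mode h => ?_⟩
  · have hf : ∀ n, AdS2Dirac.masslessFreq βp βm (j₀ + n) = μ + n := fun n => by
      rw [AdS2Dirac.masslessFreq_add, hμ]
    have hl := (AdS2Dirac.ladderModes_massless βp βm fun n => by
      have := hf (n - j₀)
      rw [add_sub_cancel] at this
      rw [this]
      intro h
      -- As `0 < μ < 1`, the frequency `-1/2` could only occur at shift `-1`, and this would force
      -- `μ = 1/2`.
      have h2 : (-1 : ℝ) < ((n - j₀ + 1 : ℤ) : ℝ) := by push_cast at h ⊢; linarith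
      have h3 : ((n - j₀ : ℤ) : ℝ) < 0 := by linarith
      have h4 : -1 < n - j₀ + 1 := by exact_mod_cast h2
      have h5 : n - j₀ < 0 := by exact_mod_cast h3
      have h6 : n - j₀ = -1 := by omega
      rw [h6] at h
      push_cast at h
      exact hne (by linarith)).shift j₀
    have hd : (1 : ℤ) ≠ 0 := by norm_num
    have hd' : (-1 : ℤ) ≠ 0 := by norm_num
    have hpos : 0 < (μ - 1 / 2) ^ 2 / 2 := by
      have := sq_pos_of_ne_zero (sub_ne_zero.2 hne)
      linarith
    have hact := hl.isUnitarySl2Action hd hd' (c := (μ - 1 / 2) ^ 2 / 2) (by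
      rw [hl.coeff_sq, hf]; push_cast; ring)
    have hmode : (fun j => AdS2Dirac.masslessMode βp βm (j₀ + j))
        = fun j => AdS2Dirac.stationaryField (AdS2Dirac.masslessFreq βp βm (j₀ + j))
          (AdS2Dirac.masslessFst βp βm (j₀ + j)) (AdS2Dirac.masslessSnd βp βm (j₀ + j)) :=
      funext fun j => AdS2Dirac.masslessMode_eq βp βm (j₀ + j)
    have hΩ := AdS2Dirac.numberCharge_vacuum
      (AdS2Dirac.excitation fun j => AdS2Dirac.masslessFreq βp βm (j₀ + j)) ((μ - 1 / 2) ^ 2 / 2)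
    rw [hmode]
    refine ⟨hl.isOrthonormalModes, _, _, _, hl.areCharges hd hd' _, hact,
      AdS2Dirac.isWeightModuleWithLowest_numberCharge (fun j => ?_) _, ?_,
      AdS2Dirac.shiftCharge_neg_one_vacuum _ hd',
      AdS2Dirac.generatesDiscreteSeries hact hpos hΩ (AdS2Dirac.shiftCharge_neg_one_vacuum _ hd')
        (by simp [AdS2Dirac.vacuum])⟩
    -- Antiparticle energies are `-(μ + j)` with `j ≤ -1`, nonnegative because `μ < 1`.
    · rw [AdS2Dirac.excitation, hf]
      split_ifs with hj
      · have : (0 : ℝ) ≤ j := by exact_mod_cast hj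
        linarith
      · have : (j : ℝ) + 1 ≤ 0 := by exact_mod_cast not_le.1 hj
        linarith
    · rw [AdS2Dirac.real_smul_eq]; exact hΩ
  · obtain ⟨hM1, hM2, U, V, κ, hl, hmode⟩ := AdS2Dirac.exists_charges_of_zeroModeTheory h
    exact AdS2Dirac.exists_charges_of_zero_mode hM1 hM2 hl hmode
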